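/- Let $n\ge 1$ and let $q,t$ be either indeterminates over $\mathbb{Q}$ or real parameters with $0<q,t<1$; let $K$ be a field containing $\mathbb{Q}(q,t)$ (an extension of $\mathbb{R}$ in the second case). On rational functions of $x=(x_1,\dots,x_n)$ put, for $1\le i\le n-1$, $$T_i=t+\frac{tx_i-x_{i+1}}{x_i-x_{i+1}}(s_i-1),\qquad T_i^{-1}=t^{-1}-1+t^{-1}T_i,$$ where $s_i$ exchanges $x_i$ and $x_{i+1}$; $T_\sigma=T_{i_1}\cdots T_{i_p}$ for a reduced word $\sigma=s_{i_1}\cdots s_{i_p}\in S_n$; and $U^-=\sum_{\sigma\in S_n}(-t)^{-l(\sigma)}T_\sigma$, where $l(\sigma)$ is the number of inversions of $\sigma$. Put $\Delta_a(z)=\prod_{1\le i<j\le n}(az_i-z_j)$. Let $\omega=s_{n-1}\cdots s_1\tau_1$, where $\tau_1$ replaces $x_1$ by $qx_1$, and $Y_i=t^{-n+i}T_i\cdots T_{n-1}\,\omega\,T_1^{-1}\cdots T_{i-1}^{-1}$ for $1\le i\le n$. For a composition $\eta\in\mathbb{Z}_{\ge0}^n$ let $\eta^+$ be its decreasing rearrangement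 and let $$l'_\eta(i)=\#\{k<i:\eta_k\ge\eta_i\}+\#\{k>i:\eta_k>\eta_i\},\qquad e_i(\eta)=q^{\eta_i}t^{-l'_\eta(i)}.$$ For compositions of the same modulus, $\nu<\eta$ denotes strict dominance order ($\nu\neq\eta$ and $\sum_{i\le p}\nu_i\le\sum_{i\le p}\eta_i$ for all $p$), and $\nu\prec\eta$ means $\nu^+<\eta^+$, or $\nu^+=\eta^+$ and $\nu<\eta$. The non-symmetric Macdonald polynomial $E_\eta(x;q,t)$ is the unique polynomial of the form $x^\eta+\sum_{\nu\prec\eta}b_{\eta\nu}x^\nu$ with $Y_iE_\eta=e_i(\eta)E_\eta$ for all $i$. For a partition $\kappa$ with $n$ distinct parts (one of which may be $0$), the $q$-antisymmetric Macdonald polynomial $S_\kappa(x;q,t)$ is the unique polynomial of the form $U^-x^\kappa+\sum_{\mu<\kappa}v_{\kappa\mu}U^-x^\mu$ ($\mu$ running over partitions with $n$ distinct parts) with $\left(\sum_iY_i\right)S_\kappa=\left(\sum_ie_i(\kappa)\right)S_\kappa$. If $\eta$ has distinct parts, $\beta_\eta(q,t)$ is the scalar defined by $S_{\eta^+}=\beta_\eta(q,t)^{-1}\,U^-E_\eta$.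 For a node $s=(i,j)$, $1\le j\le\eta_i$, let $a(s)=\eta_i-j$ and $l(s)=\#\{k>i: j\le\eta_k\le\eta_i\}+\#\{k<i: j\le\eta_k+1\le\eta_i\}$, and put $$d_\eta(q,t)=\prod_{s\in\eta}\left(1-q^{a(s)+1}t^{l(s)+1}\right),\quad d'_\eta(q,t)=\prod_{s\in\eta}\left(1-q^{a(s)+1}t^{l(s)}\right),\quad h_\eta(q,t)=\prod_{s\in\eta}\left(1-q^{a(s)}t^{l(s)+1}\right).$$ Let $\delta=(n-1,\dots,1,0)$. a) With $y=(y_1,\dots,y_n)$ further indeterminates and $U^-$ acting in the variables $x$, $$U^-\left(\prod_{i=1}^n\frac1{1-tx_iy_i}\prod_{1\le j<i\le n}\frac{1-x_iy_j}{1-tx_iy_j}\right)=\frac{\Delta_{t^{-1}}(y)\,\Delta_t(x)}{\prod_{i,j=1}^n(1-tx_iy_j)}.$$ b) For every partition $\eta^+$ with $n$ distinct parts and every $\sigma\in S_n$, the polynomials $E_{\sigma(\eta^+)}$ and $S_{\eta^+}$ exist and are unique, and $$\beta_{\sigma(\eta^+)}(q,t)=(-1)^{l(\sigma)}\,\frac{d'_{\sigma(\eta^+)}(q,t)\;h_{\eta^+-\delta}(q,qt)}{d_{\eta^+}(q,t)\;d'_{\eta^+-\delta}(q,qt)}.$$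 -/

import Mathlib

/-! The number of variables is `n = m + 1`; variables are indexed by `Fin (m + 1)` and simple
transpositions by `Fin m`, so the index `i : Fin (m + 1)` is the mathematical index `i + 1`. -/

namespace Macdonald

open Equiv

/-! ### Permutations -/

/-- The simple transposition exchanging the positions `i` and `i + 1`. -/
def simpleSwap {m : ℕ} (i : Fin m) : Perm (Fin (m + 1)) := swap i.castSucc i.succ

/-- The length `l(σ) = #{(i, j) | i < j, σ i > σ j}`. -/
def permLength {n : ℕ} (σ : Perm (Fin n)) : ℕ :=
  (Finset.univ.filter fun p : Fin n × Fin n => p.1 < p.2 ∧ σ p.2 < σ p.1).card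

/-- `w = [i₁, …, i_p]` is a reduced word of `σ`: `σ = s_{i₁} ⋯ s_{i_p}` with `p` minimal. -/
def IsReducedWord {m : ℕ} (σ : Perm (Fin (m + 1))) (w : List (Fin m)) : Prop :=
  (w.map simpleSwap).prod = σ ∧
    ∀ v : List (Fin m), (v.map simpleSwap).prod = σ → w.length ≤ v.length

theorem exists_reducedWord {m : ℕ} (σ : Perm (Fin (m + 1))) :
    ∃ w : List (Fin m), IsReducedWord σ w := by
  classical
  have hex : ∃ k : ℕ, ∃ w : List (Fin m), (w.map simpleSwap).prod = σ ∧ w.length = k := by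
    have hσ : σ ∈ Submonoid.closure
        (Set.range fun i : Fin m => swap i.castSucc i.succ) := by
      rw [Perm.mclosure_swap_castSucc_succ]; trivial
    obtain ⟨l, hl, hp⟩ := Submonoid.exists_list_of_mem_closure hσ
    have : ∃ w : List (Fin m), w.map simpleSwap = l := by
      clear hp hσ
      induction l with
      | nil => exact ⟨[], rfl⟩
      | cons a l ih =>
        obtain ⟨w, hw⟩ := ih fun y hy => hl y (List.mem_cons_of_mem _ hy)
        obtain ⟨i, hi⟩ := hl a List.mem_cons_self
        exact ⟨i :: w, by rw [List.map_cons, hw]; exact congrArg (· :: l) hi⟩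
    obtain ⟨w, hw⟩ := this
    exact ⟨w.length, w, by rw [hw, hp], rfl⟩
  obtain ⟨w, hw, hlen⟩ := Nat.find_spec hex
  exact ⟨w, hw, fun v hv => by rw [hlen]; exact Nat.find_min' hex ⟨v, hv, rfl⟩⟩

/-- A reduced word of `σ`. -/
noncomputable def reducedWord {m : ℕ} (σ : Perm (Fin (m + 1))) : List (Fin m) :=
  (exists_reducedWord σ).choose

/-! ### Operators on rational functions -/

/-- The field `k(x₁, …, x_n)` of rational functions. -/
abbrev RatFun (k : Type*) [Field k] (n : ℕ) : Type _ := FractionRing (MvPolynomial (Fin n) k)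

/-- The variable `x_i` as a rational function. -/
noncomputable def var (k : Type*) [Field k] {n : ℕ} (i : Fin n) : RatFun k n :=
  algebraMap (MvPolynomial (Fin n) k) (RatFun k n) (MvPolynomial.X i)

/-- The constants `k ⊆ k(x₁, …, x_n)`. -/
noncomputable def const {k : Type*} [Field k] {n : ℕ} (c : k) : RatFun k n :=
  algebraMap k (RatFun k n) c

/-- The monomial `x^η = x₁^{η₁} ⋯ x_n^{η_n}`. -/
noncomputable def mono (k : Type*) [Field k] {n : ℕ} (η : Fin n → ℕ) : RatFun k n :=
  ∏ i, var k i ^ η i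

/-- The operator on rational functions substituting `x_{σ(i)}` for `x_i`. -/
noncomputable def permOp (k : Type*) [Field k] {n : ℕ} (σ : Perm (Fin n)) :
    Module.End k (RatFun k n) :=
  (IsFractionRing.algEquivOfAlgEquiv (R := k) (K := RatFun k n) (L := RatFun k n)
    (MvPolynomial.renameEquiv k σ)).toLinearMap

/-- The automorphism of `k[x₁, …, x_n]` substituting `q x_i` for `x_i`. -/
noncomputable def shiftPoly {k : Type*} [Field k] {n : ℕ} (q : kˣ) (i : Fin n) :
    MvPolynomial (Fin n) k ≃ₐ[k] MvPolynomial (Fin n) k :=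
  AlgEquiv.ofAlgHom
    (MvPolynomial.aeval fun j => if j = i then (q : k) • MvPolynomial.X j else MvPolynomial.X j)
    (MvPolynomial.aeval fun j =>
      if j = i then ((q⁻¹ : kˣ) : k) • MvPolynomial.X j else MvPolynomial.X j)
    (by
      ext1 j
      by_cases h : j = i <;> simp [h, smul_smul])
    (by
      ext1 j
      by_cases h : j = i <;> simp [h, smul_smul])

/-- The `q`-shift operator `τ_i`, `(τ_i f)(x) = f(x₁, …, q x_i, …, x_n)`. -/
noncomputable def shiftOp {k : Type*} [Field k] {n : ℕ} (q : kˣ) (i : Fin n) :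
    Module.End k (RatFun k n) :=
  (IsFractionRing.algEquivOfAlgEquiv (R := k) (K := RatFun k n) (L := RatFun k n)
    (shiftPoly q i)).toLinearMap

/-- The Demazure–Lustig operator
`T_i = t + (t x_i - x_{i+1}) / (x_i - x_{i+1}) (s_i - 1)`. -/
noncomputable def demazureLustig {k : Type*} [Field k] {m : ℕ} (t : k) (i : Fin m) :
    Module.End k (RatFun k (m + 1)) :=
  t • (1 : Module.End k (RatFun k (m + 1))) +
    LinearMap.mulLeft k
        ((const t * var k i.castSucc - var k i.succ) / (var k i.castSucc - var k i.succ)) *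
      (permOp k (simpleSwap i) - 1)

/-- The inverse `T_i⁻¹ = t⁻¹ - 1 + t⁻¹ T_i`. -/
noncomputable def demazureLustigInv {k : Type*} [Field k] {m : ℕ} (t : k) (i : Fin m) :
    Module.End k (RatFun k (m + 1)) :=
  (t⁻¹ - 1) • (1 : Module.End k (RatFun k (m + 1))) + t⁻¹ • demazureLustig t i

/-- `T_σ = T_{i₁} ⋯ T_{i_p}` for a reduced word `σ = s_{i₁} ⋯ s_{i_p}`. -/
noncomputable def heckeOp {k : Type*} [Field k] {m : ℕ} (t : k) (σ : Perm (Fin (m + 1))) :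
    Module.End k (RatFun k (m + 1)) :=
  ((reducedWord σ).map (demazureLustig t)).prod

/-- The `q`-antisymmetrisation operator `U⁻ = ∑_σ (-t)^{-l(σ)} T_σ`. -/
noncomputable def antisymmetrizer {k : Type*} [Field k] (m : ℕ) (t : k) :
    Module.End k (RatFun k (m + 1)) :=
  ∑ σ : Perm (Fin (m + 1)), ((-t)⁻¹ ^ permLength σ) • heckeOp t σ

/-- The operator `ω = s_{n-1} ⋯ s_2 s_1 τ_1`. -/
noncomputable def omegaOp {k : Type*} [Field k] (m : ℕ) (q : kˣ) :
    Module.End k (RatFun k (m + 1)) :=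
  ((List.finRange m).reverse.map fun i => permOp k (simpleSwap i)).prod * shiftOp q 0

/-- The Cherednik operator
`Y_i = t^{-n+i} T_i ⋯ T_{n-1} ω T_1⁻¹ ⋯ T_{i-1}⁻¹`. -/
noncomputable def cherednik {k : Type*} [Field k] {m : ℕ} (q : kˣ) (t : k) (i : Fin (m + 1)) :
    Module.End k (RatFun k (m + 1)) :=
  (t⁻¹ ^ (m - (i : ℕ))) •
    ((((List.finRange m).filter fun j : Fin m => (i : ℕ) ≤ (j : ℕ)).map (demazureLustig t)).prod *
      omegaOp m q *
      (((List.finRange m).filter fun j : Fin m => (j : ℕ) < (i : ℕ)).map (demazureLustigInv t)).prod)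

/-- `Δ_a(z) = ∏_{i < j} (a z_i - z_j)`. -/
def delta {R : Type*} [CommRing R] {n : ℕ} (a : R) (z : Fin n → R) : R :=
  ∏ i, ∏ j ∈ Finset.univ.filter (fun j => i < j), (a * z i - z j)

/-! ### Compositions -/

/-- The partition `η⁺` obtained by rearranging `η` in decreasing order. -/
def toPartition {n : ℕ} (η : Fin n → ℕ) : Fin n → ℕ := fun i => η (Tuple.sort η (Fin.rev i))

/-- The weak dominance order: all partial sums of `ν` are at most those of `η`. -/
def DomLE {n : ℕ} (ν η : Fin n → ℕ) : Prop :=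
  ∀ p : Fin n, ∑ i ∈ Finset.univ.filter (fun i => i ≤ p), ν i ≤
    ∑ i ∈ Finset.univ.filter (fun i => i ≤ p), η i

/-- The strict dominance order on tuples of the same modulus. -/
def DomLT {n : ℕ} (ν η : Fin n → ℕ) : Prop :=
  ∑ i, ν i = ∑ i, η i ∧ DomLE ν η ∧ ν ≠ η

/-- The order `ν ≺ η` on compositions of the same modulus. -/
def Prec {n : ℕ} (ν η : Fin n → ℕ) : Prop :=
  DomLT (toPartition ν) (toPartition η) ∨ (toPartition ν = toPartition η ∧ DomLT ν η)

/-- The leg colength `l'_η(i)`. -/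
def legColength {n : ℕ} (η : Fin n → ℕ) (i : Fin n) : ℕ :=
  (Finset.univ.filter fun k => k < i ∧ η i ≤ η k).card +
    (Finset.univ.filter fun k => i < k ∧ η i < η k).card

/-- The leg length `l(s)` of the node `s = (i, j)`. -/
def legLength {n : ℕ} (η : Fin n → ℕ) (i : Fin n) (j : ℕ) : ℕ :=
  (Finset.univ.filter fun k => i < k ∧ j ≤ η k ∧ η k ≤ η i).card +
    (Finset.univ.filter fun k => k < i ∧ j ≤ η k + 1 ∧ η k + 1 ≤ η i).card

/-- `d_η(q,t) = ∏_{s ∈ η} (1 - q^{a(s)+1} t^{l(s)+1})`, where `a(i,j) = η_i - j`. -/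
def dConst {k : Type*} [Field k] {n : ℕ} (η : Fin n → ℕ) (q t : k) : k :=
  ∏ i, ∏ j ∈ Finset.Icc 1 (η i), (1 - q ^ (η i - j + 1) * t ^ (legLength η i j + 1))

/-- `d'_η(q,t) = ∏_{s ∈ η} (1 - q^{a(s)+1} t^{l(s)})`. -/
def dConst' {k : Type*} [Field k] {n : ℕ} (η : Fin n → ℕ) (q t : k) : k :=
  ∏ i, ∏ j ∈ Finset.Icc 1 (η i), (1 - q ^ (η i - j + 1) * t ^ legLength η i j)

/-- `h_η(q,t) = ∏_{s ∈ η} (1 - q^{a(s)} t^{l(s)+1})`. -/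
def hConst {k : Type*} [Field k] {n : ℕ} (η : Fin n → ℕ) (q t : k) : k :=
  ∏ i, ∏ j ∈ Finset.Icc 1 (η i), (1 - q ^ (η i - j) * t ^ (legLength η i j + 1))

/-! ### Macdonald polynomials -/

/-- `t^{η̄_i} = q^{η_i} t^{-l'_η(i)}`. -/
def eigenvalue {k : Type*} [Field k] {n : ℕ} (q t : k) (η : Fin n → ℕ) (i : Fin n) : k :=
  q ^ η i * t⁻¹ ^ legColength η i

/-- `E` is the non-symmetric Macdonald polynomial `E_η(x;q,t)`: it is `x^η` plus a linear
combination of the `x^ν` with `ν ≺ η`, and a joint eigenfunction of the Cherednik operators. -/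
def IsNonsymmetric {k : Type*} [Field k] {m : ℕ} (q : kˣ) (t : k) (η : Fin (m + 1) → ℕ)
    (E : RatFun k (m + 1)) : Prop :=
  E - mono k η ∈ Submodule.span k {f | ∃ ν : Fin (m + 1) → ℕ, Prec ν η ∧ f = mono k ν} ∧
    ∀ i, cherednik q t i E = eigenvalue (q : k) t η i • E

/-- The `q`-antisymmetric monomial `m'_κ = U⁻ x^κ`. -/
noncomputable def antisymMono {k : Type*} [Field k] {m : ℕ} (t : k) (κ : Fin (m + 1) → ℕ) :
    RatFun k (m + 1) :=
  antisymmetrizer m t (mono k κ)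

/-- `S` is the `q`-antisymmetric Macdonald polynomial `S_κ(x;q,t)`, for a partition `κ` with
distinct parts. -/
def IsAntisymmetric {k : Type*} [Field k] {m : ℕ} (q : kˣ) (t : k) (κ : Fin (m + 1) → ℕ)
    (S : RatFun k (m + 1)) : Prop :=
  S - antisymMono t κ ∈ Submodule.span k
      {f | ∃ μ : Fin (m + 1) → ℕ, StrictAnti μ ∧ DomLT μ κ ∧ f = antisymMono t μ} ∧
    (∑ i, cherednik q t i) S = (∑ i, eigenvalue (q : k) t κ i) • S

/-- The admissible parameters: `q` and `t` are either indeterminates over `ℚ`, or real numbers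
in `(0, 1)` (possibly regarded as elements of an extension field of `ℝ`). -/
def Admissible {K : Type*} [Field K] [CharZero K] (q t : K) : Prop :=
  AlgebraicIndependent ℚ ![q, t] ∨
    ∃ (φ : ℝ →+* K) (a b : ℝ), 0 < a ∧ a < 1 ∧ 0 < b ∧ b < 1 ∧ φ a = q ∧ φ b = t

end Macdonald

/-! Both parts rest on `U⁻ T_i = -U⁻` (`antisymmetrizer_mul_demazureLustig`), a consequence of the
quadratic Hecke relation.

For a), `f + s_i f` lies in the image of `T_i + 1`, so `U⁻` changes sign when `s_i` is applied to
its argument. It is also linear over symmetric functions, hence equals a fixed function times the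
plain alternating sum `A`. That function is read off from the coefficient of the longest
permutation, to which only one `T_σ` contributes: `U⁻ = t^{-N} ∏_{i<j} (t x_i - x_j)/(x_i - x_j) ·
A` with `N = n(n-1)/2` (`antisymmetrizer_eq`). Over the common denominator, which is symmetric in
`x`, the kernel is a product `∏ p_i(x_i)` with `deg p_i < n`. Its alternating sum is `det
(p_j(x_i))`, a Vandermonde determinant times a determinant of coefficients, and the latter is found
at the points `1 / y_i`, where the matrix is triangular (`det_coeff_kernelPoly`).

For b), the `E_η` are built from `1` by the raising operator `Φ = x_n ω` and by the operators `T_i +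
c`. Triangularity is proved for an order `RefLE` that is respected by both steps and implies `≺`
(`RefLT.prec`): `ν` is below `η` if, for every `p`, adding `1` to the first `p` entries of both
makes `ν` majorized by `η`. Uniqueness holds because the joint eigenvalues separate compositions as
soon as no nontrivial monomial in `q`, `t` equals `1`. Since `∑ Y_i` commutes with `U⁻`, the
polynomial `S_κ` is up to sign `U⁻ E` for the increasing rearrangement of `κ`. Its uniqueness needs
`∑ e_i` to separate partitions comparable in dominance order; this is a strict inequality for real
`0 < q, t < 1`, which also settles the case of indeterminates (`Admissible.sum_eigenvalue_ne`).

The constant is obtained by induction from the increasing arrangement. There `U⁻ E = ± S`, and the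
claimed quotient is `1` by `dConst'_rev_mul_hConst`: in each row, the columns indexed by a lower
part cancel, and the others are the columns of `κ - δ`. In the induction step `E_{s_i η} = t⁻¹ (T_i
+ c) E_η`, so `U⁻` picks up the factor `t⁻¹ (c - 1)`, which is `-d'_{s_i η} / d'_η` since only one
node changes its leg (`dConst'_swap`). -/

namespace Macdonald

open Equiv

/-! ### Automorphisms of the field of rational functions -/

section Automorphisms

variable {k : Type*} [Field k] {n : ℕ}

/-- The field automorphism underlying `permOp`. -/
noncomputable def permAut (k : Type*) [Field k] {n : ℕ} (σ : Perm (Fin n)) :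
    RatFun k n ≃ₐ[k] RatFun k n :=
  IsFractionRing.algEquivOfAlgEquiv (R := k) (K := RatFun k n) (L := RatFun k n)
    (MvPolynomial.renameEquiv k σ)

/-- The field automorphism underlying `shiftOp`. -/
noncomputable def shiftAut (q : kˣ) (i : Fin n) : RatFun k n ≃ₐ[k] RatFun k n :=
  IsFractionRing.algEquivOfAlgEquiv (R := k) (K := RatFun k n) (L := RatFun k n) (shiftPoly q i)

theorem permOp_apply (σ : Perm (Fin n)) (f : RatFun k n) : permOp k σ f = permAut k σ f := rfl

@[simp] theorem permAut_var (σ : Perm (Fin n)) (i : Fin n) :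
    permAut k σ (var k i) = var k (σ i) := by
  simp [permAut, var]

@[simp] theorem shiftAut_var (q : kˣ) (i j : Fin n) :
    shiftAut q i (var k j) = if j = i then (q : k) • var k j else var k j := by
  simp only [shiftAut, var, IsFractionRing.algEquivOfAlgEquiv_algebraMap]
  simp only [shiftPoly, AlgEquiv.ofAlgHom_apply, MvPolynomial.aeval_X]
  split_ifs
  · rw [Algebra.smul_def, Algebra.smul_def, map_mul, ← IsScalarTower.algebraMap_apply]
  · rfl

/-- The variables generate the polynomial ring, and a ring map out of its fraction field is
determined there. Identities between the automorphisms are thus checked on variables only. -/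
theorem aut_ext {φ ψ : RatFun k n →ₐ[k] RatFun k n} (h : ∀ i, φ (var k i) = ψ (var k i)) :
    φ = ψ := by
  have : φ.comp (Algebra.algHom k (MvPolynomial (Fin n) k) (RatFun k n)) =
      ψ.comp (Algebra.algHom k (MvPolynomial (Fin n) k) (RatFun k n)) := by
    ext i; exact h i
  refine AlgHom.coe_ringHom_injective ?_
  refine IsLocalization.ringHom_ext (nonZeroDivisors (MvPolynomial (Fin n) k)) ?_
  exact congrArg AlgHom.toRingHom this

theorem permAut_mul (σ τ : Perm (Fin n)) (f : RatFun k n) :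
    permAut k (σ * τ) f = permAut k σ (permAut k τ f) := by
  have := aut_ext (φ := (permAut k (σ * τ)).toAlgHom)
    (ψ := (permAut k σ).toAlgHom.comp (permAut k τ).toAlgHom) (by simp)
  exact congr($this f)

theorem permAut_one (f : RatFun k n) : permAut k 1 f = f := by
  have := aut_ext (φ := (permAut k (1 : Perm (Fin n))).toAlgHom)
    (ψ := AlgHom.id k _) (by simp)
  exact congr($this f)

theorem permOp_mul (σ τ : Perm (Fin n)) : permOp k (σ * τ) = permOp k σ * permOp k τ :=
  LinearMap.ext fun f => permAut_mul σ τ f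

theorem permOp_one : permOp k (1 : Perm (Fin n)) = 1 :=
  LinearMap.ext fun f => permAut_one f

theorem var_injective : Function.Injective (var k : Fin n → RatFun k n) := fun _ _ h =>
  MvPolynomial.X_injective (IsFractionRing.injective (MvPolynomial (Fin n) k) (RatFun k n) h)

theorem var_ne_zero (i : Fin n) : var k i ≠ 0 := fun h =>
  MvPolynomial.X_ne_zero (R := k) i
    (IsFractionRing.injective (MvPolynomial (Fin n) k) (RatFun k n) (h.trans (map_zero _).symm))

theorem var_sub_var_ne_zero {i j : Fin n} (h : i ≠ j) : var k i - var k j ≠ 0 :=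
  sub_ne_zero.2 (var_injective.ne h)

theorem const_smul (c : k) (f : RatFun k n) : c • f = const c * f := Algebra.smul_def c f

theorem const_mul_var_sub_ne_zero {i j : Fin n} (h : i ≠ j) (c : k) :
    const c * var k i - var k j ≠ 0 := by
  intro h0
  have h1 : algebraMap (MvPolynomial (Fin n) k) (RatFun k n)
      (MvPolynomial.C c * MvPolynomial.X i - MvPolynomial.X j) = 0 := by
    rw [← h0, map_sub, map_mul]; rfl
  have h2 := IsFractionRing.injective (MvPolynomial (Fin n) k) (RatFun k n)
    (h1.trans (map_zero _).symm)
  -- At the point with `x_j = 1` and all other coordinates `0` the polynomial has the value `-1`.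
  have h3 := congr(MvPolynomial.eval (fun l => if l = j then 1 else 0) $h2)
  simp [h] at h3

@[simp] theorem aut_const (φ : RatFun k n ≃ₐ[k] RatFun k n) (c : k) : φ (const c) = const c :=
  φ.commutes c

end Automorphisms

/-! ### Relations between the Demazure–Lustig operators -/

section Hecke

variable {k : Type*} [Field k] {m : ℕ}

theorem simpleSwap_castSucc (i : Fin m) : simpleSwap i i.castSucc = i.succ := swap_apply_left _ _

theorem simpleSwap_succ (i : Fin m) : simpleSwap i i.succ = i.castSucc := swap_apply_right _ _

theorem simpleSwap_of_ne {i : Fin m} {j : Fin (m + 1)} (h₁ : j ≠ i.castSucc) (h₂ : j ≠ i.succ) :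
    simpleSwap i j = j := swap_apply_of_ne_of_ne h₁ h₂

theorem simpleSwap_mul_self (i : Fin m) : simpleSwap i * simpleSwap i = 1 := swap_mul_self _ _

theorem simpleSwap_simpleSwap (i : Fin m) (j : Fin (m + 1)) :
    simpleSwap i (simpleSwap i j) = j := by
  rw [← Perm.mul_apply, simpleSwap_mul_self, Perm.one_apply]

/-- The coefficient `(t x_i - x_j) / (x_i - x_j)`. -/
noncomputable def dlCoeff (t : k) {n : ℕ} (i j : Fin n) : RatFun k n :=
  (const t * var k i - var k j) / (var k i - var k j)

theorem permAut_dlCoeff (t : k) {n : ℕ} (σ : Perm (Fin n)) (i j : Fin n) :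
    permAut k σ (dlCoeff t i j) = dlCoeff t (σ i) (σ j) := by
  simp [dlCoeff]

theorem demazureLustig_apply (t : k) (i : Fin m) (f : RatFun k (m + 1)) :
    demazureLustig t i f = const t * f +
      dlCoeff t i.castSucc i.succ * (permAut k (simpleSwap i) f - f) := by
  simp only [demazureLustig, LinearMap.add_apply, LinearMap.smul_apply, Module.End.one_apply,
    Module.End.mul_apply, LinearMap.mulLeft_apply, LinearMap.sub_apply, permOp_apply, const_smul,
    dlCoeff]

theorem permAut_simpleSwap_simpleSwap (i : Fin m) (f : RatFun k (m + 1)) :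
    permAut k (simpleSwap i) (permAut k (simpleSwap i) f) = f := by
  rw [← permAut_mul, simpleSwap_mul_self, permAut_one]

/-- The coefficient `(t x_i - x_{i+1})/(x_i - x_{i+1})` and its image under `s_i` add up to `t + 1`;
this yields `(T_i - t)(T_i + 1) = 0`, the source of the formula for `T_i⁻¹` and of the sign in `U⁻
T_i = -U⁻`. -/
theorem demazureLustig_mul_self (t : k) (i : Fin m) :
    demazureLustig t i * demazureLustig t i = (t - 1) • demazureLustig t i + t • 1 := by
  ext f
  have h := var_sub_var_ne_zero (k := k) (Fin.castSucc_lt_succ (i := i)).ne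
  have h' := var_sub_var_ne_zero (k := k) (Fin.castSucc_lt_succ (i := i)).ne'
  have h1 : (const (t - 1) : RatFun k (m + 1)) = const t - 1 := by simp [const]
  simp only [Module.End.mul_apply, LinearMap.add_apply, LinearMap.smul_apply, Module.End.one_apply,
    demazureLustig_apply, map_add, map_mul, map_sub, permAut_dlCoeff, aut_const,
    simpleSwap_castSucc, simpleSwap_succ, permAut_simpleSwap_simpleSwap, const_smul, h1]
  have e1 : dlCoeff t i.succ i.castSucc = (var k i.castSucc - const t * var k i.succ) /
      (var k i.castSucc - var k i.succ) := by
    rw [dlCoeff, div_eq_div_iff h' h]; ring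
  rw [e1, dlCoeff]
  field_simp
  ring

theorem demazureLustigInv_mul {t : k} (ht : t ≠ 0) (i : Fin m) :
    demazureLustigInv t i * demazureLustig t i = 1 := by
  rw [demazureLustigInv, add_mul, smul_mul_assoc, smul_mul_assoc, demazureLustig_mul_self, one_mul,
    smul_add, smul_smul, smul_smul, mul_sub, inv_mul_cancel₀ ht, one_smul, mul_one, ← add_assoc,
    ← add_smul]
  simp

theorem mul_demazureLustigInv {t : k} (ht : t ≠ 0) (i : Fin m) :
    demazureLustig t i * demazureLustigInv t i = 1 := by
  rw [← demazureLustigInv_mul ht i, demazureLustigInv, mul_add, add_mul]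
  simp only [mul_smul_comm, smul_mul_assoc, one_mul, mul_one]

theorem smul_demazureLustigInv {t : k} (ht : t ≠ 0) (i : Fin m) :
    t • demazureLustigInv t i = demazureLustig t i + (1 - t) • 1 := by
  rw [demazureLustigInv, smul_add, smul_smul, smul_smul, mul_sub, mul_inv_cancel₀ ht, one_smul,
    mul_one]
  exact add_comm _ _

theorem demazureLustig_comm (t : k) {i j : Fin m} (h : (i : ℕ) + 1 < j) :
    demazureLustig t i * demazureLustig t j = demazureLustig t j * demazureLustig t i := by
  have hc : simpleSwap i * simpleSwap j = simpleSwap j * simpleSwap i := by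
    refine (Perm.disjoint_iff_disjoint_support.2 ?_).commute
    rw [simpleSwap, simpleSwap, Perm.support_swap (Fin.castSucc_lt_succ).ne,
      Perm.support_swap (Fin.castSucc_lt_succ).ne]
    simp [Fin.ext_iff]; omega
  have e1 : simpleSwap i j.castSucc = j.castSucc :=
    simpleSwap_of_ne (by simp [Fin.ext_iff]; omega) (by simp [Fin.ext_iff]; omega)
  have e2 : simpleSwap i j.succ = j.succ :=
    simpleSwap_of_ne (by simp [Fin.ext_iff]; omega) (by simp [Fin.ext_iff]; omega)
  have e3 : simpleSwap j i.castSucc = i.castSucc :=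
    simpleSwap_of_ne (by simp [Fin.ext_iff]; omega) (by simp [Fin.ext_iff]; omega)
  have e4 : simpleSwap j i.succ = i.succ :=
    simpleSwap_of_ne (by simp [Fin.ext_iff]; omega) (by simp [Fin.ext_iff]; omega)
  ext f
  simp only [Module.End.mul_apply, demazureLustig_apply, map_add, map_mul, map_sub,
    permAut_dlCoeff, aut_const, e1, e2, e3, e4, ← permAut_mul, hc]
  ring

theorem simpleSwap_braid {i j : Fin m} (h : (i : ℕ) + 1 = j) :
    simpleSwap i * simpleSwap j * simpleSwap i = simpleSwap j * simpleSwap i * simpleSwap j := by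
  have hij : i.succ = j.castSucc := by simp [Fin.ext_iff, h]
  ext l
  simp only [simpleSwap, Perm.mul_apply, hij, swap_apply_def]
  have : (i.castSucc : Fin (m + 1)) ≠ j.castSucc := by simp [Fin.ext_iff]; omega
  have : (i.castSucc : Fin (m + 1)) ≠ j.succ := by simp [Fin.ext_iff]; omega
  have : (j.castSucc : Fin (m + 1)) ≠ j.succ := by simp [Fin.ext_iff]
  split_ifs <;> simp_all

/-- Treating the images of `f` under the six permutations of three variables as unrelated unknowns
`f, a, b, ab, ba, w` turns the braid relation into an identity that field arithmetic decides. -/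
theorem braid_identity {F : Type*} [Field F] (t x y z f a b ab ba w : F)
    (hxy : x - y ≠ 0) (hyz : y - z ≠ 0) (hxz : x - z ≠ 0) (hyx : y - x ≠ 0) (hzy : z - y ≠ 0) :
    t * (t * (t * f + (t * x - y) / (x - y) * (a - f)) + (t * y - z) / (y - z) *
        ((t * b + (t * x - z) / (x - z) * (ba - b)) - (t * f + (t * x - y) / (x - y) * (a - f)))) +
      (t * x - y) / (x - y) *
       ((t * (t * a + (t * y - x) / (y - x) * (f - a)) + (t * x - z) / (x - z) *
          ((t * ab + (t * y - z) / (y - z) * (w - ab)) -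
            (t * a + (t * y - x) / (y - x) * (f - a)))) -
        (t * (t * f + (t * x - y) / (x - y) * (a - f)) + (t * y - z) / (y - z) *
        ((t * b + (t * x - z) / (x - z) * (ba - b)) -
          (t * f + (t * x - y) / (x - y) * (a - f))))) =
    t * (t * (t * f + (t * y - z) / (y - z) * (b - f)) + (t * x - y) / (x - y) *
        ((t * a + (t * x - z) / (x - z) * (ab - a)) - (t * f + (t * y - z) / (y - z) * (b - f)))) +
      (t * y - z) / (y - z) *
       ((t * (t * b + (t * z - y) / (z - y) * (f - b)) + (t * x - z) / (x - z) *
          ((t * ba + (t * x - y) / (x - y) * (w - ba)) -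
            (t * b + (t * z - y) / (z - y) * (f - b)))) -
        (t * (t * f + (t * y - z) / (y - z) * (b - f)) + (t * x - y) / (x - y) *
        ((t * a + (t * x - z) / (x - z) * (ab - a)) -
          (t * f + (t * y - z) / (y - z) * (b - f))))) := by
  have e1 : (t * y - x) / (y - x) = (x - t * y) / (x - y) := by
    rw [div_eq_div_iff hyx hxy]; ring
  have e2 : (t * z - y) / (z - y) = (y - t * z) / (y - z) := by
    rw [div_eq_div_iff hzy hyz]; ring
  rw [e1, e2]
  field_simp
  ring

theorem demazureLustig_braid (t : k) {i j : Fin m} (h : (i : ℕ) + 1 = j) :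
    demazureLustig t i * demazureLustig t j * demazureLustig t i =
      demazureLustig t j * demazureLustig t i * demazureLustig t j := by
  have hij : i.succ = j.castSucc := by simp [Fin.ext_iff, h]
  have n1 : (i.castSucc : Fin (m + 1)) ≠ j.castSucc := by simp [Fin.ext_iff]; omega
  have n2 : (i.castSucc : Fin (m + 1)) ≠ j.succ := by simp [Fin.ext_iff]; omega
  have n3 : (j.castSucc : Fin (m + 1)) ≠ j.succ := by simp [Fin.ext_iff]
  have e1 : simpleSwap i i.castSucc = j.castSucc := by rw [simpleSwap_castSucc, hij]
  have e2 : simpleSwap i j.castSucc = i.castSucc := by rw [← hij, simpleSwap_succ]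
  have e3 : simpleSwap i j.succ = j.succ := simpleSwap_of_ne n2.symm (hij ▸ n3.symm)
  have e4 : simpleSwap j i.castSucc = i.castSucc := simpleSwap_of_ne n1 n2
  have hw (f) : permAut k (simpleSwap i) (permAut k (simpleSwap j) (permAut k (simpleSwap i) f)) =
      permAut k (simpleSwap j) (permAut k (simpleSwap i) (permAut k (simpleSwap j) f)) := by
    simp only [← permAut_mul, ← mul_assoc, simpleSwap_braid h]
  ext f
  simp only [Module.End.mul_apply, demazureLustig_apply, map_add, map_mul, map_sub,
    permAut_dlCoeff, aut_const, hij, e1, e2, e3, e4, simpleSwap_castSucc, simpleSwap_succ,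
    permAut_simpleSwap_simpleSwap, hw]
  simp only [dlCoeff]
  linear_combination braid_identity (F := RatFun k (m + 1)) (const t) (var k i.castSucc)
    (var k j.castSucc) (var k j.succ) f (permAut k (simpleSwap i) f) (permAut k (simpleSwap j) f)
    (permAut k (simpleSwap i) (permAut k (simpleSwap j) f))
    (permAut k (simpleSwap j) (permAut k (simpleSwap i) f))
    (permAut k (simpleSwap j) (permAut k (simpleSwap i) (permAut k (simpleSwap j) f)))
    (var_sub_var_ne_zero n1)
    (var_sub_var_ne_zero n3) (var_sub_var_ne_zero n2) (var_sub_var_ne_zero n1.symm)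
    (var_sub_var_ne_zero n3.symm)

end Hecke

/-! ### The operator `ω` -/

section Omega

variable {k : Type*} [Field k] {m : ℕ}

theorem filter_lt_succ_finRange {r : ℕ} (h : r < m) :
    (List.finRange m).filter (fun j : Fin m => (j : ℕ) < r + 1) =
      (List.finRange m).filter (fun j : Fin m => (j : ℕ) < r) ++ [⟨r, h⟩] := by
  refine List.Pairwise.eq_of_mem_iff (r := (· < ·)) ((List.pairwise_lt_finRange m).filter _) ?_ ?_
  · rw [List.pairwise_append]
    refine ⟨(List.pairwise_lt_finRange m).filter _, List.pairwise_singleton _ _, ?_⟩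
    intro a ha b hb
    simp only [List.mem_filter, decide_eq_true_eq] at ha
    rw [List.mem_singleton] at hb
    rw [hb]
    exact ha.2
  · intro j
    simp [Fin.ext_iff]; omega

theorem filter_le_finRange (i : Fin m) :
    (List.finRange m).filter (fun j : Fin m => (i : ℕ) ≤ (j : ℕ)) =
      i :: (List.finRange m).filter (fun j : Fin m => (i : ℕ) + 1 ≤ (j : ℕ)) := by
  refine List.Pairwise.eq_of_mem_iff (r := (· < ·)) ((List.pairwise_lt_finRange m).filter _) ?_ ?_
  · rw [List.pairwise_cons]
    refine ⟨?_, (List.pairwise_lt_finRange m).filter _⟩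
    intro a ha
    simp only [List.mem_filter, decide_eq_true_eq] at ha
    exact ha.2
  · intro j
    simp [Fin.ext_iff]; omega

/-- The cycle `s_{n-1} ⋯ s_1`. -/
def cycle (m : ℕ) : Perm (Fin (m + 1)) := ((List.finRange m).reverse.map simpleSwap).prod

/-- The induction over the number of factors needs all partial products `s_r ⋯ s_1`; afterwards only
the full cycle `r = m` is used. -/
theorem partialCycle_apply (r : ℕ) (hr : r ≤ m) (j : Fin (m + 1)) :
    ((((((List.finRange m).filter (fun j : Fin m => (j : ℕ) < r)).reverse.map simpleSwap).prod :
      Perm (Fin (m + 1))) j : Fin (m + 1)) : ℕ) =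
        if (j : ℕ) = 0 then r else if (j : ℕ) ≤ r then (j : ℕ) - 1 else j := by
  induction r with
  | zero =>
    simp only [not_lt_zero, decide_false, List.filter_false, List.reverse_nil, List.map_nil,
      List.prod_nil, Perm.one_apply, Nat.le_zero]
    split_ifs <;> omega
  | succ r ih =>
    rw [filter_lt_succ_finRange (by omega), List.reverse_append, List.reverse_singleton,
      List.singleton_append, List.map_cons, List.prod_cons, Perm.mul_apply]
    have := ih (by omega)
    set l := (((List.finRange m).filter (fun j : Fin m => (j : ℕ) < r)).reverse.map
      simpleSwap).prod j
    simp only [simpleSwap, swap_apply_def, Fin.ext_iff, Fin.val_castSucc, Fin.val_succ]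
    have h0 : ((0 : Fin (m + 1)) : ℕ) = 0 := rfl
    split_ifs at this <;> split_ifs <;>
      first | omega | simp only [Fin.val_castSucc, Fin.val_succ] <;> omega

theorem cycle_eq : cycle m =
    (((List.finRange m).filter (fun j : Fin m => (j : ℕ) < m)).reverse.map simpleSwap).prod := by
  rw [cycle, List.filter_eq_self.2 (by simp)]

theorem cycle_zero : cycle m 0 = Fin.last m := by
  rw [Fin.ext_iff, cycle_eq, partialCycle_apply m le_rfl]; simp

theorem cycle_succ (i : Fin m) : cycle m i.succ = i.castSucc := by
  rw [Fin.ext_iff, cycle_eq, partialCycle_apply m le_rfl]; simp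

/-- The field automorphism underlying `omegaOp`. -/
noncomputable def omegaAut (m : ℕ) (q : kˣ) : RatFun k (m + 1) ≃ₐ[k] RatFun k (m + 1) :=
  (shiftAut q 0).trans (permAut k (cycle m))

theorem omegaOp_apply (q : kˣ) (f : RatFun k (m + 1)) : omegaOp m q f = omegaAut m q f := by
  have h (l : List (Fin m)) : (l.map fun i => permOp k (simpleSwap i)).prod =
      permOp k (l.map simpleSwap).prod := by
    induction l with
    | nil => exact permOp_one.symm
    | cons a l ih => rw [List.map_cons, List.prod_cons, ih, List.map_cons, List.prod_cons,
        permOp_mul]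
  rw [omegaOp, h]; rfl

theorem omegaAut_var_zero (q : kˣ) :
    omegaAut m q (var k 0) = (q : k) • var k (Fin.last m) := by
  simp [omegaAut, cycle_zero]

theorem omegaAut_var_succ (q : kˣ) (i : Fin m) :
    omegaAut m q (var k i.succ) = var k i.castSucc := by
  simp [omegaAut, cycle_succ]

theorem shiftAut_permAut {n : ℕ} (q : kˣ) (σ : Perm (Fin n)) (i : Fin n) (f : RatFun k n) :
    shiftAut q (σ i) (permAut k σ f) = permAut k σ (shiftAut q i f) := by
  have := aut_ext (φ := (shiftAut q (σ i)).toAlgHom.comp (permAut k σ).toAlgHom)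
    (ψ := (permAut k σ).toAlgHom.comp (shiftAut q i).toAlgHom) (by
      intro j
      by_cases h : j = i <;> simp [h])
  exact congr($this f)

theorem shiftAut_comm {n : ℕ} (q : kˣ) (i j : Fin n) (f : RatFun k n) :
    shiftAut q i (shiftAut q j f) = shiftAut q j (shiftAut q i f) := by
  have := aut_ext (φ := (shiftAut q i).toAlgHom.comp (shiftAut q j).toAlgHom)
    (ψ := (shiftAut q j).toAlgHom.comp (shiftAut q i).toAlgHom) (by
      intro l
      by_cases h : l = i <;> by_cases h' : l = j <;> by_cases h'' : i = j <;> simp_all)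
  exact congr($this f)

/-- `ω` moves both variables of `T_j` down by one place. Neither is the variable scaled by `q`,
because `i + 1 = j` excludes the first index. -/
theorem omegaOp_mul_demazureLustig (q : kˣ) (t : k) {i j : Fin m} (h : (i : ℕ) + 1 = j) :
    omegaOp m q * demazureLustig t j = demazureLustig t i * omegaOp m q := by
  have hij : j.castSucc = i.succ := by simp [Fin.ext_iff, h]
  have h0 : simpleSwap j 0 = 0 :=
    simpleSwap_of_ne (by simp [Fin.ext_iff]; omega) (by simp [Fin.ext_iff])
  have hc : cycle m * simpleSwap j = simpleSwap i * cycle m := by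
    rw [simpleSwap, mul_swap_eq_swap_mul, simpleSwap, cycle_succ, hij, cycle_succ]
  have hs (f) : omegaAut m q (permAut k (simpleSwap j) f) =
      permAut k (simpleSwap i) (omegaAut m q f) := by
    simp only [omegaAut, AlgEquiv.trans_apply]
    have := shiftAut_permAut q (simpleSwap j) 0 f
    rw [h0] at this
    rw [this, ← permAut_mul, ← permAut_mul, hc]
  ext f
  simp only [Module.End.mul_apply, omegaOp_apply, demazureLustig_apply, map_add, map_mul, map_sub,
    hs, aut_const]
  simp only [dlCoeff, map_div₀, map_mul, map_sub, aut_const, hij, omegaAut_var_succ]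

/-- Two applications of `ω` move the first two variables to the last two places and scale both by
`q`; the coefficient in `T_i` is homogeneous of degree zero, so `q` drops out. This covers the index
that `omegaOp_mul_demazureLustig` leaves out. -/
theorem omegaOp_sq_mul_demazureLustig (q : kˣ) (t : k) {i j : Fin m} (hi : (i : ℕ) = 0)
    (hj : (j : ℕ) + 1 = m) :
    omegaOp m q * omegaOp m q * demazureLustig t i =
      demazureLustig t j * (omegaOp m q * omegaOp m q) := by
  have hi0 : i.castSucc = 0 := by simp [Fin.ext_iff, hi]
  have hjl : Fin.last m = j.succ := by simp [Fin.ext_iff, hj]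
  have hc1 : cycle m (cycle m i.castSucc) = j.castSucc := by
    rw [hi0, cycle_zero, hjl, cycle_succ]
  have hc2 : cycle m (cycle m i.succ) = j.succ := by
    rw [cycle_succ, hi0, cycle_zero, hjl]
  have hc : cycle m * cycle m * simpleSwap i = simpleSwap j * (cycle m * cycle m) := by
    rw [simpleSwap, mul_swap_eq_swap_mul, Perm.mul_apply, Perm.mul_apply, hc1, hc2, simpleSwap]
  have hsh (f : RatFun k (m + 1)) : omegaAut m q (omegaAut m q f) =
      permAut k (cycle m * cycle m) (shiftAut q i.castSucc (shiftAut q i.succ f)) := by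
    have := shiftAut_permAut q (cycle m) i.succ (shiftAut q 0 f)
    rw [cycle_succ, hi0] at this
    simp only [omegaAut, AlgEquiv.trans_apply]
    rw [this, ← permAut_mul, shiftAut_comm, hi0]
  have hs (f) : omegaAut m q (omegaAut m q (permAut k (simpleSwap i) f)) =
      permAut k (simpleSwap j) (omegaAut m q (omegaAut m q f)) := by
    have h1 := shiftAut_permAut q (simpleSwap i) i.castSucc f
    have h2 := shiftAut_permAut q (simpleSwap i) i.succ (shiftAut q i.castSucc f)
    rw [simpleSwap_castSucc] at h1
    rw [simpleSwap_succ] at h2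
    rw [hsh, hsh, h1, h2, ← permAut_mul, ← permAut_mul, hc, shiftAut_comm]
  have hq : (const (q : k) : RatFun k (m + 1)) ≠ 0 := by
    rw [const, Ne, FaithfulSMul.algebraMap_eq_zero_iff]; exact q.ne_zero
  have hx1 : omegaAut m q (omegaAut m q (var k i.castSucc)) = const (q : k) * var k j.castSucc := by
    rw [hi0, omegaAut_var_zero, hjl, map_smul, omegaAut_var_succ, const_smul]
  have hx2 : omegaAut m q (omegaAut m q (var k i.succ)) = const (q : k) * var k j.succ := by
    rw [omegaAut_var_succ, hi0, omegaAut_var_zero, hjl, const_smul]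
  have hd : omegaAut m q (omegaAut m q (dlCoeff t i.castSucc i.succ)) =
      dlCoeff t j.castSucc j.succ := by
    simp only [dlCoeff, map_div₀, map_mul, map_sub, aut_const, hx1, hx2]
    rw [← mul_sub, mul_left_comm, ← mul_sub, mul_div_mul_left _ _ hq]
  ext f
  simp only [Module.End.mul_apply, omegaOp_apply, demazureLustig_apply, map_add, map_mul, map_sub,
    hs, aut_const, hd]

end Omega

/-! ### Multiplication by a variable -/

section MulVar

variable {k : Type*} [Field k] {m : ℕ}

/-- Multiplication by the variable `x_i`. -/
noncomputable def mulVar (k : Type*) [Field k] {n : ℕ} (i : Fin n) : Module.End k (RatFun k n) :=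
  LinearMap.mulLeft k (var k i)

theorem mulVar_apply {n : ℕ} (i : Fin n) (f : RatFun k n) : mulVar k i f = var k i * f := rfl

theorem demazureLustig_mul_mulVar_of_ne (t : k) {i : Fin m} {j : Fin (m + 1)}
    (h₁ : j ≠ i.castSucc) (h₂ : j ≠ i.succ) :
    demazureLustig t i * mulVar k j = mulVar k j * demazureLustig t i := by
  ext f
  simp only [Module.End.mul_apply, mulVar_apply, demazureLustig_apply, map_mul, permAut_var,
    simpleSwap_of_ne h₁ h₂]
  ring

/-- A variable crosses `T_i` at the price of inverting it. This is what turns `T_1⁻¹ ⋯ T_r⁻¹` into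
`T_1 ⋯ T_r` in `invProd_mul_mulVar`. -/
theorem demazureLustig_mul_mulVar_castSucc {t : k} (ht : t ≠ 0) (i : Fin m) :
    demazureLustig t i * mulVar k i.castSucc =
      t • (mulVar k i.succ * demazureLustigInv t i) := by
  rw [← mul_smul_comm, smul_demazureLustigInv ht]
  ext f
  have h := var_sub_var_ne_zero (k := k) (Fin.castSucc_lt_succ (i := i)).ne
  have h1 : (const (1 - t) : RatFun k (m + 1)) = 1 - const t := by simp [const]
  simp only [Module.End.mul_apply, mulVar_apply, demazureLustig_apply, map_mul, permAut_var,
    simpleSwap_castSucc, LinearMap.add_apply, LinearMap.smul_apply, Module.End.one_apply,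
    const_smul, h1, dlCoeff]
  field_simp
  ring

theorem demazureLustigInv_mul_mulVar_succ {t : k} (ht : t ≠ 0) (i : Fin m) :
    demazureLustigInv t i * mulVar k i.succ =
      t⁻¹ • (mulVar k i.castSucc * demazureLustig t i) := by
  have h := demazureLustig_mul_mulVar_castSucc ht i
  have h2 := congr(demazureLustigInv t i * $h * demazureLustig t i)
  rw [mul_smul_comm, smul_mul_assoc, ← mul_assoc, demazureLustigInv_mul ht, one_mul, mul_assoc,
    mul_assoc, demazureLustigInv_mul ht, mul_one] at h2
  rw [h2, smul_smul, inv_mul_cancel₀ ht, one_smul]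

theorem demazureLustigInv_mul_of_comm {t : k} (ht : t ≠ 0) {i j : Fin m}
    {A : Module.End k (RatFun k (m + 1))}
    (h : A * demazureLustig t i = demazureLustig t j * A) :
    A * demazureLustigInv t i = demazureLustigInv t j * A := by
  have := congr(demazureLustigInv t j * $h * demazureLustigInv t i)
  rw [mul_assoc, mul_assoc, mul_demazureLustigInv ht, mul_one, ← mul_assoc,
    demazureLustigInv_mul ht, one_mul] at this
  exact this.symm

end MulVar

/-! ### The Cherednik operators -/

section Cherednik

variable {k : Type*} [Field k] {m : ℕ}

/-- The product `T_1⁻¹ ⋯ T_r⁻¹`. -/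
noncomputable def invProd (m : ℕ) (t : k) (r : ℕ) : Module.End k (RatFun k (m + 1)) :=
  (((List.finRange m).filter fun j : Fin m => (j : ℕ) < r).map (demazureLustigInv t)).prod

/-- The product `T_{r+1} ⋯ T_{n-1}`. -/
noncomputable def upProd (m : ℕ) (t : k) (r : ℕ) : Module.End k (RatFun k (m + 1)) :=
  (((List.finRange m).filter fun j : Fin m => r ≤ (j : ℕ)).map (demazureLustig t)).prod

theorem invProd_zero (t : k) : invProd m t 0 = 1 := by simp [invProd]

theorem invProd_succ (t : k) (i : Fin m) :
    invProd m t (i + 1) = invProd m t i * demazureLustigInv t i := by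
  rw [invProd, filter_lt_succ_finRange i.2]; simp [invProd]

theorem upProd_castSucc (t : k) (i : Fin m) :
    upProd m t i = demazureLustig t i * upProd m t (i + 1) := by
  rw [upProd, filter_le_finRange]; simp [upProd]

theorem upProd_last (t : k) : upProd m t m = 1 := by
  rw [upProd, List.filter_eq_nil_iff.2 (by simp)]; simp

theorem cherednik_eq (q : kˣ) (t : k) (i : Fin (m + 1)) :
    cherednik q t i = t⁻¹ ^ (m - (i : ℕ)) • (upProd m t i * omegaOp m q * invProd m t i) := rfl

/-- The right factor `T_i` cancels the last factor `T_i⁻¹` of `Y_{i+1}`. The recursion reduces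
statements about all `Y_i` to `Y_n` by downward induction. -/
theorem cherednik_castSucc (q : kˣ) {t : k} (ht : t ≠ 0) (i : Fin m) :
    cherednik q t i.castSucc =
      t⁻¹ • (demazureLustig t i * cherednik q t i.succ * demazureLustig t i) := by
  rw [cherednik_eq, cherednik_eq, Fin.val_castSucc, Fin.val_succ, upProd_castSucc, invProd_succ,
    mul_smul_comm, smul_mul_assoc, smul_smul, ← pow_succ']
  have : m - (i : ℕ) = m - (i + 1) + 1 := by omega
  rw [this]
  simp only [mul_assoc, demazureLustigInv_mul ht, mul_one]

theorem cherednik_last (q : kˣ) (t : k) :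
    cherednik q t (Fin.last m) = omegaOp m q * invProd m t m := by
  simp [cherednik_eq, upProd_last]

theorem cherednik_zero (q : kˣ) (t : k) :
    cherednik q t (0 : Fin (m + 1)) = t⁻¹ ^ m • (upProd m t 0 * omegaOp m q) := by
  simp [cherednik_eq, invProd_zero]

theorem demazureLustigInv_comm {t : k} (ht : t ≠ 0) {i j : Fin m}
    (h : (i : ℕ) + 1 < j ∨ (j : ℕ) + 1 < i) :
    demazureLustig t i * demazureLustigInv t j = demazureLustigInv t j * demazureLustig t i :=
  demazureLustigInv_mul_of_comm ht
    (h.elim (demazureLustig_comm t) fun h => (demazureLustig_comm t h).symm)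

theorem invProd_mul_demazureLustig_of_lt {t : k} (ht : t ≠ 0) (r : ℕ) (hr : r ≤ m) {i : Fin m}
    (h : r < i) : invProd m t r * demazureLustig t i = demazureLustig t i * invProd m t r := by
  induction r with
  | zero => rw [invProd_zero, one_mul, mul_one]
  | succ r ih =>
    have hs := invProd_succ (m := m) t ⟨r, by omega⟩
    simp only at hs
    rw [hs, mul_assoc, ← demazureLustigInv_comm ht (Or.inr (by simp; omega)), ← mul_assoc,
      ih (by omega) (by omega), mul_assoc]

theorem semiconj_inverse {M : Type*} [Monoid M] {U V a b : M} (h₁ : U * V = 1) (h₂ : V * U = 1)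
    (h : U * b = a * U) : V * a = b * V := by
  have : V * (a * U) * V = V * (U * b) * V := by rw [h]
  rwa [mul_assoc, mul_assoc, h₁, mul_one, ← mul_assoc V, h₂, one_mul] at this

/-- `T_i` passes the factors with index beyond `j`, becomes `T_j` on crossing `T_i⁻¹ T_j⁻¹` by the
braid relation, and then passes the remaining factors. -/
theorem invProd_mul_demazureLustig {t : k} (ht : t ≠ 0) (r : ℕ) (hr : r ≤ m) {i j : Fin m}
    (hij : (i : ℕ) + 1 = j) (h : j < r) :
    invProd m t r * demazureLustig t i = demazureLustig t j * invProd m t r := by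
  induction r with
  | zero => omega
  | succ r ih =>
    have hs := invProd_succ (m := m) t ⟨r, by omega⟩
    simp only at hs
    rw [hs]
    rcases (show (j : ℕ) < r ∨ (j : ℕ) = r by omega) with h | h
    · rw [mul_assoc, ← demazureLustigInv_comm ht (Or.inl (by simp; omega)), ← mul_assoc,
        ih (by omega) h, mul_assoc]
    · have hj : (⟨r, by omega⟩ : Fin m) = j := Fin.ext h.symm
      have hs' := invProd_succ (m := m) t i
      rw [show (i : ℕ) + 1 = r by omega] at hs'
      rw [hj, hs']
      have hb : demazureLustigInv t i * demazureLustigInv t j * demazureLustig t i =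
          demazureLustig t j * (demazureLustigInv t i * demazureLustigInv t j) := by
        refine semiconj_inverse (U := demazureLustig t j * demazureLustig t i) ?_ ?_ ?_
        · rw [mul_assoc, ← mul_assoc (demazureLustig t i), mul_demazureLustigInv ht, one_mul,
            mul_demazureLustigInv ht]
        · rw [mul_assoc, ← mul_assoc (demazureLustigInv t j), demazureLustigInv_mul ht, one_mul,
            demazureLustigInv_mul ht]
        · rw [← demazureLustig_braid t hij, mul_assoc]
      rw [mul_assoc, mul_assoc, ← mul_assoc (demazureLustigInv t i), hb, ← mul_assoc,
        invProd_mul_demazureLustig_of_lt ht i i.2.le (by omega), mul_assoc, mul_assoc]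

theorem demazureLustig_mul_cherednik_last (q : kˣ) {t : k} (ht : t ≠ 0) {i : Fin m}
    (h : (i : ℕ) + 1 < m) :
    demazureLustig t i * cherednik q t (Fin.last m) =
      cherednik q t (Fin.last m) * demazureLustig t i := by
  have hij : (i : ℕ) + 1 = (⟨i + 1, h⟩ : Fin m) := rfl
  rw [cherednik_last, mul_assoc, invProd_mul_demazureLustig ht m le_rfl hij h, ← mul_assoc,
    ← mul_assoc, omegaOp_mul_demazureLustig q t hij]

/-- `T_i` commutes with `Y_j` unless `j = i` or `j = i + 1`. -/
theorem demazureLustig_mul_cherednik (q : kˣ) {t : k} (ht : t ≠ 0) (j : Fin (m + 1)) :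
    ∀ i : Fin m, j ≠ i.castSucc → j ≠ i.succ →
      demazureLustig t i * cherednik q t j = cherednik q t j * demazureLustig t i := by
  induction hd : m - (j : ℕ) using Nat.strong_induction_on generalizing j with
  | _ d ih =>
  cases j using Fin.lastCases with
  | last =>
    intro i _ h
    refine demazureLustig_mul_cherednik_last q ht ?_
    have := i.2
    simp [Fin.ext_iff] at h
    omega
  | cast j =>
    have hjm := j.2
    rw [Fin.val_castSucc] at hd
    intro i h1 h2
    have h1' : (j : ℕ) ≠ i := by simpa [Fin.ext_iff] using h1
    have h2' : (j : ℕ) ≠ i + 1 := by simpa [Fin.ext_iff] using h2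
    rw [cherednik_castSucc q ht, mul_smul_comm, smul_mul_assoc]
    congr 1
    -- For `i = j + 1` the recursion is unfolded a second time and the braid relation applies;
    -- otherwise `T_i` commutes with all three factors of `Y_j`.
    by_cases h3 : (j : ℕ) + 1 = i
    · have hs : j.succ = i.castSucc := by simp [Fin.ext_iff, h3]
      have hc : demazureLustig t j * cherednik q t i.succ =
          cherednik q t i.succ * demazureLustig t j := by
        refine ih _ ?_ i.succ rfl j (by simp [Fin.ext_iff]; omega) (by simp [Fin.ext_iff]; omega)
        simp only [Fin.val_succ]
        omega
      rw [hs, cherednik_castSucc q ht]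
      simp only [mul_smul_comm, smul_mul_assoc]
      congr 1
      have hb := demazureLustig_braid t h3
      set a := demazureLustig t j
      set b := demazureLustig t i
      set Y := cherednik q t i.succ
      calc b * (a * (b * Y * b) * a) = (b * a * b) * Y * b * a := by simp only [mul_assoc]
        _ = a * b * (a * Y) * b * a := by rw [← hb]; simp only [mul_assoc]
        _ = a * b * Y * (a * b * a) := by rw [hc]; simp only [mul_assoc]
        _ = a * (b * Y * b) * a * b := by rw [hb]; simp only [mul_assoc]
    · have hc := ih _ (by simp only [Fin.val_succ]; omega) j.succ rfl i (by simp [Fin.ext_iff]; omega) (by simp [Fin.ext_iff]; omega)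
      have hT : demazureLustig t i * demazureLustig t j =
          demazureLustig t j * demazureLustig t i := by
        rcases (show (i : ℕ) + 1 < j ∨ (j : ℕ) + 1 < i by omega) with h | h
        · exact demazureLustig_comm t h
        · exact (demazureLustig_comm t h).symm
      rw [← mul_assoc, ← mul_assoc, hT, mul_assoc (demazureLustig t j), hc, ← mul_assoc,
        mul_assoc _ (demazureLustig t i), hT, ← mul_assoc]

end Cherednik

/-! ### Exchange relations of the `Y_i` with `T_i` and with the raising operator -/

section CherednikRelations

variable {k : Type*} [Field k] {m : ℕ}

theorem demazureLustig_mul_cherednik_castSucc (q : kˣ) {t : k} (ht : t ≠ 0) (i : Fin m) :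
    demazureLustig t i * cherednik q t i.castSucc =
      (t - 1) • cherednik q t i.castSucc + cherednik q t i.succ * demazureLustig t i := by
  rw [cherednik_castSucc q ht, mul_smul_comm, ← mul_assoc, ← mul_assoc, demazureLustig_mul_self]
  simp only [add_mul, smul_mul_assoc, one_mul, smul_add, smul_smul]
  rw [inv_mul_cancel₀ ht, one_smul, mul_comm]

theorem cherednik_castSucc_mul_demazureLustig (q : kˣ) {t : k} (ht : t ≠ 0) (i : Fin m) :
    cherednik q t i.castSucc * demazureLustig t i =
      (t - 1) • cherednik q t i.castSucc + demazureLustig t i * cherednik q t i.succ := by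
  rw [cherednik_castSucc q ht, smul_mul_assoc, mul_assoc, mul_assoc, demazureLustig_mul_self]
  simp only [mul_add, mul_smul_comm, mul_one, smul_add, smul_smul]
  rw [inv_mul_cancel₀ ht, one_smul, mul_comm, mul_assoc]

/-- The correction terms of the exchange relations at `Y_i` and `Y_{i+1}` cancel in the sum. This is
what makes `U⁻ E_η` an eigenvector of `∑ Y_j`. -/
theorem demazureLustig_mul_sum_cherednik (q : kˣ) {t : k} (ht : t ≠ 0) (i : Fin m) :
    demazureLustig t i * ∑ j, cherednik q t j = (∑ j, cherednik q t j) * demazureLustig t i := by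
  have hne : i.castSucc ≠ i.succ := (Fin.castSucc_lt_succ).ne
  rw [Finset.mul_sum, Finset.sum_mul, ← sub_eq_zero, ← Finset.sum_sub_distrib,
    ← Finset.sum_subset (Finset.subset_univ {i.castSucc, i.succ}), Finset.sum_pair hne]
  · rw [demazureLustig_mul_cherednik_castSucc q ht, cherednik_castSucc_mul_demazureLustig q ht]
    abel
  · intro j _ hj
    simp only [Finset.mem_insert, Finset.mem_singleton, not_or] at hj
    rw [demazureLustig_mul_cherednik q ht j i hj.1 hj.2, sub_self]

/-- The raising operator `Φ = x_n ω`. -/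
noncomputable def raising (m : ℕ) (q : kˣ) : Module.End k (RatFun k (m + 1)) :=
  mulVar k (Fin.last m) * omegaOp m q

theorem demazureLustig_mul_raising (q : kˣ) (t : k) {i j : Fin m} (h : (i : ℕ) + 1 = j) :
    demazureLustig t i * raising m q = raising m q * demazureLustig t j := by
  have hj := j.2
  rw [raising, ← mul_assoc, demazureLustig_mul_mulVar_of_ne t (by simp [Fin.ext_iff]; omega)
    (by simp [Fin.ext_iff]; omega), mul_assoc, ← omegaOp_mul_demazureLustig q t h, mul_assoc]

theorem invProd_mul_mulVar_last {t : k} (ht : t ≠ 0) {r : Fin (m + 1)} {i : Fin (m + 1)}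
    (h : (r : ℕ) < i) : invProd m t r * mulVar k i = mulVar k i * invProd m t r := by
  induction r using Fin.induction with
  | zero => rw [Fin.val_zero, invProd_zero, one_mul, mul_one]
  | succ r ih =>
    rw [Fin.val_succ] at h ⊢
    have hc := (demazureLustigInv_mul_of_comm (i := r) (j := r) (A := mulVar k i) ht
      (demazureLustig_mul_mulVar_of_ne t (by simp [Fin.ext_iff]; omega)
        (by simp [Fin.ext_iff]; omega)).symm).symm
    rw [invProd_succ, mul_assoc, hc, ← mul_assoc, ← Fin.val_castSucc,
      ih (by rw [Fin.val_castSucc]; omega), mul_assoc]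

/-- `T_1 ⋯ T_r`. -/
noncomputable def lowProd (m : ℕ) (t : k) (r : ℕ) : Module.End k (RatFun k (m + 1)) :=
  (((List.finRange m).filter fun j : Fin m => (j : ℕ) < r).map (demazureLustig t)).prod

theorem lowProd_succ (t : k) (i : Fin m) :
    lowProd m t (i + 1) = lowProd m t i * demazureLustig t i := by
  rw [lowProd, filter_lt_succ_finRange i.2]; simp [lowProd]

theorem lowProd_last (t : k) : lowProd m t m = upProd m t 0 := by
  rw [lowProd, upProd, List.filter_eq_self.2 (by simp), List.filter_eq_self.2 (by simp)]

theorem invProd_mul_mulVar {t : k} (ht : t ≠ 0) (r : Fin (m + 1)) :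
    invProd m t r * mulVar k r = t⁻¹ ^ (r : ℕ) • (mulVar k 0 * lowProd m t r) := by
  induction r using Fin.induction with
  | zero => simp [invProd_zero, lowProd]
  | succ r ih =>
    rw [Fin.val_castSucc] at ih
    rw [Fin.val_succ, invProd_succ, mul_assoc, demazureLustigInv_mul_mulVar_succ ht,
      mul_smul_comm, ← mul_assoc, ih, lowProd_succ, smul_mul_assoc, smul_smul, pow_succ',
      mul_assoc]

theorem omegaOp_mul_mulVar_zero (q : kˣ) :
    omegaOp m q * mulVar k 0 = (q : k) • (mulVar k (Fin.last m) * omegaOp m q) := by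
  ext f
  simp only [Module.End.mul_apply, LinearMap.smul_apply, omegaOp_apply, mulVar_apply, map_mul,
    omegaAut_var_zero, smul_mul_assoc]

theorem omegaOp_mul_mulVar_succ (q : kˣ) (i : Fin m) :
    omegaOp m q * mulVar k i.succ = mulVar k i.castSucc * omegaOp m q := by
  ext f
  simp only [Module.End.mul_apply, omegaOp_apply, mulVar_apply, map_mul, omegaAut_var_succ]

/-- Moving `x_n` to the left across `T_1⁻¹ ⋯ T_{n-1}⁻¹` leaves `x_1 T_1 ⋯ T_{n-1}`, whose product
with `ω` is `Y_1` up to a power of `t`. The factor `q` comes from `ω x_1 = q x_n ω`. -/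
theorem cherednik_last_mul_raising (q : kˣ) {t : k} (ht : t ≠ 0) :
    cherednik q t (Fin.last m) * raising m q = (q : k) • (raising m q * cherednik q t 0) := by
  have h := invProd_mul_mulVar ht (Fin.last m)
  rw [Fin.val_last, lowProd_last] at h
  rw [cherednik_last, cherednik_zero, raising, mul_assoc, ← mul_assoc (invProd m t m), h]
  simp only [smul_mul_assoc, mul_smul_comm]
  rw [mul_assoc, ← mul_assoc (omegaOp m q) (mulVar k 0), omegaOp_mul_mulVar_zero]
  simp only [smul_mul_assoc, mul_assoc, smul_smul, mul_comm]

/-- `T_1⁻¹` crosses `ω²` and becomes `T_{n-1}⁻¹`; every later factor crosses only one `ω` and drops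
its index by one. -/
theorem omegaOp_sq_mul_invProd (q : kˣ) {t : k} (ht : t ≠ 0) {i : Fin m} (hi : (i : ℕ) + 1 = m)
    (r : ℕ) (hr : r < m) :
    omegaOp m q * omegaOp m q * invProd m t (r + 1) =
      demazureLustigInv t i * (omegaOp m q * (invProd m t r * omegaOp m q)) := by
  induction r with
  | zero =>
    have h := invProd_succ (m := m) t ⟨0, hr⟩
    simp only [invProd_zero, one_mul] at h ⊢
    rw [h]
    exact demazureLustigInv_mul_of_comm ht (omegaOp_sq_mul_demazureLustig q t rfl hi)
  | succ r ih =>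
    have h := invProd_succ (m := m) t ⟨r + 1, hr⟩
    have h' := invProd_succ (m := m) t ⟨r, by omega⟩
    have hc := demazureLustigInv_mul_of_comm ht
      (omegaOp_mul_demazureLustig q t (i := ⟨r, by omega⟩) (j := ⟨r + 1, hr⟩) rfl)
    simp only at h h'
    rw [h, ← mul_assoc, ih (by omega), h', mul_assoc (invProd m t r), ← hc]
    simp only [mul_assoc]

/-- Downward induction on `i` through `Y_i = t⁻¹ T_i Y_{i+1} T_i` and `T_i Φ = Φ T_{i+1}`. The base
case, next to the last index, is where the relation for `ω²` enters. -/
theorem cherednik_castSucc_mul_raising (q : kˣ) {t : k} (ht : t ≠ 0) (i : Fin m) :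
    cherednik q t i.castSucc * raising m q = raising m q * cherednik q t i.succ := by
  induction hd : m - (i : ℕ) generalizing i with
  | zero => have := i.2; omega
  | succ d ih =>
    by_cases h : (i : ℕ) + 1 = m
    · have hl : Fin.last m = i.succ := by simp [Fin.ext_iff, h]
      have hr := omegaOp_sq_mul_invProd q ht h i i.2
      rw [h] at hr
      have hY : cherednik q t i.castSucc =
          t⁻¹ • (demazureLustig t i * omegaOp m q * invProd m t i) := by
        rw [cherednik_eq, Fin.val_castSucc, upProd_castSucc, h, upProd_last, mul_one,
          show m - (i : ℕ) = 1 by omega, pow_one]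
      have hv := invProd_mul_mulVar_last ht (r := i.castSucc) (i := Fin.last m) (by simp)
      rw [Fin.val_castSucc] at hv
      calc cherednik q t i.castSucc * raising m q
          = t⁻¹ • (demazureLustig t i * (omegaOp m q * (invProd m t i * mulVar k (Fin.last m)) *
              omegaOp m q)) := by
            rw [hY, raising, smul_mul_assoc]; simp only [mul_assoc]
        _ = t⁻¹ • (demazureLustig t i * mulVar k i.castSucc *
              (omegaOp m q * (invProd m t i * omegaOp m q))) := by
            rw [hv, hl, ← mul_assoc (omegaOp m q), omegaOp_mul_mulVar_succ]; simp only [mul_assoc]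
        _ = mulVar k i.succ * (omegaOp m q * omegaOp m q * invProd m t m) := by
            rw [demazureLustig_mul_mulVar_castSucc ht, hr, smul_mul_assoc, smul_smul,
              inv_mul_cancel₀ ht, one_smul, mul_assoc]
        _ = raising m q * cherednik q t i.succ := by
            rw [raising, ← hl, cherednik_last]; simp only [mul_assoc]
    · have hij : (i : ℕ) + 1 = (⟨i + 1, by omega⟩ : Fin m) := rfl
      have hs : i.succ = (⟨i + 1, by omega⟩ : Fin m).castSucc := rfl
      have := ih ⟨i + 1, by omega⟩ (by simp only; omega)
      set j : Fin m := ⟨i + 1, by omega⟩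
      calc cherednik q t i.castSucc * raising m q
          = t⁻¹ • (demazureLustig t i * (cherednik q t j.castSucc *
              (demazureLustig t i * raising m q))) := by
            rw [cherednik_castSucc q ht i, hs, smul_mul_assoc]; simp only [mul_assoc]
        _ = t⁻¹ • (demazureLustig t i * (cherednik q t j.castSucc * raising m q) *
              demazureLustig t j) := by
            rw [demazureLustig_mul_raising q t hij]; simp only [mul_assoc]
        _ = t⁻¹ • (demazureLustig t i * raising m q * cherednik q t j.succ *
              demazureLustig t j) := by
            rw [this]; simp only [mul_assoc]
        _ = raising m q * cherednik q t i.succ := by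
            rw [demazureLustig_mul_raising q t hij, hs, cherednik_castSucc q ht j, mul_smul_comm]
            simp only [mul_assoc]

theorem demazureLustig_one (t : k) (i : Fin m) : demazureLustig t i 1 = const t := by
  simp [demazureLustig_apply]

/-- Every `T_i` multiplies constants by `t` and `ω` fixes them, so only exponents are counted. The
construction of the `E_η` starts here, with `E_0 = 1`. -/
theorem cherednik_one (q : kˣ) {t : k} (ht : t ≠ 0) (i : Fin (m + 1)) :
    cherednik q t i 1 = const (t⁻¹ ^ (i : ℕ)) := by
  have hc (a b : k) : (const (a * b) : RatFun k (m + 1)) = const a * const b := map_mul _ _ _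
  have hT (i : Fin m) (c : k) : demazureLustig t i (const c) = const (t * c) := by
    have h : (const c : RatFun k (m + 1)) = c • 1 := by rw [const_smul, mul_one]
    rw [h, map_smul, demazureLustig_one, const_smul, hc, mul_comm]
  have hinv (r : Fin (m + 1)) : invProd m t r 1 = const (t⁻¹ ^ (r : ℕ)) := by
    induction r using Fin.induction with
    | zero => simp [invProd_zero, const]
    | succ r ih =>
      rw [Fin.val_castSucc] at ih
      have h1 : demazureLustigInv t r (1 : RatFun k (m + 1)) = t⁻¹ • 1 := by
        rw [demazureLustigInv, LinearMap.add_apply, LinearMap.smul_apply, LinearMap.smul_apply,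
          Module.End.one_apply,
          demazureLustig_one, const_smul t⁻¹, ← hc, inv_mul_cancel₀ ht, show (const 1 : RatFun k (m + 1)) = 1 from
            map_one _, sub_smul, one_smul, sub_add_cancel]
      rw [Fin.val_succ, invProd_succ, Module.End.mul_apply, h1, map_smul, ih, const_smul, ← hc,
        pow_succ']
  induction i using Fin.reverseInduction with
  | last =>
    have h := hinv (Fin.last m)
    rw [Fin.val_last] at h ⊢
    rw [cherednik_last, Module.End.mul_apply, h, omegaOp_apply, aut_const]
  | cast i ih =>
    rw [cherednik_castSucc q ht, LinearMap.smul_apply, Module.End.mul_apply, Module.End.mul_apply,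
      demazureLustig_one, show (const t : RatFun k (m + 1)) = t • 1 by rw [const_smul, mul_one],
      map_smul, map_smul, ih, hT, smul_smul, inv_mul_cancel₀ ht, one_smul, Fin.val_succ,
      Fin.val_castSucc, pow_succ', ← mul_assoc, mul_inv_cancel₀ ht, one_mul]

end CherednikRelations

/-! ### Inversions and reduced words -/

section Length

variable {m : ℕ}

/-- The set of inversions of a permutation. -/
def invSet {n : ℕ} (σ : Perm (Fin n)) : Finset (Fin n × Fin n) :=
  Finset.univ.filter fun p : Fin n × Fin n => p.1 < p.2 ∧ σ p.2 < σ p.1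

theorem card_invSet {n : ℕ} (σ : Perm (Fin n)) : (invSet σ).card = permLength σ := rfl

theorem mem_invSet {n : ℕ} {σ : Perm (Fin n)} {p : Fin n × Fin n} :
    p ∈ invSet σ ↔ p.1 < p.2 ∧ σ p.2 < σ p.1 := by simp [invSet]

theorem simpleSwap_lt {i : Fin m} {a b : Fin (m + 1)} (h : a < b)
    (hne : ¬(a = i.castSucc ∧ b = i.succ)) : simpleSwap i a < simpleSwap i b := by
  simp only [simpleSwap, swap_apply_def, Fin.ext_iff, Fin.val_castSucc, Fin.val_succ,
    Fin.lt_def] at *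
  split_ifs <;> first | omega | (simp only [Fin.val_castSucc, Fin.val_succ] at *; omega)

/-- `s_i` preserves the order of every pair of positions except `(i, i + 1)`, so inversions are
relabelled by `s_i` and one pair is added. -/
theorem invSet_mul_simpleSwap {σ : Perm (Fin (m + 1))} {i : Fin m}
    (h : σ i.castSucc < σ i.succ) :
    invSet (σ * simpleSwap i) = insert (i.castSucc, i.succ)
      ((invSet σ).image fun p => (simpleSwap i p.1, simpleSwap i p.2)) := by
  ext ⟨a, b⟩
  simp only [Finset.mem_insert, Finset.mem_image, mem_invSet, Perm.mul_apply, Prod.mk.injEq,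
    Prod.exists]
  constructor
  · rintro ⟨h1, h2⟩
    by_cases hne : a = i.castSucc ∧ b = i.succ
    · exact Or.inl hne
    · exact Or.inr ⟨_, _, ⟨simpleSwap_lt h1 hne, h2⟩, simpleSwap_simpleSwap i a,
        simpleSwap_simpleSwap i b⟩
  · rintro (⟨rfl, rfl⟩ | ⟨c, d, ⟨h1, h2⟩, rfl, rfl⟩)
    · rw [simpleSwap_castSucc, simpleSwap_succ]
      exact ⟨Fin.castSucc_lt_succ, h⟩
    · rw [simpleSwap_simpleSwap, simpleSwap_simpleSwap]
      refine ⟨simpleSwap_lt h1 ?_, h2⟩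
      rintro ⟨rfl, rfl⟩
      exact absurd h h2.not_gt

theorem prod_invSet_mul_simpleSwap {M : Type*} [CommMonoid M] (g : Fin (m + 1) × Fin (m + 1) → M)
    {σ : Perm (Fin (m + 1))} {i : Fin m} (h : σ i.castSucc < σ i.succ) :
    ∏ p ∈ invSet (σ * simpleSwap i), g p = g (i.castSucc, i.succ) *
      ∏ p ∈ invSet σ, g (simpleSwap i p.1, simpleSwap i p.2) := by
  rw [invSet_mul_simpleSwap h, Finset.prod_insert, Finset.prod_image]
  · rintro ⟨a, b⟩ _ ⟨c, d⟩ _ h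
    simpa using h
  · simp only [Finset.mem_image, mem_invSet, Prod.mk.injEq, Prod.exists, not_exists, not_and,
      and_imp]
    intro a b hab _ ha hb
    have ha' : a = i.succ := by
      rw [← simpleSwap_castSucc, ← ha, simpleSwap_simpleSwap]
    have hb' : b = i.castSucc := by
      rw [← simpleSwap_succ, ← hb, simpleSwap_simpleSwap]
    rw [ha', hb'] at hab
    exact absurd hab Fin.castSucc_lt_succ.not_gt

theorem permLength_mul_simpleSwap {σ : Perm (Fin (m + 1))} {i : Fin m}
    (h : σ i.castSucc < σ i.succ) : permLength (σ * simpleSwap i) = permLength σ + 1 := by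
  have := prod_invSet_mul_simpleSwap (fun _ => Multiplicative.ofAdd 1) h
  simp only [Finset.prod_const, card_invSet] at this
  have := congr(Multiplicative.toAdd $this)
  simp only [toAdd_pow, toAdd_ofAdd, toAdd_mul, smul_eq_mul, mul_one] at this
  omega

theorem permLength_mul_simpleSwap' {σ : Perm (Fin (m + 1))} {i : Fin m}
    (h : σ i.succ < σ i.castSucc) : permLength (σ * simpleSwap i) + 1 = permLength σ := by
  rw [← permLength_mul_simpleSwap (i := i), mul_assoc, simpleSwap_mul_self, mul_one]
  rwa [Perm.mul_apply, Perm.mul_apply, simpleSwap_castSucc, simpleSwap_succ]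

theorem lt_or_gt_simpleSwap (σ : Perm (Fin (m + 1))) (i : Fin m) :
    σ i.castSucc < σ i.succ ∨ σ i.succ < σ i.castSucc :=
  lt_or_gt_of_ne (σ.injective.ne Fin.castSucc_lt_succ.ne)

theorem permLength_one {n : ℕ} : permLength (1 : Perm (Fin n)) = 0 := by
  rw [permLength, Finset.card_eq_zero, Finset.filter_eq_empty_iff]
  rintro p - ⟨h1, h2⟩
  exact absurd h1 h2.not_gt

theorem exists_descent {σ : Perm (Fin (m + 1))} (h : σ ≠ 1) :
    ∃ i : Fin m, σ i.succ < σ i.castSucc := by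
  by_contra! hc
  have hs : StrictMono σ := Fin.strictMono_iff_lt_succ.2 fun i =>
    (lt_or_gt_simpleSwap σ i).resolve_right (hc i).not_gt
  refine h (Equiv.ext fun i => ?_)
  have := (hs.range_inj strictMono_id).1 (by simp [σ.surjective.range_eq])
  exact congr_fun this i

theorem permLength_prod_le (w : List (Fin m)) : permLength (w.map simpleSwap).prod ≤ w.length := by
  induction w using List.reverseRecOn with
  | nil => simp [permLength_one]
  | append_singleton w i ih =>
    rw [List.map_append, List.prod_append, List.map_singleton, List.prod_singleton,
      List.length_append, List.length_singleton]
    rcases lt_or_gt_simpleSwap (w.map simpleSwap).prod i with h | h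
    · rw [permLength_mul_simpleSwap h]; omega
    · have := permLength_mul_simpleSwap' h; omega

theorem exists_word_length_eq (σ : Perm (Fin (m + 1))) :
    ∃ w : List (Fin m), (w.map simpleSwap).prod = σ ∧ w.length = permLength σ := by
  induction hn : permLength σ using Nat.strong_induction_on generalizing σ with
  | _ n ih =>
  by_cases hσ : σ = 1
  · exact ⟨[], by simp [hσ], by simp [← hn, hσ, permLength_one]⟩
  · obtain ⟨i, hi⟩ := exists_descent hσ
    have hl := permLength_mul_simpleSwap' hi
    obtain ⟨w, hw, hlen⟩ := ih _ (by omega) (σ * simpleSwap i) rfl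
    refine ⟨w ++ [i], ?_, by simp; omega⟩
    rw [List.map_append, List.prod_append, List.map_singleton, List.prod_singleton, hw, mul_assoc,
      simpleSwap_mul_self, mul_one]

theorem isReducedWord_iff {σ : Perm (Fin (m + 1))} {w : List (Fin m)} :
    IsReducedWord σ w ↔ (w.map simpleSwap).prod = σ ∧ w.length = permLength σ := by
  constructor
  · rintro ⟨rfl, h⟩
    obtain ⟨v, hv, hl⟩ := exists_word_length_eq (w.map simpleSwap).prod
    exact ⟨rfl, le_antisymm (hl ▸ h v hv) (permLength_prod_le w)⟩
  · rintro ⟨rfl, h⟩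
    refine ⟨rfl, fun v hv => ?_⟩
    rw [h, ← hv]
    exact permLength_prod_le v

theorem sign_eq_neg_one_pow_permLength (σ : Perm (Fin (m + 1))) :
    (Perm.sign σ : ℤ) = (-1) ^ permLength σ := by
  induction hn : permLength σ using Nat.strong_induction_on generalizing σ with
  | _ n ih =>
  by_cases hσ : σ = 1
  · rw [← hn, hσ, permLength_one]; simp
  · obtain ⟨i, hi⟩ := exists_descent hσ
    have hl := permLength_mul_simpleSwap' hi
    have := ih _ (by omega) (σ * simpleSwap i) rfl
    have hs : Perm.sign (simpleSwap i) = -1 := Perm.sign_swap Fin.castSucc_lt_succ.ne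
    rw [Perm.sign_mul, hs] at this
    rw [← hn, ← hl, pow_succ, ← this]
    simp

end Length

/-! ### Independence of the reduced word -/

section Matsumoto

variable {m : ℕ}

theorem simpleSwap_comm {i j : Fin m} (h : (i : ℕ) + 1 < j) :
    simpleSwap i * simpleSwap j = simpleSwap j * simpleSwap i := by
  refine (Perm.disjoint_iff_disjoint_support.2 ?_).commute
  rw [simpleSwap, simpleSwap, Perm.support_swap (Fin.castSucc_lt_succ).ne,
    Perm.support_swap (Fin.castSucc_lt_succ).ne]
  simp [Fin.ext_iff]; omega

/-- Any two reduced words of a permutation have the same image in a monoid in which the braid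
relations hold. -/
theorem prod_eq_of_reducedWord {M : Type*} [Monoid M] {f : Fin m → M}
    (hcomm : ∀ i j : Fin m, (i : ℕ) + 1 < j → f i * f j = f j * f i)
    (hbraid : ∀ i j : Fin m, (i : ℕ) + 1 = j → f i * f j * f i = f j * f i * f j)
    {σ : Perm (Fin (m + 1))} {w v : List (Fin m)} (hw : IsReducedWord σ w)
    (hv : IsReducedWord σ v) : (w.map f).prod = (v.map f).prod := by
  induction hn : permLength σ using Nat.strong_induction_on generalizing σ w v with
  | _ n ih =>
  rw [isReducedWord_iff] at hw hv
  -- the last letters of the two words are descents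
  have hlast : ∀ (w : List (Fin m)) (i : Fin m), ((w ++ [i]).map simpleSwap).prod = σ →
      (w ++ [i]).length = permLength σ → IsReducedWord (σ * simpleSwap i) w ∧
        σ i.succ < σ i.castSucc := by
    intro w i h1 h2
    rw [List.map_append, List.prod_append, List.map_singleton, List.prod_singleton] at h1
    have h3 : (w.map simpleSwap).prod = σ * simpleSwap i := by
      rw [← h1, mul_assoc, simpleSwap_mul_self, mul_one]
    have h4 := permLength_prod_le w
    rw [h3] at h4
    rw [List.length_append, List.length_singleton] at h2
    rcases lt_or_gt_simpleSwap σ i with h | h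
    · have := permLength_mul_simpleSwap h; omega
    · have := permLength_mul_simpleSwap' h
      exact ⟨isReducedWord_iff.2 ⟨h3, by omega⟩, h⟩
  -- If `σ` has two distinct descents `i`, `j`, the longest element of the group generated by `s_i`,
  -- `s_j` splits off on the right. A reduced word `r` of the remaining factor extends to reduced
  -- words of `σ s_i` and `σ s_j`, to which the induction hypothesis applies.
  have key : ∀ (w v : List (Fin m)) (i j : Fin m), i < j → IsReducedWord (σ * simpleSwap i) w →
      σ i.succ < σ i.castSucc → IsReducedWord (σ * simpleSwap j) v → σ j.succ < σ j.castSucc →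
      (w.map f).prod * f i = (v.map f).prod * f j := by
    intro w v i j hij hw hi hv hj
    have hli := permLength_mul_simpleSwap' hi
    have hlj := permLength_mul_simpleSwap' hj
    rcases (show (i : ℕ) + 1 < j ∨ (i : ℕ) + 1 = j by rw [Fin.lt_def] at hij; omega) with h | h
    · have e1 : simpleSwap i j.castSucc = j.castSucc :=
        simpleSwap_of_ne (by simp [Fin.ext_iff]; omega) (by simp [Fin.ext_iff]; omega)
      have e2 : simpleSwap i j.succ = j.succ :=
        simpleSwap_of_ne (by simp [Fin.ext_iff]; omega) (by simp [Fin.ext_iff]; omega)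
      have hl := permLength_mul_simpleSwap' (σ := σ * simpleSwap i) (i := j) (by
        rwa [Perm.mul_apply, Perm.mul_apply, e1, e2])
      obtain ⟨r, hr, hrl⟩ := exists_word_length_eq (σ * simpleSwap i * simpleSwap j)
      have h1 : IsReducedWord (σ * simpleSwap i) (r ++ [j]) := by
        refine isReducedWord_iff.2 ⟨?_, by simp; omega⟩
        simp [hr, mul_assoc, simpleSwap_mul_self]
      have h2 : IsReducedWord (σ * simpleSwap j) (r ++ [i]) := by
        refine isReducedWord_iff.2 ⟨?_, by simp; omega⟩
        simp only [List.map_append, List.prod_append, hr, List.map_singleton, List.prod_singleton]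
        rw [mul_assoc σ, simpleSwap_comm h]
        simp [mul_assoc, simpleSwap_mul_self]
      rw [ih _ (by omega) hw h1 rfl, ih _ (by omega) hv h2 rfl]
      simp [mul_assoc, hcomm i j h]
    · have hs : i.succ = j.castSucc := by simp [Fin.ext_iff, h]
      have n1 : (i.castSucc : Fin (m + 1)) ≠ j.castSucc := by simp [Fin.ext_iff]; omega
      have n2 : (i.castSucc : Fin (m + 1)) ≠ j.succ := by simp [Fin.ext_iff]; omega
      have n3 : (j.castSucc : Fin (m + 1)) ≠ j.succ := by simp [Fin.ext_iff]
      have e1 : simpleSwap i i.castSucc = j.castSucc := by rw [simpleSwap_castSucc, hs]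
      have e2 : simpleSwap i j.castSucc = i.castSucc := by rw [← hs, simpleSwap_succ]
      have e3 : simpleSwap i j.succ = j.succ := simpleSwap_of_ne n2.symm (hs ▸ n3.symm)
      have e4 : simpleSwap j i.castSucc = i.castSucc := simpleSwap_of_ne n1 n2
      rw [hs] at hi
      have hl := permLength_mul_simpleSwap' (σ := σ * simpleSwap i) (i := j) (by
        rw [Perm.mul_apply, Perm.mul_apply, e2, e3]; exact hj.trans hi)
      have hl' := permLength_mul_simpleSwap' (σ := σ * simpleSwap i * simpleSwap j) (i := i) (by
        rw [hs, Perm.mul_apply, Perm.mul_apply, Perm.mul_apply, Perm.mul_apply,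
          simpleSwap_castSucc, e3, e4, e1]; exact hj)
      have hb := simpleSwap_braid h
      obtain ⟨r, hr, hrl⟩ := exists_word_length_eq
        (σ * simpleSwap i * simpleSwap j * simpleSwap i)
      have h1 : IsReducedWord (σ * simpleSwap i) (r ++ [i, j]) := by
        refine isReducedWord_iff.2 ⟨?_, by simp; omega⟩
        simp only [List.map_append, List.prod_append, hr, List.map_cons, List.prod_cons,
          List.map_nil, List.prod_nil, mul_one]
        rw [mul_assoc _ (simpleSwap i) (simpleSwap i * _), ← mul_assoc (simpleSwap i),
          simpleSwap_mul_self, one_mul, mul_assoc, simpleSwap_mul_self, mul_one]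
      have h2 : IsReducedWord (σ * simpleSwap j) (r ++ [j, i]) := by
        refine isReducedWord_iff.2 ⟨?_, by simp; omega⟩
        simp only [List.map_append, List.prod_append, hr, List.map_cons, List.prod_cons,
          List.map_nil, List.prod_nil, mul_one]
        rw [mul_assoc σ, mul_assoc σ, hb, mul_assoc, mul_assoc _ (simpleSwap j) (simpleSwap j * _),
          ← mul_assoc (simpleSwap j) (simpleSwap j), simpleSwap_mul_self, one_mul,
          mul_assoc, simpleSwap_mul_self, mul_one]
      rw [ih _ (by omega) hw h1 rfl, ih _ (by omega) hv h2 rfl]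
      simp only [List.map_append, List.prod_append, List.map_cons, List.prod_cons, List.map_nil,
        List.prod_nil, mul_one]
      rw [mul_assoc, hbraid i j h]
      simp only [mul_assoc]
  rcases w.eq_nil_or_concat' with rfl | ⟨w, i, rfl⟩
  · have : v = [] := List.length_eq_zero_iff.1 (by rw [hv.2, ← hw.2]; rfl)
    rw [this]
  · rcases v.eq_nil_or_concat' with rfl | ⟨v, j, rfl⟩
    · have := hw.2.trans hv.2.symm
      simp at this
    · obtain ⟨hw', hi⟩ := hlast w i hw.1 hw.2
      obtain ⟨hv', hj⟩ := hlast v j hv.1 hv.2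
      simp only [List.map_append, List.prod_append, List.map_singleton, List.prod_singleton]
      rcases lt_trichotomy i j with h | rfl | h
      · exact key w v i j h hw' hi hv' hj
      · rw [ih _ _ hw' hv' rfl]
        have := permLength_mul_simpleSwap' hi
        omega
      · exact (key v w j i h hv' hj hw' hi).symm

end Matsumoto

/-! ### The operators `T_σ` -/

section HeckeOp

variable {k : Type*} [Field k] {m : ℕ}

theorem heckeOp_eq {t : k} {σ : Perm (Fin (m + 1))} {w : List (Fin m)} (hw : IsReducedWord σ w) :
    heckeOp t σ = (w.map (demazureLustig t)).prod :=
  prod_eq_of_reducedWord (fun _ _ h => demazureLustig_comm t h)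
    (fun _ _ h => demazureLustig_braid t h) (exists_reducedWord σ).choose_spec hw

theorem heckeOp_mul_demazureLustig (t : k) {σ : Perm (Fin (m + 1))} {i : Fin m}
    (h : σ i.castSucc < σ i.succ) :
    heckeOp t σ * demazureLustig t i = heckeOp t (σ * simpleSwap i) := by
  obtain ⟨w, hw, hl⟩ := exists_word_length_eq σ
  rw [heckeOp_eq (isReducedWord_iff.2 ⟨hw, hl⟩), heckeOp_eq (w := w ++ [i])]
  · simp
  · refine isReducedWord_iff.2 ⟨by simp [hw], ?_⟩
    rw [permLength_mul_simpleSwap h]; simp [hl]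

/-- The terms of `σ` and `σ s_i` combine to a multiple of `T_σ (1 - t⁻¹ T_i)`, and `(1 - t⁻¹
T_i)(T_i + 1) = 0` by the quadratic relation. -/
theorem antisymmetrizer_mul_demazureLustig {t : k} (ht : t ≠ 0) (i : Fin m) :
    antisymmetrizer m t * demazureLustig t i = -antisymmetrizer m t := by
  rw [← add_eq_zero_iff_eq_neg]
  have h : antisymmetrizer m t * demazureLustig t i + antisymmetrizer m t =
      antisymmetrizer m t * (demazureLustig t i + 1) := by rw [mul_add, mul_one]
  rw [h, antisymmetrizer, Finset.sum_mul]
  have hq : (1 + (-t)⁻¹ • demazureLustig t i) * (demazureLustig t i + 1) = 0 := by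
    rw [mul_add, mul_one, add_mul, one_mul, smul_mul_assoc, demazureLustig_mul_self, smul_add,
      smul_smul, smul_smul, inv_neg, neg_mul, neg_mul, inv_mul_cancel₀ ht, mul_sub,
      inv_mul_cancel₀ ht]
    module
  have key (σ : Perm (Fin (m + 1))) (hσ : σ i.castSucc < σ i.succ) :
      (-t)⁻¹ ^ permLength σ • heckeOp t σ * (demazureLustig t i + 1) +
        (-t)⁻¹ ^ permLength (σ * simpleSwap i) • heckeOp t (σ * simpleSwap i) *
          (demazureLustig t i + 1) = 0 := by
    rw [← heckeOp_mul_demazureLustig t hσ, permLength_mul_simpleSwap hσ, pow_succ, mul_smul,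
      ← mul_smul_comm, smul_mul_assoc, smul_mul_assoc, ← smul_add, mul_assoc, ← mul_add,
      ← one_add_mul, hq, mul_zero, smul_zero]
  refine Finset.sum_involution (fun σ _ => σ * simpleSwap i) ?_ ?_ (fun _ _ => Finset.mem_univ _) ?_
  · intro σ _
    rcases lt_or_gt_simpleSwap σ i with h | h
    · exact key σ h
    · have := key (σ * simpleSwap i)
        (by rwa [Perm.mul_apply, Perm.mul_apply, simpleSwap_castSucc, simpleSwap_succ])
      rw [mul_assoc, simpleSwap_mul_self, mul_one] at this
      exact (add_comm _ _).trans this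
  · intro σ _ _ h
    have : simpleSwap i = 1 := mul_left_cancel (h.trans (mul_one σ).symm)
    have := congr($this i.castSucc)
    rw [simpleSwap_castSucc, Perm.one_apply] at this
    exact Fin.castSucc_lt_succ.ne' this
  · intro σ _
    rw [mul_assoc, simpleSwap_mul_self, mul_one]

end HeckeOp

/-! ### The product formula for the antisymmetriser -/

section Alternating

variable {k : Type*} [Field k] {n : ℕ}

/-- The alternating operator `∑_σ sgn(σ) σ`. -/
noncomputable def altOp (k : Type*) [Field k] (n : ℕ) : Module.End k (RatFun k n) :=
  ∑ σ : Perm (Fin n), (Perm.sign σ : ℤ) • permOp k σ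

theorem altOp_apply (f : RatFun k n) :
    altOp k n f = ∑ σ : Perm (Fin n), ((Perm.sign σ : ℤ) : RatFun k n) * permAut k σ f := by
  simp [altOp, permOp_apply]

theorem permAut_altOp (σ : Perm (Fin n)) (f : RatFun k n) :
    permAut k σ (altOp k n f) = ((Perm.sign σ : ℤ) : RatFun k n) * altOp k n f := by
  rw [altOp_apply, map_sum, Finset.mul_sum, ← Equiv.sum_comp (Equiv.mulLeft σ)
    fun τ => ((Perm.sign σ : ℤ) : RatFun k n) * (((Perm.sign τ : ℤ) : RatFun k n) *
      permAut k τ f)]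
  refine Finset.sum_congr rfl fun τ _ => ?_
  simp only [Equiv.coe_mulLeft, map_mul, map_intCast, permAut_mul]
  rcases Int.units_eq_one_or (Perm.sign σ) with h | h <;> simp [h]

/-- The Vandermonde determinant of the variables. -/
noncomputable def vand (k : Type*) [Field k] (n : ℕ) : RatFun k n :=
  (Matrix.vandermonde (var k : Fin n → RatFun k n)).det

theorem vand_ne_zero : vand k n ≠ 0 :=
  Matrix.det_vandermonde_ne_zero_iff.2 var_injective

theorem permAut_vand (σ : Perm (Fin n)) :
    permAut k σ (vand k n) = ((Perm.sign σ : ℤ) : RatFun k n) * vand k n := by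
  rw [vand, ← Matrix.det_permute, AlgEquiv.map_det]
  congr 1
  ext i j
  simp [Matrix.vandermonde_apply]

end Alternating

/-! ### Reduction of `U⁻` to the alternating sum -/

section ProductFormula

variable {k : Type*} [Field k] {m : ℕ}

/-- `f + s_i f = (T_i + 1)(d f)`, which `U⁻` annihilates. In `T_i + 1` the identity has coefficient
`(x_i - t x_{i+1})/(x_i - x_{i+1})` and `s_i` has coefficient `(t x_i - x_{i+1})/(x_i - x_{i+1})`;
`d` inverts the first and `s_i d` the second. -/
theorem antisymmetrizer_add_simpleSwap {t : k} (ht : t ≠ 0) (i : Fin m) (f : RatFun k (m + 1)) :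
    antisymmetrizer m t (f + permAut k (simpleSwap i) f) = 0 := by
  have hne : i.castSucc ≠ i.succ := (Fin.castSucc_lt_succ).ne
  have h := var_sub_var_ne_zero (k := k) hne
  have h' := var_sub_var_ne_zero (k := k) hne.symm
  have h2 := const_mul_var_sub_ne_zero (k := k) hne.symm t
  have h3 : var k i.castSucc - const t * var k i.succ ≠ 0 := by rw [← neg_sub]; exact neg_ne_zero.2 h2
  have h4 := const_mul_var_sub_ne_zero (k := k) hne t
  set d : RatFun k (m + 1) := (var k i.castSucc - var k i.succ) /
    (var k i.castSucc - const t * var k i.succ) with hd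
  have hs : permAut k (simpleSwap i) d = (var k i.castSucc - var k i.succ) /
      (const t * var k i.castSucc - var k i.succ) := by
    rw [hd, map_div₀, map_sub, map_sub, map_mul, aut_const, permAut_var, permAut_var,
      simpleSwap_castSucc, simpleSwap_succ, div_eq_div_iff _ h4]
    · ring
    · rw [← neg_sub]; exact neg_ne_zero.2 h4
  have key : f + permAut k (simpleSwap i) f = demazureLustig t i (d * f) + d * f := by
    rw [demazureLustig_apply, map_mul, hs, hd, dlCoeff]
    field_simp
    ring
  have hU := congr($(antisymmetrizer_mul_demazureLustig ht i) (d * f))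
  rw [Module.End.mul_apply, LinearMap.neg_apply] at hU
  rw [key, map_add, hU, neg_add_cancel]

theorem antisymmetrizer_permAut {t : k} (ht : t ≠ 0) (σ : Perm (Fin (m + 1)))
    (f : RatFun k (m + 1)) :
    antisymmetrizer m t (permAut k σ f) = (Perm.sign σ : ℤ) • antisymmetrizer m t f := by
  obtain ⟨w, rfl, -⟩ := exists_word_length_eq σ
  induction w with
  | nil => simp [permAut_one]
  | cons i w ih =>
    rw [List.map_cons, List.prod_cons, permAut_mul]
    have := antisymmetrizer_add_simpleSwap ht i (permAut k (w.map simpleSwap).prod f)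
    rw [map_add] at this
    have hs : Perm.sign (simpleSwap i) = -1 := Perm.sign_swap Fin.castSucc_lt_succ.ne
    rw [eq_neg_of_add_eq_zero_right this, ih, Perm.sign_mul, hs]
    simp

theorem prod_demazureLustig_mul (t : k) {g : RatFun k (m + 1)}
    (hg : ∀ i : Fin m, permAut k (simpleSwap i) g = g) (w : List (Fin m)) (f : RatFun k (m + 1)) :
    (w.map (demazureLustig t)).prod (g * f) = g * (w.map (demazureLustig t)).prod f := by
  induction w with
  | nil => simp
  | cons i w ih =>
    rw [List.map_cons, List.prod_cons, Module.End.mul_apply, ih, Module.End.mul_apply,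
      demazureLustig_apply, demazureLustig_apply, map_mul, hg]
    ring

theorem antisymmetrizer_apply (t : k) (f : RatFun k (m + 1)) :
    antisymmetrizer m t f =
      ∑ σ : Perm (Fin (m + 1)), const ((-t)⁻¹ ^ permLength σ) * heckeOp t σ f := by
  simp only [antisymmetrizer, LinearMap.sum_apply, LinearMap.smul_apply, const_smul]

theorem antisymmetrizer_mul (t : k) {g : RatFun k (m + 1)}
    (hg : ∀ i : Fin m, permAut k (simpleSwap i) g = g) (f : RatFun k (m + 1)) :
    antisymmetrizer m t (g * f) = g * antisymmetrizer m t f := by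
  rw [antisymmetrizer_apply, antisymmetrizer_apply, Finset.mul_sum]
  refine Finset.sum_congr rfl fun σ _ => ?_
  rw [heckeOp, prod_demazureLustig_mul t hg]
  ring

theorem antisymmetrizer_altOp {t : k} (ht : t ≠ 0) (f : RatFun k (m + 1)) :
    antisymmetrizer m t (altOp k (m + 1) f) =
      ((m + 1).factorial : RatFun k (m + 1)) * antisymmetrizer m t f := by
  have h (σ : Perm (Fin (m + 1))) : antisymmetrizer m t (((Perm.sign σ : ℤ) : RatFun k (m + 1)) *
      permAut k σ f) = antisymmetrizer m t f := by
    rw [← zsmul_eq_mul, map_zsmul, antisymmetrizer_permAut ht]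
    rcases Int.units_eq_one_or (Perm.sign σ) with h | h <;> simp [h]
  rw [altOp_apply, map_sum, Finset.sum_congr rfl fun σ _ => h σ, Finset.sum_const,
    Finset.card_univ, Fintype.card_perm, Fintype.card_fin, nsmul_eq_mul]

/-- The antisymmetriser is a multiple of the alternating operator. -/
theorem exists_antisymmetrizer_eq_mul_altOp [CharZero k] {t : k} (ht : t ≠ 0) :
    ∃ h : RatFun k (m + 1), ∀ f, antisymmetrizer m t f = h * altOp k (m + 1) f := by
  have : CharZero (RatFun k (m + 1)) := charZero_of_injective_algebraMap
    (FaithfulSMul.algebraMap_injective k (RatFun k (m + 1)))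
  have hn : ((m + 1).factorial : RatFun k (m + 1)) ≠ 0 := Nat.cast_ne_zero.2 (Nat.factorial_ne_zero _)
  -- With `V` the Vandermonde determinant, `A f / V` is symmetric, so `n! U⁻ f = U⁻ (A f) = (A f /
  -- V) U⁻ V`; the factor is read off from this.
  refine ⟨antisymmetrizer m t (vand k (m + 1)) / ((m + 1).factorial * vand k (m + 1)), fun f => ?_⟩
  have hV := vand_ne_zero (k := k) (n := m + 1)
  have hg (i : Fin m) : permAut k (simpleSwap i) (altOp k (m + 1) f / vand k (m + 1)) =
      altOp k (m + 1) f / vand k (m + 1) := by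
    have hs : Perm.sign (simpleSwap i) = -1 := Perm.sign_swap Fin.castSucc_lt_succ.ne
    rw [map_div₀, permAut_altOp, permAut_vand, hs]
    simp [neg_div_neg_eq]
  have h := antisymmetrizer_mul t hg (vand k (m + 1))
  rw [div_mul_cancel₀ _ hV, antisymmetrizer_altOp ht] at h
  rw [← mul_right_inj' hn, h]
  field_simp

/-- The leading coefficient of `T_σ`. -/
noncomputable def leadCoeff (t : k) (σ : Perm (Fin (m + 1))) : RatFun k (m + 1) :=
  ∏ p ∈ invSet σ, dlCoeff t (σ p.2) (σ p.1)

theorem leadCoeff_mul_simpleSwap (t : k) {σ : Perm (Fin (m + 1))} {i : Fin m}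
    (h : σ i.castSucc < σ i.succ) : leadCoeff t (σ * simpleSwap i) =
      leadCoeff t σ * dlCoeff t (σ i.castSucc) (σ i.succ) := by
  rw [leadCoeff, prod_invSet_mul_simpleSwap (fun p => dlCoeff t ((σ * simpleSwap i) p.2)
    ((σ * simpleSwap i) p.1)) h, mul_comm]
  simp only [Perm.mul_apply, simpleSwap_simpleSwap, simpleSwap_castSucc, simpleSwap_succ]
  rfl

/-- Expansion of a product of Demazure–Lustig operators in permutations. -/
theorem exists_expansion (t : k) (w : List (Fin m)) :
    ∃ b : Perm (Fin (m + 1)) → RatFun k (m + 1),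
      (∀ f, (w.map (demazureLustig t)).prod f = ∑ σ, b σ * permAut k σ f) ∧
      (∀ σ, w.length < permLength σ → b σ = 0) ∧
      (w.length = permLength (w.map simpleSwap).prod →
        b (w.map simpleSwap).prod = leadCoeff t (w.map simpleSwap).prod) := by
  classical
  induction w using List.reverseRecOn with
  | nil =>
    refine ⟨Pi.single 1 1, fun f => ?_, fun σ h => ?_, fun _ => ?_⟩
    · rw [Finset.sum_eq_single 1]
      · simp [permAut_one]
      · intro σ _ h; simp [h]
      · simp
    · rw [Pi.single_eq_of_ne]
      rintro rfl
      simp [permLength_one] at h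
    · have : invSet (1 : Perm (Fin (m + 1))) = ∅ := Finset.card_eq_zero.1 permLength_one
      have h1 : (([] : List (Fin m)).map simpleSwap).prod = 1 := rfl
      rw [h1, Pi.single_eq_same, leadCoeff, this, Finset.prod_empty]
  | append_singleton w i ih =>
    obtain ⟨b, hb, hb0, hbl⟩ := ih
    -- `τ` arises from `τ` through the part of `T_i` without `s_i`, and from `τ s_i` through the
    -- part with `s_i`.
    refine ⟨fun τ => b τ * (const t - dlCoeff t (τ i.castSucc) (τ i.succ)) +
      b (τ * simpleSwap i) * dlCoeff t (τ i.succ) (τ i.castSucc), fun f => ?_, fun σ h => ?_,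
      fun h => ?_⟩
    · rw [List.map_append, List.prod_append, List.map_singleton, List.prod_singleton,
        Module.End.mul_apply, hb]
      have e1 (σ : Perm (Fin (m + 1))) : b σ * permAut k σ (demazureLustig t i f) =
          b σ * (const t - dlCoeff t (σ i.castSucc) (σ i.succ)) * permAut k σ f +
            b σ * dlCoeff t (σ i.castSucc) (σ i.succ) * permAut k (σ * simpleSwap i) f := by
        rw [demazureLustig_apply, permAut_mul]
        simp only [map_add, map_mul, map_sub, aut_const, permAut_dlCoeff]
        ring
      rw [Finset.sum_congr rfl fun σ _ => e1 σ, Finset.sum_add_distrib,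
        ← Equiv.sum_comp (Equiv.mulRight (simpleSwap i))
          fun σ => b σ * dlCoeff t (σ i.castSucc) (σ i.succ) * permAut k (σ * simpleSwap i) f,
        ← Finset.sum_add_distrib]
      refine Finset.sum_congr rfl fun σ _ => ?_
      simp only [Equiv.coe_mulRight, mul_assoc σ, simpleSwap_mul_self, mul_one, Perm.mul_apply,
        simpleSwap_castSucc, simpleSwap_succ]
      ring
    · rw [List.length_append, List.length_singleton] at h
      have h1 : w.length < permLength (σ * simpleSwap i) := by
        rcases lt_or_gt_simpleSwap σ i with h' | h'
        · have := permLength_mul_simpleSwap h'; omega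
        · have := permLength_mul_simpleSwap' h'; omega
      simp only
      rw [hb0 σ (by omega), hb0 _ h1, zero_mul, zero_mul, add_zero]
    · simp only [List.map_append, List.prod_append, List.map_singleton, List.prod_singleton,
        List.length_append, List.length_singleton] at h ⊢
      have hle := permLength_prod_le w
      rcases lt_or_gt_simpleSwap (w.map simpleSwap).prod i with h' | h'
      · have hl := permLength_mul_simpleSwap h'
        rw [hb0 _ (by omega), mul_assoc, simpleSwap_mul_self, mul_one, hbl (by omega),
          leadCoeff_mul_simpleSwap t h', Perm.mul_apply, Perm.mul_apply, simpleSwap_castSucc,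
          simpleSwap_succ, zero_mul, zero_add]
      · have hl := permLength_mul_simpleSwap' h'
        omega

theorem exists_heckeOp_expansion (t : k) (σ : Perm (Fin (m + 1))) :
    ∃ b : Perm (Fin (m + 1)) → RatFun k (m + 1),
      (∀ f, heckeOp t σ f = ∑ τ, b τ * permAut k τ f) ∧
      (∀ τ, permLength σ < permLength τ → b τ = 0) ∧ b σ = leadCoeff t σ := by
  obtain ⟨w, hw, hl⟩ := exists_word_length_eq σ
  obtain ⟨b, hb, hb0, hbl⟩ := exists_expansion t w
  rw [hl] at hb0
  refine ⟨b, fun f => ?_, hb0, ?_⟩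
  · rw [heckeOp_eq (isReducedWord_iff.2 ⟨hw, hl⟩), hb]
  · have := hbl (by rw [hw, hl])
    rwa [hw] at this

theorem permAut_injective {n : ℕ} {σ τ : Perm (Fin n)} (h : ∀ f, permAut k σ f = permAut k τ f) :
    σ = τ := by
  ext i
  have := h (var k i)
  rw [permAut_var, permAut_var] at this
  rw [var_injective this]

/-- Permutations are linearly independent over the field of rational functions. -/
theorem coeff_eq_of_sum_permAut_eq {n : ℕ} {b c : Perm (Fin n) → RatFun k n}
    (h : ∀ f, ∑ σ, b σ * permAut k σ f = ∑ σ, c σ * permAut k σ f) (σ : Perm (Fin n)) :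
    b σ = c σ := by
  -- Dedekind independence of distinct characters, applied to the automorphisms `permAut k σ`.
  have hli := (linearIndependent_monoidHom (RatFun k n) (RatFun k n)).comp
    (fun σ : Perm (Fin n) => (permAut k σ : RatFun k n →* RatFun k n)) (fun σ τ hστ =>
      permAut_injective fun f => congr($hστ f))
  have := Fintype.linearIndependent_iff.1 hli (fun σ => b σ - c σ) (by
    ext f
    simp only [Finset.sum_apply, Pi.smul_apply, Function.comp_apply, smul_eq_mul, Pi.zero_apply,
      sub_mul, Finset.sum_sub_distrib]
    exact sub_eq_zero.2 (h f)) σ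
  exact sub_eq_zero.1 this

/-- The set of pairs `i < j`. -/
def pairs (n : ℕ) : Finset (Fin n × Fin n) := Finset.univ.filter fun p => p.1 < p.2

theorem invSet_revPerm {n : ℕ} : invSet (Fin.revPerm : Perm (Fin n)) = pairs n := by
  ext p
  simp [invSet, pairs]

theorem permLength_lt_revPerm {n : ℕ} {σ : Perm (Fin n)} (h : σ ≠ Fin.revPerm) :
    permLength σ < permLength (Fin.revPerm : Perm (Fin n)) := by
  rw [← card_invSet, ← card_invSet, invSet_revPerm]
  refine Finset.card_lt_card ⟨fun p hp => ?_, fun hs => h ?_⟩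
  · simp only [pairs, Finset.mem_filter, Finset.mem_univ, true_and]
    exact (mem_invSet.1 hp).1
  · have hanti : StrictMono (σ ∘ Fin.rev) := fun i j hij =>
      (mem_invSet.1 (hs (show (Fin.rev j, Fin.rev i) ∈ pairs n by simpa [pairs] using hij))).2
    have := (hanti.range_inj strictMono_id).1 (by
      simp [Set.range_comp, Fin.rev_surjective.range_eq, σ.surjective.range_eq])
    ext i
    have := congr_fun this (Fin.rev i)
    simp at this
    simp [this]

theorem leadCoeff_revPerm (t : k) : leadCoeff t (Fin.revPerm : Perm (Fin (m + 1))) =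
    ∏ p ∈ pairs (m + 1), dlCoeff t p.1 p.2 := by
  rw [leadCoeff, invSet_revPerm]
  refine Finset.prod_nbij' (fun p => (Fin.rev p.2, Fin.rev p.1))
    (fun p => (Fin.rev p.2, Fin.rev p.1)) ?_ ?_ ?_ ?_ ?_ <;> simp [pairs]

/-- The product formula for the antisymmetriser. -/
theorem antisymmetrizer_eq [CharZero k] {t : k} (ht : t ≠ 0) (f : RatFun k (m + 1)) :
    antisymmetrizer m t f = const (t⁻¹ ^ (pairs (m + 1)).card) *
      (∏ p ∈ pairs (m + 1), dlCoeff t p.1 p.2) * altOp k (m + 1) f := by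
  obtain ⟨h, hh⟩ := exists_antisymmetrizer_eq_mul_altOp (m := m) ht
  suffices h = const (t⁻¹ ^ (pairs (m + 1)).card) * (∏ p ∈ pairs (m + 1), dlCoeff t p.1 p.2) by
    rw [hh, this]
  choose b hb hb0 hbl using exists_heckeOp_expansion (k := k) (m := m) t
  -- The coefficients of the longest permutation are compared: a `T_σ` with shorter `σ` contributes
  -- nothing there.
  have := coeff_eq_of_sum_permAut_eq
    (b := fun τ => ∑ σ : Perm (Fin (m + 1)), const ((-t)⁻¹ ^ permLength σ) * b σ τ)
    (c := fun τ => h * ((Perm.sign τ : ℤ) : RatFun k (m + 1))) (fun f => by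
      have h1 := antisymmetrizer_apply t f
      rw [hh, altOp_apply] at h1
      simp only [hb, Finset.mul_sum] at h1
      rw [Finset.sum_comm] at h1
      simp only [Finset.sum_mul]
      simp only [mul_assoc] at h1 ⊢
      exact h1.symm) Fin.revPerm
  rw [Finset.sum_eq_single Fin.revPerm, hbl, leadCoeff_revPerm, ← card_invSet, invSet_revPerm]
    at this
  · have hs := sign_eq_neg_one_pow_permLength (Fin.revPerm : Perm (Fin (m + 1)))
    rw [← card_invSet, invSet_revPerm] at hs
    rw [hs, inv_neg, neg_pow] at this
    have hc : (const ((-1) ^ (pairs (m + 1)).card * t⁻¹ ^ (pairs (m + 1)).card) :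
        RatFun k (m + 1)) = (-1) ^ (pairs (m + 1)).card *
          const (t⁻¹ ^ (pairs (m + 1)).card) := by simp [const]
    rw [hc] at this
    push_cast at this
    -- The sign of the longest permutation and the sign in `(-t)^{-l}` are the same power of `-1`.
    have hsq : ((-1 : RatFun k (m + 1)) ^ (pairs (m + 1)).card) *
        (-1) ^ (pairs (m + 1)).card = 1 := by rw [← mul_pow]; simp
    linear_combination (-(-1 : RatFun k (m + 1)) ^ (pairs (m + 1)).card) * this - h * hsq +
      hsq * const (t⁻¹ ^ (pairs (m + 1)).card) * (∏ p ∈ pairs (m + 1), dlCoeff t p.1 p.2)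
  · intro σ _ hσ
    rw [hb0 σ _ (permLength_lt_revPerm hσ), mul_zero]
  · simp

end ProductFormula

/-! ### The antisymmetrised Cauchy kernel -/

section Kernel

theorem prod_prod_lt {M : Type*} [CommMonoid M] {n : ℕ} (g : Fin n → Fin n → M) :
    ∏ i, ∏ j ∈ Finset.univ.filter (fun j => i < j), g i j = ∏ p ∈ pairs n, g p.1 p.2 := by
  simp only [pairs, Finset.prod_filter, ← Finset.univ_product_univ, Finset.prod_product]

theorem prod_prod_gt {M : Type*} [CommMonoid M] {n : ℕ} (g : Fin n → Fin n → M) :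
    ∏ i, ∏ j ∈ Finset.univ.filter (fun j => j < i), g i j = ∏ p ∈ pairs n, g p.2 p.1 := by
  simp only [pairs, Finset.prod_filter, ← Finset.univ_product_univ, Finset.prod_product]
  rw [Finset.prod_comm]

theorem delta_eq_prod_pairs {R : Type*} [CommRing R] {n : ℕ} (a : R) (z : Fin n → R) :
    delta a z = ∏ p ∈ pairs n, (a * z p.1 - z p.2) := prod_prod_lt _

theorem det_vandermonde_eq_prod_pairs {R : Type*} [CommRing R] {n : ℕ} (z : Fin n → R) :
    (Matrix.vandermonde z).det = ∏ p ∈ pairs n, (z p.2 - z p.1) := by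
  rw [Matrix.det_vandermonde, ← prod_prod_lt fun i j => z j - z i]
  refine Finset.prod_congr rfl fun i _ => Finset.prod_congr ?_ fun _ _ => rfl
  ext j; simp

/-- Evaluating a polynomial of degree below `n` multiplies a Vandermonde row by its column of
coefficients. This serves twice: at the variables `x_i`, and at `1 / y_i` to find the determinant of
the coefficients. -/
theorem det_eval_eq {R : Type*} [CommRing R] {n : ℕ} (z : Fin n → R) (p : Fin n → Polynomial R)
    (hp : ∀ j, (p j).natDegree < n) :
    (Matrix.of fun i j => (p j).eval (z i)).det =
      (Matrix.vandermonde z).det * (Matrix.of fun i j : Fin n => (p j).coeff i).det := by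
  rw [← Matrix.det_mul]
  congr 1
  ext i j
  simp only [Matrix.of_apply, Matrix.mul_apply, Matrix.vandermonde_apply]
  rw [Polynomial.eval_eq_sum_range' (hp j), Finset.sum_range]
  exact Finset.sum_congr rfl fun _ _ => mul_comm _ _

variable {k : Type*} [Field k] {n : ℕ}

/-- The polynomials `∏_{j < i} (1 - y_j X) ∏_{i < j} (1 - s y_j X)`. -/
noncomputable def kernelPoly (s : k) (y : Fin n → k) (i : Fin n) : Polynomial k :=
  (∏ j ∈ Finset.univ.filter (fun j => j < i), (1 - Polynomial.C (y j) * Polynomial.X)) *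
    ∏ j ∈ Finset.univ.filter (fun j => i < j), (1 - Polynomial.C (s * y j) * Polynomial.X)

theorem natDegree_kernelPoly_lt (s : k) (y : Fin n → k) (i : Fin n) :
    (kernelPoly s y i).natDegree < n := by
  have hd (a : k) : (1 - Polynomial.C a * Polynomial.X).natDegree ≤ 1 := by
    compute_degree
  have h1 := Polynomial.natDegree_prod_le (Finset.univ.filter (fun j => j < i))
    fun j => (1 - Polynomial.C (y j) * Polynomial.X)
  have h2 := Polynomial.natDegree_prod_le (Finset.univ.filter (fun j => i < j))
    fun j => (1 - Polynomial.C (s * y j) * Polynomial.X)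
  have h3 := Finset.sum_le_card_nsmul (Finset.univ.filter (fun j => j < i))
    (fun j => (1 - Polynomial.C (y j) * Polynomial.X).natDegree) 1 fun _ _ => hd _
  have h4 := Finset.sum_le_card_nsmul (Finset.univ.filter (fun j => i < j))
    (fun j => (1 - Polynomial.C (s * y j) * Polynomial.X).natDegree) 1 fun _ _ => hd _
  have h5 := Polynomial.natDegree_mul_le
    (p := ∏ j ∈ Finset.univ.filter (fun j => j < i), (1 - Polynomial.C (y j) * Polynomial.X))
    (q := ∏ j ∈ Finset.univ.filter (fun j => i < j), (1 - Polynomial.C (s * y j) * Polynomial.X))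
  have c1 : (Finset.univ.filter (fun j => j < i)).card = i := by
    rw [show Finset.univ.filter (fun j => j < i) = Finset.Iio i by ext; simp, Fin.card_Iio]
  have c2 : (Finset.univ.filter (fun j => i < j)).card = n - 1 - i := by
    rw [show Finset.univ.filter (fun j => i < j) = Finset.Ioi i by ext; simp, Fin.card_Ioi]
  rw [c1] at h3
  rw [c2] at h4
  simp only [smul_eq_mul, mul_one] at h3 h4
  have := i.2
  rw [kernelPoly]
  omega

/-- For `i < j` the polynomial `kernelPoly s y j` has the factor `1 - y_i X` and vanishes at `1 /
y_i`. The matrix of values at these points is triangular, and dividing its determinant by the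
Vandermonde determinant leaves the one of the coefficients. -/
theorem det_coeff_kernelPoly (s : k) {y : Fin n → k} (hy : ∀ i, y i ≠ 0)
    (hinj : Function.Injective y) :
    (Matrix.of fun i j : Fin n => (kernelPoly s y j).coeff i).det =
      ∏ p ∈ pairs n, -(y p.1 - s * y p.2) := by
  have h := det_eval_eq (fun i => (y i)⁻¹) (kernelPoly s y) (natDegree_kernelPoly_lt s y)
  have hpe (p : Fin n × Fin n) (hp : p ∈ pairs n) : y p.1 - y p.2 ≠ 0 := by
    simp only [pairs, Finset.mem_filter, Finset.mem_univ, true_and] at hp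
    exact sub_ne_zero.2 (hinj.ne hp.ne)
  have hV : (Matrix.vandermonde fun i => (y i)⁻¹).det ≠ 0 :=
    Matrix.det_vandermonde_ne_zero_iff.2 (inv_injective.comp hinj)
  rw [Matrix.det_of_isLowerTriangular] at h
  · refine mul_left_cancel₀ hV (h.symm.trans ?_)
    rw [det_vandermonde_eq_prod_pairs]
    simp only [Matrix.of_apply, kernelPoly, Polynomial.eval_mul, Polynomial.eval_prod,
      Polynomial.eval_sub, Polynomial.eval_one, Polynomial.eval_C, Polynomial.eval_X,
      Finset.prod_mul_distrib]
    rw [prod_prod_gt fun i j : Fin n => 1 - y j * (y i)⁻¹,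
      prod_prod_lt fun i j : Fin n => 1 - s * y j * (y i)⁻¹,
      ← Finset.prod_mul_distrib, ← Finset.prod_mul_distrib]
    refine Finset.prod_congr rfl fun p hp => ?_
    have := hy p.1
    have := hy p.2
    field_simp
    ring
  · intro i j hij
    have hij' : i < j := hij
    simp only [Matrix.of_apply, kernelPoly, Polynomial.eval_mul, Polynomial.eval_prod]
    rw [Finset.prod_eq_zero (i := i) (by simp [hij']), zero_mul]
    simp [hy i]

/-- The alternating sum of `∏ p_i(x_i)` is the Leibniz expansion of `det (p_j(x_i))`. -/
theorem altOp_prod_kernelPoly (s : k) {y : Fin n → k} (hy : ∀ i, y i ≠ 0)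
    (hinj : Function.Injective y) :
    altOp k n (∏ i, ((kernelPoly s y i).map (algebraMap k (RatFun k n))).eval (var k i)) =
      (∏ p ∈ pairs n, (var k p.1 - var k p.2)) * ∏ p ∈ pairs n, const (y p.1 - s * y p.2) := by
  have h1 : altOp k n (∏ i, ((kernelPoly s y i).map (algebraMap k (RatFun k n))).eval (var k i)) =
      (Matrix.of fun i j : Fin n =>
        ((kernelPoly s y j).map (algebraMap k (RatFun k n))).eval (var k i)).det := by
    rw [altOp_apply, Matrix.det_apply']
    refine Finset.sum_congr rfl fun σ _ => ?_
    rw [map_prod]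
    congr 1
    refine Finset.prod_congr rfl fun i _ => ?_
    rw [Matrix.of_apply, Polynomial.eval_map_algebraMap, Polynomial.eval_map_algebraMap,
      ← permAut_var, Polynomial.aeval_algHom_apply]
  rw [h1, det_eval_eq _ _ fun j => (Polynomial.natDegree_map_le).trans_lt
    (natDegree_kernelPoly_lt s y j), det_vandermonde_eq_prod_pairs]
  have h2 : (Matrix.of fun i j : Fin n =>
      ((kernelPoly s y j).map (algebraMap k (RatFun k n))).coeff i).det =
      const ((Matrix.of fun i j : Fin n => (kernelPoly s y j).coeff i).det) := by
    rw [const, RingHom.map_det]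
    congr 1
    ext i j
    simp
  rw [h2, det_coeff_kernelPoly s hy hinj, const, map_prod, ← Finset.prod_mul_distrib,
    ← Finset.prod_mul_distrib]
  refine Finset.prod_congr rfl fun p _ => ?_
  rw [map_neg, const]
  ring

theorem altOp_mul_of_symm {g : RatFun k n} (hg : ∀ σ : Perm (Fin n), permAut k σ g = g)
    (f : RatFun k n) : altOp k n (f * g) = altOp k n f * g := by
  rw [altOp_apply, altOp_apply, Finset.sum_mul]
  refine Finset.sum_congr rfl fun σ _ => ?_
  rw [map_mul, hg, mul_assoc]

theorem one_sub_mul_var_ne_zero (a : k) (i : Fin n) : 1 - const a * var k i ≠ 0 := by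
  intro h0
  have h1 : algebraMap (MvPolynomial (Fin n) k) (RatFun k n)
      (1 - MvPolynomial.C a * MvPolynomial.X i) = 0 := by
    rw [← h0, map_sub, map_mul, map_one]; rfl
  have h2 := IsFractionRing.injective (MvPolynomial (Fin n) k) (RatFun k n)
    (h1.trans (map_zero _).symm)
  have h3 := congr(MvPolynomial.eval (fun _ => 0) $h2)
  simp at h3

/-- Only distinct nonzero `y_i` are needed, so they may be elements of the coefficient field; part
a) is the case of the field `K(y)`. -/
theorem antisymmetrizer_kernel [CharZero k] {m : ℕ} {s : k} (hs : s ≠ 0) {y : Fin (m + 1) → k}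
    (hy : ∀ i, y i ≠ 0) (hinj : Function.Injective y) :
    antisymmetrizer m s ((∏ i, 1 / (1 - const s * var k i * const (y i))) *
          ∏ i, ∏ j ∈ Finset.univ.filter (fun j => j < i),
            (1 - var k i * const (y j)) / (1 - const s * var k i * const (y j))) =
      const (delta s⁻¹ y) * delta (const s) (var k) /
        ∏ i, ∏ j, (1 - const s * var k i * const (y j)) := by
  have hne (i j : Fin (m + 1)) : 1 - const s * var k i * const (y j) ≠ 0 := by
    have := one_sub_mul_var_ne_zero (s * y j) i
    rwa [const, map_mul, mul_right_comm] at this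
  set D : RatFun k (m + 1) := ∏ i, ∏ j, (1 - const s * var k i * const (y j)) with hD
  have hD0 : D ≠ 0 := Finset.prod_ne_zero_iff.2 fun i _ => Finset.prod_ne_zero_iff.2 fun j _ =>
    hne i j
  -- Over the common denominator `D` the denominators with `j ≤ i` cancel, and the factors with `j >
  -- i` remain in the numerator; together with `1 - x_i y_j` for `j < i` they form `kernelPoly`.
  have hf : (∏ i, 1 / (1 - const s * var k i * const (y i))) *
          (∏ i, ∏ j ∈ Finset.univ.filter (fun j => j < i),
            (1 - var k i * const (y j)) / (1 - const s * var k i * const (y j))) =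
      (∏ i, ((kernelPoly s y i).map (algebraMap k (RatFun k (m + 1)))).eval (var k i)) * D⁻¹ := by
    rw [← div_eq_mul_inv, hD, ← Finset.prod_mul_distrib, ← Finset.prod_div_distrib]
    refine Finset.prod_congr rfl fun i _ => ?_
    have hsplit : ∏ j, (1 - const s * var k i * const (y j)) =
        (1 - const s * var k i * const (y i)) *
          (∏ j ∈ Finset.univ.filter (fun j => j < i), (1 - const s * var k i * const (y j))) *
          ∏ j ∈ Finset.univ.filter (fun j => i < j), (1 - const s * var k i * const (y j)) := by
      rw [← Finset.prod_filter_mul_prod_filter_not Finset.univ (fun j => j < i),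
        mul_comm (1 - const s * var k i * const (y i)), mul_assoc]
      congr 1
      have hset : Finset.univ.filter (fun j => ¬j < i) =
          insert i (Finset.univ.filter fun j => i < j) := by
        ext j
        simp only [Finset.mem_filter, Finset.mem_univ, true_and, Finset.mem_insert, not_lt]
        rw [le_iff_eq_or_lt, eq_comm]
      rw [hset, Finset.prod_insert (by simp)]
    have h1 : ∏ j ∈ Finset.univ.filter (fun j => j < i), (1 - const s * var k i * const (y j)) ≠
      0 := Finset.prod_ne_zero_iff.2 fun j _ => hne i j
    have h2 : ∏ j ∈ Finset.univ.filter (fun j => i < j), (1 - const s * var k i * const (y j)) ≠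
      0 := Finset.prod_ne_zero_iff.2 fun j _ => hne i j
    have h3 := hne i i
    have he : ((kernelPoly s y i).map (algebraMap k (RatFun k (m + 1)))).eval (var k i) =
        (∏ j ∈ Finset.univ.filter (fun j => j < i), (1 - var k i * const (y j))) *
          ∏ j ∈ Finset.univ.filter (fun j => i < j), (1 - const s * var k i * const (y j)) := by
      rw [kernelPoly, Polynomial.map_mul, Polynomial.map_prod, Polynomial.map_prod,
        Polynomial.eval_mul, Polynomial.eval_prod, Polynomial.eval_prod]
      congr 1 <;> refine Finset.prod_congr rfl fun j _ => ?_
      all_goals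
        simp only [const, Polynomial.map_sub, Polynomial.map_one, Polynomial.map_mul,
          Polynomial.map_C, Polynomial.map_X, Polynomial.eval_sub, Polynomial.eval_one,
          Polynomial.eval_mul, Polynomial.eval_C, Polynomial.eval_X, map_mul]
        ring
    rw [he, hsplit, Finset.prod_div_distrib]
    field_simp
  have hsymm (σ : Perm (Fin (m + 1))) : permAut k σ D⁻¹ = D⁻¹ := by
    rw [map_inv₀, hD, map_prod]
    simp only [map_prod, map_sub, map_one, map_mul, aut_const, permAut_var]
    rw [Equiv.prod_comp σ fun i => ∏ j, (1 - const s * var k i * const (y j))]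
  have hx : ∏ p ∈ pairs (m + 1), (var k p.1 - var k p.2) ≠ 0 := by
    refine Finset.prod_ne_zero_iff.2 fun p hp => ?_
    simp only [pairs, Finset.mem_filter, Finset.mem_univ, true_and] at hp
    exact var_sub_var_ne_zero hp.ne
  have hdl : ∏ p ∈ pairs (m + 1), dlCoeff s p.1 p.2 =
      delta (const s) (var k) / ∏ p ∈ pairs (m + 1), (var k p.1 - var k p.2) := by
    rw [delta_eq_prod_pairs, ← Finset.prod_div_distrib]; rfl
  have hc : (const (s⁻¹ ^ (pairs (m + 1)).card) : RatFun k (m + 1)) *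
      ∏ p ∈ pairs (m + 1), const (y p.1 - s * y p.2) = const (delta s⁻¹ y) := by
    rw [delta_eq_prod_pairs, const, ← Finset.prod_const]
    simp only [const]
    rw [← map_prod, ← map_mul, ← Finset.prod_mul_distrib]
    congr 1
    refine Finset.prod_congr rfl fun p _ => ?_
    field_simp
  rw [hf, antisymmetrizer_eq hs, altOp_mul_of_symm hsymm, altOp_prod_kernelPoly s hy hinj, hdl,
    ← hc]
  field_simp

theorem antisymmetrizer_cauchyKernel {K : Type*} [Field K] [CharZero K] (m : ℕ) (t : Kˣ) :
    let L := RatFun K (m + 1)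
    let s : L := const (t : K)
    let y : Fin (m + 1) → L := fun i => var K i
    let x : Fin (m + 1) → RatFun L (m + 1) := fun i => var L i
    let c : L → RatFun L (m + 1) := const
    antisymmetrizer m s
        ((∏ i, 1 / (1 - c s * x i * c (y i))) *
          ∏ i, ∏ j ∈ Finset.univ.filter (fun j => j < i),
            (1 - x i * c (y j)) / (1 - c s * x i * c (y j))) =
      c (delta s⁻¹ y) * delta (c s) x / ∏ i, ∏ j, (1 - c s * x i * c (y j)) := by
  intro L s y x c
  have : CharZero L := charZero_of_injective_algebraMap
    (FaithfulSMul.algebraMap_injective K (RatFun K (m + 1)))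
  have hs : s ≠ 0 := (map_ne_zero_iff _ (FaithfulSMul.algebraMap_injective K L)).2 t.ne_zero
  exact antisymmetrizer_kernel hs (fun i => var_ne_zero i) var_injective

end Kernel

/-! ### The refined order on compositions -/

section Order

variable {m n : ℕ}

/-- The sum `∑_{i ≤ p} (ν_i + 1 - c)⁺ + ∑_{i > p} (ν_i - c)⁺`. -/
def excess {n : ℕ} (ν : Fin n → ℕ) (p c : ℕ) : ℕ :=
  ∑ i : Fin n, (ν i + (if (i : ℕ) < p then 1 else 0) - c)

/-- The order on compositions controlling the support of the non-symmetric Macdonald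
polynomials. -/
def RefLE {n : ℕ} (ν η : Fin n → ℕ) : Prop :=
  ∑ i, ν i = ∑ i, η i ∧ ∀ p c, excess ν p c ≤ excess η p c

/-- The strict version of `RefLE`. -/
def RefLT {n : ℕ} (ν η : Fin n → ℕ) : Prop := RefLE ν η ∧ ν ≠ η

theorem RefLE.refl (η : Fin n → ℕ) : RefLE η η := ⟨rfl, fun _ _ => le_rfl⟩

theorem RefLE.trans {ν η ξ : Fin n → ℕ} (h : RefLE ν η) (h' : RefLE η ξ) : RefLE ν ξ :=
  ⟨h.1.trans h'.1, fun p c => (h.2 p c).trans (h'.2 p c)⟩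

/-- The increment in `p` detects whether `c ≤ ν_p`. All excesses together therefore determine `ν`,
which gives antisymmetry of the order. -/
theorem excess_succ (ν : Fin n → ℕ) (p : Fin n) (c : ℕ) :
    excess ν (p + 1) c = excess ν p c + if c ≤ ν p then 1 else 0 := by
  rw [excess, excess, ← Finset.add_sum_erase _ _ (Finset.mem_univ p),
    ← Finset.add_sum_erase _ _ (Finset.mem_univ p)]
  have : ∑ i ∈ Finset.univ.erase p, (ν i + (if (i : ℕ) < p + 1 then 1 else 0) - c) =
      ∑ i ∈ Finset.univ.erase p, (ν i + (if (i : ℕ) < p then 1 else 0) - c) := by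
    refine Finset.sum_congr rfl fun i hi => ?_
    have : (i : ℕ) ≠ p := fun h => (Finset.mem_erase.1 hi).1 (Fin.ext h)
    have : (i : ℕ) < p + 1 ↔ (i : ℕ) < p := by omega
    simp only [this]
  rw [this]
  simp
  split_ifs <;> omega

theorem RefLE.antisymm {ν η : Fin n → ℕ} (h : RefLE ν η) (h' : RefLE η ν) : ν = η := by
  have he (p c) : excess ν p c = excess η p c := le_antisymm (h.2 p c) (h'.2 p c)
  ext p
  have h1 := excess_succ ν p (ν p)
  have h2 := excess_succ η p (ν p)
  have h3 := excess_succ ν p (η p)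
  have h4 := excess_succ η p (η p)
  simp only [he, le_refl, if_true] at h1 h2 h3 h4
  split_ifs at h2 h3 <;> omega

theorem RefLT.trans {ν η ξ : Fin n → ℕ} (h : RefLT ν η) (h' : RefLT η ξ) : RefLT ν ξ :=
  ⟨h.1.trans h'.1, by
    rintro rfl
    exact h.2 (h.1.antisymm h'.1)⟩

theorem finite_sum_eq (n M : ℕ) : Finite {ν : Fin n → ℕ // ∑ i, ν i = M} :=
  Set.Finite.subset (s := Set.Iic fun _ : Fin n => M) (t := {ν : Fin n → ℕ | ∑ i, ν i = M})
    (Set.finite_Iic _) fun ν hν i => by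
      have hν' : ∑ i, ν i = M := hν
      rw [← hν']
      exact Finset.single_le_sum (fun _ _ => Nat.zero_le _) (Finset.mem_univ i)

/-- The order compares only compositions of equal modulus, of which there are finitely many; so it
is well-founded. -/
theorem refLT_induction {P : (Fin n → ℕ) → Prop} (h : ∀ η, (∀ ν, RefLT ν η → P ν) → P η)
    (η : Fin n → ℕ) : P η := by
  have := finite_sum_eq n (∑ i, η i)
  let r : {ν : Fin n → ℕ // ∑ i, ν i = ∑ i, η i} → {ν : Fin n → ℕ // ∑ i, ν i = ∑ i, η i} → Prop :=
    fun a b => RefLT a.1 b.1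
  have : IsTrans _ r := ⟨fun _ _ _ => RefLT.trans⟩
  have : Std.Irrefl r := ⟨fun _ h => h.2 rfl⟩
  have wf : WellFounded r := Finite.wellFounded_of_trans_of_irrefl r
  exact wf.induction (C := fun a => P a.1) ⟨η, rfl⟩ fun a ih =>
    h a.1 fun ν hν => ih ⟨ν, hν.1.1.trans a.2⟩ hν

theorem excess_of_le (ν : Fin n → ℕ) {p : ℕ} (hp : n ≤ p) (c : ℕ) :
    excess ν p (c + 1) = excess ν 0 c := by
  refine Finset.sum_congr rfl fun i _ => ?_
  have : (i : ℕ) < p := i.2.trans_le hp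
  simp [this]

theorem excess_zero_right (ν : Fin n → ℕ) (p : ℕ) :
    excess ν p 0 = ∑ i, ν i + ∑ i : Fin n, if (i : ℕ) < p then 1 else 0 := by
  simp [excess, Finset.sum_add_distrib]

theorem excess_zero_comp (ν : Fin n → ℕ) (σ : Perm (Fin n)) (c : ℕ) :
    excess (fun i => ν (σ i)) 0 c = excess ν 0 c := by
  simp only [excess, not_lt_zero, if_false]
  exact Equiv.sum_comp σ fun i => ν i + 0 - c

/-! #### Rotation -/

/-- The composition `Φη = (η_2, …, η_n, η_1 + 1)`. -/
def rotate (η : Fin (m + 1) → ℕ) : Fin (m + 1) → ℕ :=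
  Fin.snoc (α := fun _ => ℕ) (fun j : Fin m => η j.succ) (η 0 + 1)

@[simp] theorem rotate_castSucc (η : Fin (m + 1) → ℕ) (j : Fin m) :
    rotate η j.castSucc = η j.succ := Fin.snoc_castSucc (α := fun _ => ℕ) ..

@[simp] theorem rotate_last (η : Fin (m + 1) → ℕ) : rotate η (Fin.last m) = η 0 + 1 :=
  Fin.snoc_last (α := fun _ => ℕ) ..

theorem sum_rotate (η : Fin (m + 1) → ℕ) : ∑ i, rotate η i = ∑ i, η i + 1 := by
  rw [Fin.sum_univ_castSucc, Fin.sum_univ_succ]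
  simp; ring

/-- Raising the first `p` entries of `Φη` and raising the first `p + 1` entries of `η` give the same
multiset. This is the purpose of the parameter `p`: rotation only shifts it. -/
theorem excess_rotate (η : Fin (m + 1) → ℕ) {p : ℕ} (hp : p ≤ m) (c : ℕ) :
    excess (rotate η) p c = excess η (p + 1) c := by
  rw [excess, excess, Fin.sum_univ_castSucc, Fin.sum_univ_succ]
  have : ¬ m < p := by omega
  simp [this]; ring

theorem rotate_injective : Function.Injective (rotate : (Fin (m + 1) → ℕ) → Fin (m + 1) → ℕ) := by
  intro a b h
  ext i
  cases i using Fin.cases with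
  | zero => simpa using congr_fun h (Fin.last m)
  | succ i => simpa using congr_fun h i.castSucc

theorem RefLE.rotate {ν η : Fin (m + 1) → ℕ} (h : RefLE ν η) :
    RefLE (rotate ν) (Macdonald.rotate η) := by
  refine ⟨by rw [sum_rotate, sum_rotate, h.1], fun p c => ?_⟩
  by_cases hp : p ≤ m
  · rw [excess_rotate _ hp, excess_rotate _ hp]; exact h.2 _ _
  -- For `p > m` all entries are raised, which is the same as `p = 0` with `c` lowered by one.
  · cases c with
    | zero => rw [excess_zero_right, excess_zero_right, sum_rotate, sum_rotate, h.1]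
    | succ c =>
      rw [excess_of_le _ (by omega), excess_of_le _ (by omega), excess_rotate _ (by omega),
        excess_rotate _ (by omega)]
      exact h.2 _ _

theorem RefLT.rotate {ν η : Fin (m + 1) → ℕ} (h : RefLT ν η) :
    RefLT (rotate ν) (Macdonald.rotate η) := ⟨h.1.rotate, rotate_injective.ne h.2⟩

/-! #### Simple transpositions -/

/-- The indices other than `i` and `i + 1`. -/
def others (i : Fin m) : Finset (Fin (m + 1)) := (Finset.univ.erase i.castSucc).erase i.succ

theorem mem_others {i : Fin m} {j : Fin (m + 1)} :
    j ∈ others i ↔ j ≠ i.castSucc ∧ j ≠ i.succ := by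
  simp [others, and_comm]

theorem prod_eq_mul_prod_others {M : Type*} [CommMonoid M] (i : Fin m) (f : Fin (m + 1) → M) :
    ∏ j, f j = f i.castSucc * f i.succ * ∏ j ∈ others i, f j := by
  rw [others, mul_assoc, Finset.mul_prod_erase _ _ (by simp [Fin.ext_iff]),
    Finset.mul_prod_erase _ _ (Finset.mem_univ _)]

theorem sum_eq_add_sum_others (i : Fin m) (f : Fin (m + 1) → ℕ) :
    ∑ j, f j = f i.castSucc + f i.succ + ∑ j ∈ others i, f j := by
  have := prod_eq_mul_prod_others i fun j => Multiplicative.ofAdd (f j)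
  exact this

/-- `μ` arises from `ν` by changing the entries `i`, `i + 1` within the interval they span. -/
def Between (i : Fin m) (ν μ : Fin (m + 1) → ℕ) : Prop :=
  (∀ j ∈ others i, μ j = ν j) ∧ μ i.castSucc + μ i.succ = ν i.castSucc + ν i.succ ∧
    min (ν i.castSucc) (ν i.succ) ≤ μ i.castSucc ∧ min (ν i.castSucc) (ν i.succ) ≤ μ i.succ

theorem Between.refl (i : Fin m) (ν : Fin (m + 1) → ℕ) : Between i ν ν :=
  ⟨fun _ _ => rfl, rfl, min_le_left _ _, min_le_right _ _⟩

theorem comp_simpleSwap_of_mem {i : Fin m} (η : Fin (m + 1) → ℕ) {j : Fin (m + 1)}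
    (hj : j ∈ others i) : η (simpleSwap i j) = η j := by
  rw [simpleSwap_of_ne (mem_others.1 hj).1 (mem_others.1 hj).2]

theorem sum_congr_others {i : Fin m} {ν μ : Fin (m + 1) → ℕ} (h : ∀ j ∈ others i, μ j = ν j)
    (g : ℕ → Fin (m + 1) → ℕ) : ∑ j ∈ others i, g (μ j) j = ∑ j ∈ others i, g (ν j) j :=
  Finset.sum_congr rfl fun j hj => by rw [h j hj]

/-- The contribution to the excess of the indices other than `i` and `i + 1`. -/
def restExcess (i : Fin m) (ν : Fin (m + 1) → ℕ) (p c : ℕ) : ℕ :=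
  ∑ j ∈ others i, (ν j + (if (j : ℕ) < p then 1 else 0) - c)

theorem excess_eq (i : Fin m) (ν : Fin (m + 1) → ℕ) (p c : ℕ) :
    excess ν p c = (ν i.castSucc + (if (i : ℕ) < p then 1 else 0) - c) +
      (ν i.succ + (if (i : ℕ) + 1 < p then 1 else 0) - c) + restExcess i ν p c :=
  sum_eq_add_sum_others i _

theorem restExcess_congr {i : Fin m} {ν μ : Fin (m + 1) → ℕ} (h : ∀ j ∈ others i, μ j = ν j)
    (p c : ℕ) : restExcess i μ p c = restExcess i ν p c :=
  Finset.sum_congr rfl fun j hj => by rw [h j hj]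

theorem restExcess_eq {i : Fin m} (ν : Fin (m + 1) → ℕ) {p p' : ℕ} (h₁ : (i : ℕ) ≤ p)
    (h₂ : p ≤ i + 2) (h₁' : (i : ℕ) ≤ p') (h₂' : p' ≤ i + 2) (c : ℕ) :
    restExcess i ν p c = restExcess i ν p' c := by
  refine Finset.sum_congr rfl fun j hj => ?_
  have h := mem_others.1 hj
  simp only [ne_eq, Fin.ext_iff, Fin.val_castSucc, Fin.val_succ] at h
  have : (j : ℕ) < p ↔ (j : ℕ) < p' := by omega
  simp only [this]

/-- If `p ≠ i + 1`, the positions `i` and `i + 1` are raised together or not at all, so the exchange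
does not affect the excess of `η`, and moving two entries of `ν` closer together lowers a sum of
convex functions. If `p = i + 1`, the bounds at `p = i` and `p = i + 2` are needed as well. -/
theorem RefLE.between {i : Fin m} {ν η μ : Fin (m + 1) → ℕ} (h : RefLE ν η)
    (hη : η i.castSucc < η i.succ) (hμ : Between i ν μ) :
    RefLE μ (fun j => η (simpleSwap i j)) := by
  obtain ⟨h1, h2, h3, h4⟩ := hμ
  have hs : ∀ j ∈ others i, η (simpleSwap i j) = η j := fun j hj => comp_simpleSwap_of_mem η hj
  refine ⟨?_, fun p c => ?_⟩
  · rw [Equiv.sum_comp (simpleSwap i) η, ← h.1, sum_eq_add_sum_others i, h2,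
      sum_congr_others h1 fun a _ => a, ← sum_eq_add_sum_others]
  · rw [excess_eq i, excess_eq i, restExcess_congr h1, restExcess_congr hs, simpleSwap_castSucc,
      simpleSwap_succ]
    have hp := h.2 p c
    rw [excess_eq i, excess_eq i] at hp
    by_cases hpi : p = i + 1
    · have e0 := h.2 i c
      have e2 := h.2 (i + 2) c
      rw [excess_eq i, excess_eq i] at e0 e2
      rw [restExcess_eq ν (p' := p) le_rfl (by omega) (by omega) (by omega),
        restExcess_eq η (p' := p) le_rfl (by omega) (by omega) (by omega)] at e0
      rw [restExcess_eq ν (p' := p) (by omega) le_rfl (by omega) (by omega),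
        restExcess_eq η (p' := p) (by omega) le_rfl (by omega) (by omega)] at e2
      subst hpi
      simp at e0 e2 hp ⊢
      omega
    · have : (i : ℕ) < p ↔ (i : ℕ) + 1 < p := by omega
      simp only [this] at hp ⊢
      split_ifs at hp ⊢ <;> omega

/-- If `μ = s_i η`, the bound at `p = i`, `c = η_{i+1}` forces the two entries of `ν` to be those of
`η` up to order, and the bound at `p = i + 1` excludes the exchanged order. -/
theorem RefLT.between_ne {i : Fin m} {ν η μ : Fin (m + 1) → ℕ} (h : RefLT ν η)
    (hη : η i.castSucc < η i.succ) (hμ : Between i ν μ) : μ ≠ fun j => η (simpleSwap i j) := by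
  rintro rfl
  obtain ⟨h1, h2, h3, h4⟩ := hμ
  simp only [simpleSwap_castSucc, simpleSwap_succ] at h2 h3 h4
  have h1' : ∀ j ∈ others i, η j = ν j := fun j hj => by
    rw [← h1 j hj]; exact (comp_simpleSwap_of_mem η hj).symm
  have e0 := h.1.2 i (η i.succ)
  have e1 := h.1.2 (i + 1) (η i.succ)
  rw [excess_eq i, excess_eq i, restExcess_congr h1'] at e0 e1
  simp at e0 e1
  refine h.2 (funext fun j => ?_)
  by_cases hj : j ∈ others i
  · exact (h1' j hj).symm
  · rw [mem_others] at hj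
    by_cases hj' : j = i.castSucc
    · rw [hj']; omega
    · have : j = i.succ := by tauto
      rw [this]; omega

theorem RefLT.between {i : Fin m} {ν η μ : Fin (m + 1) → ℕ} (h : RefLT ν η)
    (hη : η i.castSucc < η i.succ) (hμ : Between i ν μ) :
    RefLT μ (fun j => η (simpleSwap i j)) := ⟨h.1.between hη hμ, h.between_ne hη hμ⟩

/-! #### Comparison with the dominance order -/

theorem toPartition_eq_comp (η : Fin n → ℕ) :
    toPartition η = fun i => η ((Fin.revPerm.trans (Tuple.sort η)) i) := rfl

theorem antitone_toPartition (η : Fin n → ℕ) : Antitone (toPartition η) := fun _ _ h =>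
  Tuple.monotone_sort η (Fin.rev_le_rev.2 h)

theorem sum_toPartition (η : Fin n → ℕ) : ∑ i, toPartition η i = ∑ i, η i := by
  rw [toPartition_eq_comp]; exact Equiv.sum_comp _ η

theorem excess_toPartition (η : Fin n → ℕ) (c : ℕ) :
    excess (toPartition η) 0 c = excess η 0 c := excess_zero_comp η (Fin.revPerm.trans (Tuple.sort η)) c

/-- With `c = l_p`, the initial sum of `l` up to `p` equals `c` times the number of its terms plus
the excess, while for `μ` this expression is an upper bound. -/
theorem domLE_of_antitone {μ l : Fin n → ℕ} (hl : Antitone l)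
    (h : ∀ c, excess μ 0 c ≤ excess l 0 c) : DomLE μ l := by
  intro p
  have h0 := h (l p)
  simp only [excess, not_lt_zero, if_false, add_zero] at h0
  have h1 : ∑ i ∈ Finset.univ.filter (fun i => i ≤ p), μ i ≤
      ∑ i ∈ Finset.univ.filter (fun i => i ≤ p), l p + ∑ i, (μ i - l p) := by
    calc _ ≤ ∑ i ∈ Finset.univ.filter (fun i => i ≤ p), (l p + (μ i - l p)) :=
          Finset.sum_le_sum fun i _ => by omega
      _ ≤ _ := by
          rw [Finset.sum_add_distrib]
          exact Nat.add_le_add_left (Finset.sum_le_sum_of_subset (Finset.subset_univ _)) _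
  have h2 : ∑ i ∈ Finset.univ.filter (fun i => i ≤ p), l i =
      ∑ i ∈ Finset.univ.filter (fun i => i ≤ p), l p + ∑ i, (l i - l p) := by
    rw [← Finset.sum_filter_add_sum_filter_not Finset.univ (fun i => i ≤ p) fun i => l i - l p,
      ← add_assoc, ← Finset.sum_add_distrib,
      Finset.sum_eq_zero (s := Finset.univ.filter fun i => ¬i ≤ p), add_zero]
    · refine Finset.sum_congr rfl fun i hi => ?_
      have := hl (Finset.mem_filter.1 hi).2
      omega
    · intro i hi
      have := hl (not_le.1 (Finset.mem_filter.1 hi).2).le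
      omega
  omega

theorem sum_range_sub_succ {a M : ℕ} (h : a ≤ M) :
    ∑ c ∈ Finset.range M, (a + 1 - (c + 1)) = a + ∑ c ∈ Finset.range M, (a + 0 - (c + 1)) := by
  have h1 := Finset.sum_range_succ (fun c => a - c) M
  have h2 := Finset.sum_range_succ' (fun c => a - c) M
  simp only [Nat.add_sub_add_right, add_zero]
  omega

/-- Summed over `c`, raising an entry `a` by one gains exactly `a`; the excesses at `p` thus recover
the sum of the first `p` entries. -/
theorem sum_excess {M : ℕ} (ν : Fin n → ℕ) (h : ∀ i, ν i ≤ M) (p : ℕ) :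
    ∑ c ∈ Finset.range M, excess ν p (c + 1) =
      ∑ i ∈ Finset.univ.filter (fun i : Fin n => (i : ℕ) < p), ν i +
        ∑ c ∈ Finset.range M, excess ν 0 (c + 1) := by
  simp only [excess]
  rw [Finset.sum_comm, Finset.sum_comm (s := Finset.range M), Finset.sum_filter,
    ← Finset.sum_add_distrib]
  refine Finset.sum_congr rfl fun i _ => ?_
  simp only [not_lt_zero, if_false]
  split_ifs
  · exact sum_range_sub_succ (h i)
  · simp

/-- The case `p = 0` is dominance of the sorted compositions. If these agree, summing the excesses
over `c` gives dominance of the compositions themselves. -/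
theorem RefLT.prec {ν η : Fin n → ℕ} (h : RefLT ν η) : Prec ν η := by
  by_cases he : toPartition ν = toPartition η
  · refine Or.inr ⟨he, h.1.1, fun p => ?_, h.2⟩
    have hb (ξ : Fin n → ℕ) (hξ : ∑ i, ξ i = ∑ i, η i) (i) : ξ i ≤ ∑ i, η i :=
      (Finset.single_le_sum (f := ξ) (fun _ _ => Nat.zero_le _) (Finset.mem_univ i)).trans hξ.le
    have h1 := sum_excess ν (hb ν h.1.1) (p + 1)
    have h2 := sum_excess η (hb η rfl) (p + 1)
    have h3 : ∑ c ∈ Finset.range (∑ i, η i), excess ν (p + 1) (c + 1) ≤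
        ∑ c ∈ Finset.range (∑ i, η i), excess η (p + 1) (c + 1) :=
      Finset.sum_le_sum fun c _ => h.1.2 _ _
    have h4 : ∑ c ∈ Finset.range (∑ i, η i), excess ν 0 (c + 1) =
        ∑ c ∈ Finset.range (∑ i, η i), excess η 0 (c + 1) :=
      Finset.sum_congr rfl fun c _ => by rw [← excess_toPartition, he, excess_toPartition]
    have h5 : Finset.univ.filter (fun i : Fin n => (i : ℕ) < p + 1) =
        Finset.univ.filter (fun i => i ≤ p) := by
      ext i; simp only [Nat.lt_succ_iff, Fin.le_def]
    rw [h5] at h1 h2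
    rw [h1, h2, h4] at h3
    exact Nat.le_of_add_le_add_right h3
  · refine Or.inl ⟨by rw [sum_toPartition, sum_toPartition, h.1.1], ?_, he⟩
    refine domLE_of_antitone (antitone_toPartition η) fun c => ?_
    rw [excess_toPartition, excess_toPartition]
    exact h.1.2 _ _

theorem DomLE.antisymm {ν η : Fin n → ℕ} (h : DomLE ν η) (h' : DomLE η ν) : ν = η := by
  ext p
  induction hp : (p : ℕ) using Nat.strong_induction_on generalizing p with
  | _ r ih =>
  have he := le_antisymm (h p) (h' p)
  have hs (ξ : Fin n → ℕ) : ∑ i ∈ Finset.univ.filter (fun i => i ≤ p), ξ i =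
      ξ p + ∑ i ∈ Finset.univ.filter (fun i => i < p), ξ i := by
    rw [← Finset.sum_insert (by simp)]
    refine Finset.sum_congr ?_ fun _ _ => rfl
    ext j
    simp [le_iff_eq_or_lt]
  have hl : ∑ i ∈ Finset.univ.filter (fun i => i < p), ν i =
      ∑ i ∈ Finset.univ.filter (fun i => i < p), η i :=
    Finset.sum_congr rfl fun i hi => ih i (hp ▸ (Finset.mem_filter.1 hi).2) i rfl
  rw [hs, hs, hl] at he
  exact Nat.add_right_cancel he

theorem DomLT.asymm {ν η : Fin n → ℕ} (h : DomLT ν η) (h' : DomLT η ν) : False :=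
  h.2.2 (h.2.1.antisymm h'.2.1)

theorem Prec.asymm {ν η : Fin n → ℕ} (h : Prec ν η) (h' : Prec η ν) : False := by
  rcases h with h | ⟨he, h⟩ <;> rcases h' with h' | ⟨he', h'⟩
  · exact h.asymm h'
  · exact h.2.2 he'.symm
  · exact h'.2.2 he.symm
  · exact h.asymm h'

end Order

/-! ### Action of the operators on monomials -/

section Monomials

variable {k : Type*} [Field k] {m : ℕ}

theorem mono_eq (i : Fin m) (η : Fin (m + 1) → ℕ) :
    mono k η = (∏ j ∈ others i, var k j ^ η j) *
      (var k i.castSucc ^ η i.castSucc * var k i.succ ^ η i.succ) := by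
  rw [mono, prod_eq_mul_prod_others i, mul_comm]

theorem permAut_prod_others (i : Fin m) (η : Fin (m + 1) → ℕ) :
    permAut k (simpleSwap i) (∏ j ∈ others i, var k j ^ η j) = ∏ j ∈ others i, var k j ^ η j := by
  rw [map_prod]
  refine Finset.prod_congr rfl fun j hj => ?_
  rw [map_pow, permAut_var, simpleSwap_of_ne (mem_others.1 hj).1 (mem_others.1 hj).2]

theorem demazureLustig_mul_of_symm (t : k) {i : Fin m} {g : RatFun k (m + 1)}
    (hg : permAut k (simpleSwap i) g = g) (f : RatFun k (m + 1)) :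
    demazureLustig t i (g * f) = g * demazureLustig t i f := by
  rw [demazureLustig_apply, demazureLustig_apply, map_mul, hg]
  ring

/-- `x_i - x_{i+1}` divides the difference of two exchanged monomials, with a geometric sum as
quotient; so `T_i` produces only monomials with exponents between the given ones. -/
theorem dlCoeff_mul_geom (t : k) (i : Fin m) (a d : ℕ) :
    dlCoeff t i.castSucc i.succ *
        (var k i.castSucc ^ (a + d) * var k i.succ ^ a - var k i.castSucc ^ a *
          var k i.succ ^ (a + d)) =
      t • ∑ l ∈ Finset.range d, var k i.castSucc ^ (a + l + 1) * var k i.succ ^ (a + (d - 1 - l)) -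
        ∑ l ∈ Finset.range d, var k i.castSucc ^ (a + l) * var k i.succ ^ (a + (d - 1 - l) + 1) := by
  have h := var_sub_var_ne_zero (k := k) (Fin.castSucc_lt_succ (i := i)).ne
  have hg := (Commute.all (var k i.castSucc) (var k i.succ)).geom_sum₂_mul d
  set x := var k i.castSucc
  set y := var k i.succ
  have e1 : x ^ (a + d) * y ^ a - x ^ a * y ^ (a + d) =
      x ^ a * y ^ a * ((∑ l ∈ Finset.range d, x ^ l * y ^ (d - 1 - l)) * (x - y)) := by
    rw [hg]; ring
  have e2 : ∑ l ∈ Finset.range d, x ^ (a + l + 1) * y ^ (a + (d - 1 - l)) =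
      x ^ a * y ^ a * x * ∑ l ∈ Finset.range d, x ^ l * y ^ (d - 1 - l) := by
    rw [Finset.mul_sum]; exact Finset.sum_congr rfl fun _ _ => by ring
  have e3 : ∑ l ∈ Finset.range d, x ^ (a + l) * y ^ (a + (d - 1 - l) + 1) =
      x ^ a * y ^ a * y * ∑ l ∈ Finset.range d, x ^ l * y ^ (d - 1 - l) := by
    rw [Finset.mul_sum]; exact Finset.sum_congr rfl fun _ _ => by ring
  have e4 : dlCoeff t i.castSucc i.succ = (const t * x - y) / (x - y) := rfl
  rw [e1, e2, e3, e4, const_smul]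
  field_simp

/-- The monomial obtained from `η` by replacing the entries `i`, `i + 1` by `a`, `b`. -/
def setPair (i : Fin m) (η : Fin (m + 1) → ℕ) (a b : ℕ) : Fin (m + 1) → ℕ :=
  Function.update (Function.update η i.castSucc a) i.succ b

theorem setPair_castSucc (i : Fin m) (η : Fin (m + 1) → ℕ) (a b : ℕ) :
    setPair i η a b i.castSucc = a := by
  rw [setPair, Function.update_of_ne Fin.castSucc_lt_succ.ne, Function.update_self]

theorem setPair_succ (i : Fin m) (η : Fin (m + 1) → ℕ) (a b : ℕ) :
    setPair i η a b i.succ = b := Function.update_self ..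

theorem setPair_of_mem {i : Fin m} (η : Fin (m + 1) → ℕ) (a b : ℕ) {j : Fin (m + 1)}
    (hj : j ∈ others i) : setPair i η a b j = η j := by
  rw [setPair, Function.update_of_ne (mem_others.1 hj).2,
    Function.update_of_ne (mem_others.1 hj).1]

theorem mono_setPair (i : Fin m) (η : Fin (m + 1) → ℕ) (a b : ℕ) :
    mono k (setPair i η a b) = (∏ j ∈ others i, var k j ^ η j) *
      (var k i.castSucc ^ a * var k i.succ ^ b) := by
  rw [mono_eq i, setPair_castSucc, setPair_succ]
  congr 1
  exact Finset.prod_congr rfl fun j hj => by rw [setPair_of_mem η a b hj]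

theorem between_setPair {i : Fin m} {η : Fin (m + 1) → ℕ} {a b : ℕ}
    (h : a + b = η i.castSucc + η i.succ) (ha : min (η i.castSucc) (η i.succ) ≤ a)
    (hb : min (η i.castSucc) (η i.succ) ≤ b) : Between i η (setPair i η a b) :=
  ⟨fun _ hj => setPair_of_mem η a b hj, by rw [setPair_castSucc, setPair_succ, h],
    by rwa [setPair_castSucc], by rwa [setPair_succ]⟩

theorem setPair_swap (i : Fin m) (η : Fin (m + 1) → ℕ) :
    setPair i η (η i.succ) (η i.castSucc) = fun j => η (simpleSwap i j) := by
  ext j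
  by_cases hj : j ∈ others i
  · rw [setPair_of_mem _ _ _ hj, comp_simpleSwap_of_mem η hj]
  · rw [mem_others] at hj
    by_cases hj' : j = i.castSucc
    · rw [hj', setPair_castSucc, simpleSwap_castSucc]
    · have : j = i.succ := by tauto
      rw [this, setPair_succ, simpleSwap_succ]

/-- The leading term of `T_i x^η` when `η_i < η_{i+1}`. -/
theorem demazureLustig_mono_sub_mem (t : k) {i : Fin m} {η : Fin (m + 1) → ℕ}
    (h : η i.castSucc < η i.succ) :
    demazureLustig t i (mono k η) - t • mono k (fun j => η (simpleSwap i j)) ∈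
      Submodule.span k {f | ∃ μ, (Between i η μ ∧ μ ≠ fun j => η (simpleSwap i j)) ∧
        f = mono k μ} := by
  obtain ⟨d, hd⟩ := Nat.exists_eq_add_of_lt h
  have hd' : η i.succ = η i.castSucc + (d + 1) := by omega
  have hg := dlCoeff_mul_geom t i (η i.castSucc) (d + 1)
  have hmem (a b : ℕ) (hab : a + b = η i.castSucc + η i.succ) (ha : η i.castSucc ≤ a)
      (hb : η i.castSucc < b) : mono k (setPair i η a b) ∈
        Submodule.span k {f | ∃ μ, (Between i η μ ∧ μ ≠ fun j => η (simpleSwap i j)) ∧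
        f = mono k μ} := by
    refine Submodule.subset_span ⟨_, ⟨between_setPair hab (by omega) (by omega), ?_⟩, rfl⟩
    intro he
    have := congr_fun he i.succ
    rw [setPair_succ, simpleSwap_succ] at this
    omega
  -- The term `l = d` of the first geometric sum is the exchanged monomial, with coefficient `t`; it
  -- is the one subtracted.
  have key : demazureLustig t i (mono k η) - t • mono k (fun j => η (simpleSwap i j)) =
      t • mono k (setPair i η (η i.castSucc) (η i.succ)) +
      (t • ∑ l ∈ Finset.range d,
        mono k (setPair i η (η i.castSucc + l + 1) (η i.castSucc + (d + 1 - 1 - l))) -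
      ∑ l ∈ Finset.range (d + 1),
        mono k (setPair i η (η i.castSucc + l) (η i.castSucc + (d + 1 - 1 - l) + 1))) := by
    rw [← setPair_swap, mono_eq i, demazureLustig_mul_of_symm t (permAut_prod_others i η),
      demazureLustig_apply, map_mul, map_pow, map_pow, permAut_var, permAut_var,
      simpleSwap_castSucc, simpleSwap_succ]
    rw [Finset.sum_range_succ] at hg
    simp only [mono_setPair, ← Finset.mul_sum]
    rw [hd', mul_comm (var k i.succ ^ _), hg]
    simp only [const_smul]
    rw [show η i.castSucc + (d + 1 - 1 - d) = η i.castSucc by omega,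
      show η i.castSucc + (d + 1) = η i.castSucc + d + 1 by omega]
    ring
  rw [key]
  refine add_mem (Submodule.smul_mem _ _ (hmem _ _ rfl le_rfl h)) (sub_mem
    (Submodule.smul_mem _ _ (sum_mem fun l hl => ?_)) (sum_mem fun l hl => ?_))
  · rw [Finset.mem_range] at hl
    exact hmem _ _ (by omega) (by omega) (by omega)
  · rw [Finset.mem_range] at hl
    exact hmem _ _ (by omega) (by omega) (by omega)

theorem demazureLustig_mono_mem (t : k) (i : Fin m) (η : Fin (m + 1) → ℕ) :
    demazureLustig t i (mono k η) ∈
      Submodule.span k {f | ∃ μ, Between i η μ ∧ f = mono k μ} := by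
  have hmem (a b : ℕ) (hab : a + b = η i.castSucc + η i.succ)
      (ha : min (η i.castSucc) (η i.succ) ≤ a) (hb : min (η i.castSucc) (η i.succ) ≤ b) :
      mono k (setPair i η a b) ∈ Submodule.span k {f | ∃ μ, Between i η μ ∧ f = mono k μ} :=
    Submodule.subset_span ⟨_, between_setPair hab ha hb, rfl⟩
  have key : demazureLustig t i (mono k η) = t • mono k (setPair i η (η i.castSucc) (η i.succ)) +
      (∏ j ∈ others i, var k j ^ η j) * (dlCoeff t i.castSucc i.succ *
        (var k i.castSucc ^ η i.succ * var k i.succ ^ η i.castSucc -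
          var k i.castSucc ^ η i.castSucc * var k i.succ ^ η i.succ)) := by
    rw [mono_setPair, mono_eq i, demazureLustig_mul_of_symm t (permAut_prod_others i η),
      demazureLustig_apply, map_mul, map_pow, map_pow, permAut_var, permAut_var,
      simpleSwap_castSucc, simpleSwap_succ, const_smul]
    ring
  rw [key]
  refine add_mem (Submodule.smul_mem _ _ (hmem _ _ rfl (by omega) (by omega))) ?_
  have hsum (a d : ℕ) (hda : a + (a + d) = η i.castSucc + η i.succ)
      (ha : min (η i.castSucc) (η i.succ) = a) :
      (∏ j ∈ others i, var k j ^ η j) * (dlCoeff t i.castSucc i.succ *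
        (var k i.castSucc ^ (a + d) * var k i.succ ^ a - var k i.castSucc ^ a *
          var k i.succ ^ (a + d))) ∈
        Submodule.span k {f | ∃ μ, Between i η μ ∧ f = mono k μ} := by
    rw [dlCoeff_mul_geom, mul_sub, mul_smul_comm, Finset.mul_sum, Finset.mul_sum]
    simp only [← mono_setPair]
    refine sub_mem (Submodule.smul_mem _ _ (sum_mem fun l hl => ?_)) (sum_mem fun l hl => ?_)
    · rw [Finset.mem_range] at hl
      exact hmem _ _ (by omega) (by omega) (by omega)
    · rw [Finset.mem_range] at hl
      exact hmem _ _ (by omega) (by omega) (by omega)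
  rcases le_total (η i.castSucc) (η i.succ) with h | h
  · obtain ⟨d, hd⟩ := Nat.exists_eq_add_of_le h
    have := hsum (η i.castSucc) d (by omega) (by omega)
    rwa [← hd] at this
  · obtain ⟨d, hd⟩ := Nat.exists_eq_add_of_le h
    have := hsum (η i.succ) d (by omega) (by omega)
    rw [← hd] at this
    rw [← neg_mem_iff, ← mul_neg, ← mul_neg, neg_sub]
    exact this

theorem permAut_mono {n : ℕ} (σ : Perm (Fin n)) (η : Fin n → ℕ) :
    permAut k σ (mono k η) = mono k (fun i => η (σ⁻¹ i)) := by
  rw [mono, mono, map_prod, ← Equiv.prod_comp σ fun i => var k i ^ η (σ⁻¹ i)]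
  simp

theorem raising_mono (q : kˣ) (η : Fin (m + 1) → ℕ) :
    raising m q (mono k η) = (q : k) ^ η 0 • mono k (rotate η) := by
  rw [raising, Module.End.mul_apply, mulVar_apply, omegaOp_apply, mono, mono, map_prod,
    Fin.prod_univ_succ, Fin.prod_univ_castSucc]
  simp only [map_pow, omegaAut_var_zero, omegaAut_var_succ, rotate_castSucc, rotate_last]
  rw [smul_pow, smul_mul_assoc, mul_smul_comm]
  congr 1
  ring

end Monomials

/-! ### Lower spans -/

section LowerSpan

variable {k : Type*} [Field k] {m : ℕ}

/-- The span of the monomials strictly below `η`. -/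
noncomputable def lowerSpan (k : Type*) [Field k] {n : ℕ} (η : Fin n → ℕ) : Submodule k (RatFun k n) :=
  Submodule.span k {f | ∃ ν, RefLT ν η ∧ f = mono k ν}

theorem mono_mem_lowerSpan {n : ℕ} {ν η : Fin n → ℕ} (h : RefLT ν η) :
    mono k ν ∈ lowerSpan k η := Submodule.subset_span ⟨ν, h, rfl⟩

theorem map_mem_of_lowerSpan {n : ℕ} {V : Type*} [AddCommGroup V] [Module k V]
    (A : RatFun k n →ₗ[k] V) {η : Fin n → ℕ} {S : Submodule k V}
    (h : ∀ ν, RefLT ν η → A (mono k ν) ∈ S) {f : RatFun k n} (hf : f ∈ lowerSpan k η) :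
    A f ∈ S := by
  have : lowerSpan k η ≤ S.comap A := Submodule.span_le.2 (by
    rintro _ ⟨ν, hν, rfl⟩
    exact h ν hν)
  exact this hf

theorem span_between_le {i : Fin m} {ν η : Fin (m + 1) → ℕ} (h : RefLT ν η)
    (hη : η i.castSucc < η i.succ) :
    Submodule.span k {f | ∃ μ, Between i ν μ ∧ f = mono k μ} ≤
      lowerSpan k (fun j => η (simpleSwap i j)) := Submodule.span_le.2 (by
  rintro _ ⟨μ, hμ, rfl⟩
  exact mono_mem_lowerSpan (h.between hη hμ))

theorem lowerSpan_le_swap {i : Fin m} {η : Fin (m + 1) → ℕ} (hη : η i.castSucc < η i.succ) :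
    lowerSpan k η ≤ lowerSpan k (fun j => η (simpleSwap i j)) := Submodule.span_le.2 (by
  rintro _ ⟨ν, hν, rfl⟩
  exact mono_mem_lowerSpan (hν.between hη (Between.refl i ν)))

theorem refLT_swap {i : Fin m} {η : Fin (m + 1) → ℕ} (hη : η i.castSucc < η i.succ) :
    RefLT η (fun j => η (simpleSwap i j)) := by
  refine ⟨(RefLE.refl η).between hη (Between.refl i η), fun h => ?_⟩
  have := congr_fun h i.castSucc
  rw [simpleSwap_castSucc] at this
  omega

theorem raising_mem_lowerSpan (q : kˣ) {η : Fin (m + 1) → ℕ} {f : RatFun k (m + 1)}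
    (hf : f ∈ lowerSpan k η) : raising m q f ∈ lowerSpan k (rotate η) :=
  map_mem_of_lowerSpan _ (fun ν hν => by
    rw [raising_mono]
    exact Submodule.smul_mem _ _ (mono_mem_lowerSpan hν.rotate)) hf

/-- `E` is `x^η` plus lower terms and a joint eigenfunction of the Cherednik operators. -/
def IsTriangularEigen (q : kˣ) (t : k) (η : Fin (m + 1) → ℕ) (E : RatFun k (m + 1)) : Prop :=
  E - mono k η ∈ lowerSpan k η ∧ ∀ i, cherednik q t i E = eigenvalue (q : k) t η i • E

theorem IsTriangularEigen.isNonsymmetric {q : kˣ} {t : k} {η : Fin (m + 1) → ℕ}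
    {E : RatFun k (m + 1)} (h : IsTriangularEigen q t η E) : IsNonsymmetric q t η E := by
  refine ⟨Submodule.span_mono ?_ h.1, h.2⟩
  rintro _ ⟨ν, hν, rfl⟩
  exact ⟨ν, hν.prec, rfl⟩

/-! #### Behaviour of the eigenvalues -/

/-- The entry moved from the front to the end changes from the rule `≥` to the rule `>`, which its
increase by one compensates. -/
theorem legColength_rotate_castSucc (η : Fin (m + 1) → ℕ) (i : Fin m) :
    legColength (rotate η) i.castSucc = legColength η i.succ := by
  simp only [legColength, Finset.card_filter]
  rw [Fin.sum_univ_castSucc, Fin.sum_univ_castSucc, Fin.sum_univ_succ, Fin.sum_univ_succ]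
  simp only [rotate_castSucc, rotate_last, Fin.castSucc_lt_castSucc_iff, Fin.succ_lt_succ_iff,
    Fin.castSucc_lt_last, Fin.succ_pos, true_and, Fin.not_lt_zero, false_and, if_false,
    Nat.lt_succ_iff, not_lt_of_gt (Fin.castSucc_lt_last i)]
  ring

theorem legColength_rotate_last (η : Fin (m + 1) → ℕ) :
    legColength (rotate η) (Fin.last m) = legColength η 0 := by
  simp only [legColength, Finset.card_filter]
  rw [Fin.sum_univ_castSucc, Fin.sum_univ_castSucc, Fin.sum_univ_succ, Fin.sum_univ_succ]
  simp [(Fin.le_last _).not_gt]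

theorem eigenvalue_rotate_castSucc (q t : k) (η : Fin (m + 1) → ℕ) (i : Fin m) :
    eigenvalue q t (rotate η) i.castSucc = eigenvalue q t η i.succ := by
  rw [eigenvalue, eigenvalue, legColength_rotate_castSucc, rotate_castSucc]

theorem eigenvalue_rotate_last (q t : k) (η : Fin (m + 1) → ℕ) :
    eigenvalue q t (rotate η) (Fin.last m) = q * eigenvalue q t η 0 := by
  rw [eigenvalue, eigenvalue, legColength_rotate_last, rotate_last, pow_succ', mul_assoc]

theorem legColength_eq (i : Fin m) (η : Fin (m + 1) → ℕ) (a : Fin (m + 1)) :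
    legColength η a =
      (if i.castSucc < a ∧ η a ≤ η i.castSucc then 1 else 0) +
        (if i.succ < a ∧ η a ≤ η i.succ then 1 else 0) +
      ((if a < i.castSucc ∧ η a < η i.castSucc then 1 else 0) +
        (if a < i.succ ∧ η a < η i.succ then 1 else 0)) +
      ∑ l ∈ others i, ((if l < a ∧ η a ≤ η l then 1 else 0) +
        (if a < l ∧ η a < η l then 1 else 0)) := by
  rw [legColength, Finset.card_filter, Finset.card_filter, sum_eq_add_sum_others i,
    sum_eq_add_sum_others i, Finset.sum_add_distrib]
  ring

theorem lt_castSucc_iff_of_mem {i : Fin m} {l : Fin (m + 1)} (hl : l ∈ others i) :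
    (l < i.castSucc ↔ l < i.succ) ∧ (i.castSucc < l ↔ i.succ < l) := by
  have h := mem_others.1 hl
  simp only [ne_eq, Fin.ext_iff, Fin.val_castSucc, Fin.val_succ, Fin.lt_def] at h ⊢
  omega

/-- `l'_η` ranks the entries by decreasing size, ties being broken by position. Exchanging two
unequal neighbours changes no rank. -/
theorem legColength_swap {i : Fin m} {η : Fin (m + 1) → ℕ} (h : η i.castSucc < η i.succ)
    (j : Fin (m + 1)) :
    legColength (fun l => η (simpleSwap i l)) j = legColength η (simpleSwap i j) := by
  have hlt : i.castSucc < i.succ := Fin.castSucc_lt_succ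
  have hnlt : ¬ i.succ < i.castSucc := hlt.not_gt
  have hnle : ¬ η i.succ ≤ η i.castSucc := h.not_ge
  rw [legColength_eq i, legColength_eq i]
  by_cases hj : j ∈ others i
  · have hs : simpleSwap i j = j :=
      simpleSwap_of_ne (mem_others.1 hj).1 (mem_others.1 hj).2
    simp only [hs, simpleSwap_castSucc, simpleSwap_succ, (lt_castSucc_iff_of_mem hj).1,
      (lt_castSucc_iff_of_mem hj).2]
    congr 1
    · ring
    · refine Finset.sum_congr rfl fun l hl => ?_
      rw [comp_simpleSwap_of_mem η hl]
  · rw [mem_others] at hj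
    by_cases hj' : j = i.castSucc
    · subst hj'
      simp only [simpleSwap_castSucc, simpleSwap_succ, lt_self_iff_false, false_and, if_false,
        hlt, hnlt, hnle, true_and, h.not_gt]
      congr 1
      refine Finset.sum_congr rfl fun l hl => ?_
      rw [comp_simpleSwap_of_mem η hl]
      simp only [(lt_castSucc_iff_of_mem hl).1, (lt_castSucc_iff_of_mem hl).2]
    · have hj'' : j = i.succ := by tauto
      subst hj''
      simp only [simpleSwap_castSucc, simpleSwap_succ, lt_self_iff_false, false_and, if_false,
        hlt, hnlt, true_and, h, h.le, if_true]
      congr 1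
      refine Finset.sum_congr rfl fun l hl => ?_
      rw [comp_simpleSwap_of_mem η hl]
      simp only [(lt_castSucc_iff_of_mem hl).1, (lt_castSucc_iff_of_mem hl).2]

theorem eigenvalue_swap (q t : k) {i : Fin m} {η : Fin (m + 1) → ℕ}
    (h : η i.castSucc < η i.succ) (j : Fin (m + 1)) :
    eigenvalue q t (fun l => η (simpleSwap i l)) j = eigenvalue q t η (simpleSwap i j) := by
  rw [eigenvalue, eigenvalue, legColength_swap h]

theorem legColength_lt {i : Fin m} {η : Fin (m + 1) → ℕ} (h : η i.castSucc < η i.succ) :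
    legColength η i.succ < legColength η i.castSucc := by
  have hlt : i.castSucc < i.succ := Fin.castSucc_lt_succ
  rw [legColength_eq i, legColength_eq i]
  simp only [lt_self_iff_false, false_and, if_false, hlt, hlt.not_gt, h.not_ge, true_and, h,
    if_true]
  have : ∑ l ∈ others i, ((if l < i.succ ∧ η i.succ ≤ η l then 1 else 0) +
        (if i.succ < l ∧ η i.succ < η l then 1 else 0)) ≤
      ∑ l ∈ others i, ((if l < i.castSucc ∧ η i.castSucc ≤ η l then 1 else 0) +
        (if i.castSucc < l ∧ η i.castSucc < η l then 1 else 0)) := by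
    refine Finset.sum_le_sum fun l hl => ?_
    simp only [(lt_castSucc_iff_of_mem hl).1, (lt_castSucc_iff_of_mem hl).2]
    split_ifs <;> omega
  omega

end LowerSpan

/-! ### Generic parameters and eigenvalues -/

section Generic

variable {k : Type*} [Field k] {m n : ℕ}

/-- No nontrivial monomial in `q` and `t` is equal to one. -/
def Generic (q t : k) : Prop := ∀ a b : ℕ, q ^ a * t ^ b = 1 → a = 0 ∧ b = 0

/-- The indices preceding `i` in the ordering of the entries of `η`. -/
def above (η : Fin n → ℕ) (i : Fin n) : Finset (Fin n) :=
  Finset.univ.filter fun l => (l < i ∧ η i ≤ η l) ∨ (i < l ∧ η i < η l)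

theorem card_above (η : Fin n → ℕ) (i : Fin n) : (above η i).card = legColength η i := by
  rw [above, Finset.filter_or, Finset.card_union_of_disjoint, legColength]
  rw [Finset.disjoint_filter]
  rintro l - ⟨h, -⟩ ⟨h', -⟩
  exact lt_asymm h h'

theorem mem_above {η : Fin n → ℕ} {i l : Fin n} :
    l ∈ above η i ↔ (l < i ∧ η i ≤ η l) ∨ (i < l ∧ η i < η l) := by simp [above]

theorem legColength_lt_of_mem_above {η : Fin n → ℕ} {i j : Fin n} (h : j ∈ above η i) :
    legColength η j < legColength η i := by
  rw [← card_above, ← card_above]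
  refine Finset.card_lt_card ⟨fun l hl => ?_, fun hs => ?_⟩
  · rw [mem_above] at *
    rcases h with ⟨h1, h2⟩ | ⟨h1, h2⟩ <;> rcases hl with ⟨h3, h4⟩ | ⟨h3, h4⟩
    · exact Or.inl ⟨h3.trans h1, h2.trans h4⟩
    · rcases lt_trichotomy l i with h | rfl | h
      · exact Or.inl ⟨h, by omega⟩
      · omega
      · exact Or.inr ⟨h, by omega⟩
    · rcases lt_trichotomy l i with h | rfl | h
      · exact Or.inl ⟨h, by omega⟩
      · omega
      · exact Or.inr ⟨h, by omega⟩
    · exact Or.inr ⟨h1.trans h3, h2.trans h4⟩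
  · have := mem_above.1 (hs h)
    simp at this

theorem eigenvalue_eq_iff {q t : k} (hq : q ≠ 0) (ht : t ≠ 0) (hg : Generic q t)
    {η ν : Fin n → ℕ} {i : Fin n} (h : eigenvalue q t η i = eigenvalue q t ν i)
    (hlt : ν i < η i) : legColength ν i < legColength η i := by
  by_contra! hc
  rw [eigenvalue, eigenvalue, inv_pow, inv_pow, ← div_eq_mul_inv, ← div_eq_mul_inv,
    div_eq_div_iff (pow_ne_zero _ ht) (pow_ne_zero _ ht)] at h
  obtain ⟨a, ha⟩ := Nat.exists_eq_add_of_lt hlt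
  obtain ⟨b, hb⟩ := Nat.exists_eq_add_of_le hc
  have : q ^ (a + 1) * t ^ b = 1 := by
    have h0 : q ^ ν i * t ^ legColength η i ≠ 0 :=
      mul_ne_zero (pow_ne_zero _ hq) (pow_ne_zero _ ht)
    refine mul_left_cancel₀ h0 ?_
    rw [ha, hb] at h
    linear_combination h
  have := (hg _ _ this).1
  omega

/-- If `ν_i < η_i`, equality of eigenvalues forces `l'_ν(i) < l'_η(i)`. Hence some `j` precedes `i`
in the ranking of `η` but not in that of `ν`, so `ν_j < η_j` with a smaller rank: infinite descent.
-/
theorem le_of_eigenvalue_eq {q t : k} (hq : q ≠ 0) (ht : t ≠ 0) (hg : Generic q t)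
    {η ν : Fin n → ℕ} (h : eigenvalue q t η = eigenvalue q t ν) (i : Fin n) : η i ≤ ν i := by
  by_contra! hc
  induction hl : legColength η i using Nat.strong_induction_on generalizing i with
  | _ r ih =>
  have h1 := eigenvalue_eq_iff hq ht hg (congr_fun h i) hc
  rw [← card_above, ← card_above] at h1
  obtain ⟨j, hj, hj'⟩ := Finset.exists_mem_notMem_of_card_lt_card h1
  refine ih _ (hl ▸ legColength_lt_of_mem_above hj) j ?_ rfl
  rw [mem_above] at hj hj'
  rcases hj with ⟨h2, h3⟩ | ⟨h2, h3⟩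
  · have : ¬ ν i ≤ ν j := fun h => hj' (Or.inl ⟨h2, h⟩)
    omega
  · have : ¬ ν i < ν j := fun h => hj' (Or.inr ⟨h2, h⟩)
    omega

theorem eigenvalue_injective {q t : k} (hq : q ≠ 0) (ht : t ≠ 0) (hg : Generic q t) :
    Function.Injective (eigenvalue q t : (Fin n → ℕ) → Fin n → k) := fun _ _ h =>
  funext fun i => le_antisymm (le_of_eigenvalue_eq hq ht hg h i)
    (le_of_eigenvalue_eq hq ht hg h.symm i)

/-- The ratio `e_{i+1}(η) / e_i(η)`. -/
def eigenRatio (q t : k) (i : Fin m) (η : Fin (m + 1) → ℕ) : k :=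
  q ^ (η i.succ - η i.castSucc) * t ^ (legColength η i.castSucc - legColength η i.succ)

theorem eigenvalue_succ {q t : k} (ht : t ≠ 0) {i : Fin m} {η : Fin (m + 1) → ℕ}
    (h : η i.castSucc < η i.succ) :
    eigenvalue q t η i.succ = eigenRatio q t i η * eigenvalue q t η i.castSucc := by
  have h2 := legColength_lt h
  obtain ⟨a, ha⟩ := Nat.exists_eq_add_of_lt h
  obtain ⟨b, hb⟩ := Nat.exists_eq_add_of_lt h2
  rw [eigenvalue, eigenvalue, eigenRatio]
  rw [show η i.succ - η i.castSucc = a + 1 by omega,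
    show legColength η i.castSucc - legColength η i.succ = b + 1 by omega, ha, hb]
  simp only [inv_pow, pow_add]
  field_simp

theorem eigenRatio_ne_one {q t : k} (hg : Generic q t) {i : Fin m} {η : Fin (m + 1) → ℕ}
    (h : η i.castSucc < η i.succ) : eigenRatio q t i η ≠ 1 := fun he => by
  have := (hg _ _ he).1
  omega

/-- A joint eigenvector in the span of joint eigenvectors with other eigenvalues is zero. -/
theorem eq_zero_of_mem_span_eigen {V ι : Type*} [AddCommGroup V] [Module k V]
    {Y : ι → Module.End k V} {χ : ι → k} {v : V} (hv : ∀ i, Y i v = χ i • v) {S : Set V}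
    (hS : ∀ w ∈ S, ∃ χ' : ι → k, (∀ i, Y i w = χ' i • w) ∧ χ' ≠ χ)
    (hvS : v ∈ Submodule.span k S) : v = 0 := by
  classical
  obtain ⟨T, hT, hvT⟩ := Submodule.mem_span_finite_of_mem_span hvS
  replace hS : ∀ w ∈ T, ∃ χ' : ι → k, (∀ i, Y i w = χ' i • w) ∧ χ' ≠ χ := fun w hw => hS w (hT hw)
  clear hT hvS
  induction T using Finset.induction_on with
  | empty => simpa using hvT
  | insert w T _ ih =>
    refine ih ?_ fun u hu => hS u (Finset.mem_insert_of_mem hu)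
    obtain ⟨χ', hw, hne⟩ := hS w (Finset.mem_insert_self _ _)
    obtain ⟨i, hi⟩ := Function.ne_iff.1 hne
    rw [Finset.coe_insert] at hvT
    obtain ⟨a, z, hz, rfl⟩ := Submodule.mem_span_insert.1 hvT
    have hinv : ∀ u ∈ Submodule.span k (T : Set V), Y i u ∈ Submodule.span k (T : Set V) := by
      intro u hu
      have : Submodule.span k (T : Set V) ≤ (Submodule.span k (T : Set V)).comap (Y i) :=
        Submodule.span_le.2 fun u hu => by
          obtain ⟨χ'', hu', -⟩ := hS u (Finset.mem_insert_of_mem hu)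
          simp only [Submodule.comap_coe, Set.mem_preimage, hu']
          exact Submodule.smul_mem _ _ (Submodule.subset_span hu)
      exact this hu
    -- `Y_i - χ'_i` annihilates `w` and multiplies the eigenvector by a nonzero scalar, so `w` can
    -- be omitted from the spanning set.
    have h1 : (χ i - χ' i) • (a • w + z) = Y i z - χ' i • z := by
      rw [sub_smul, ← hv, map_add, map_smul, hw]
      module
    have h2 : (χ i - χ' i) • (a • w + z) ∈ Submodule.span k (T : Set V) :=
      h1 ▸ sub_mem (hinv z hz) (Submodule.smul_mem _ _ hz)
    exact (Submodule.smul_mem_iff _ (sub_ne_zero.2 hi.symm)).1 h2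

end Generic

/-! ### Existence and uniqueness of the non-symmetric Macdonald polynomials -/

section Nonsymmetric

variable {k : Type*} [Field k] {m : ℕ}

theorem isTriangularEigen_zero (q : kˣ) {t : k} (ht : t ≠ 0) :
    IsTriangularEigen q t (0 : Fin (m + 1) → ℕ) 1 := by
  refine ⟨by simp [mono], fun i => ?_⟩
  rw [cherednik_one q ht, const_smul, mul_one]
  congr 1
  have : legColength (0 : Fin (m + 1) → ℕ) i = i := by
    simp only [legColength, Pi.zero_apply, le_refl, and_true, lt_irrefl, and_false,
      Finset.filter_false, Finset.card_empty, add_zero]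
    rw [show Finset.univ.filter (fun j => j < i) = Finset.Iio i by ext; simp, Fin.card_Iio]
  simp [eigenvalue, this]

theorem IsTriangularEigen.raising {q : kˣ} {t : k} (ht : t ≠ 0) {η : Fin (m + 1) → ℕ}
    {E : RatFun k (m + 1)} (h : IsTriangularEigen q t η E) :
    IsTriangularEigen q t (rotate η) (((q : k) ^ η 0)⁻¹ • raising m q E) := by
  have hq : (q : k) ^ η 0 ≠ 0 := pow_ne_zero _ q.ne_zero
  refine ⟨?_, fun i => ?_⟩
  · have : ((q : k) ^ η 0)⁻¹ • Macdonald.raising m q E - mono k (rotate η) =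
        ((q : k) ^ η 0)⁻¹ • Macdonald.raising m q (E - mono k η) := by
      rw [map_sub, raising_mono, smul_sub, smul_smul, inv_mul_cancel₀ hq, one_smul]
    rw [this]
    exact Submodule.smul_mem _ _ (raising_mem_lowerSpan q h.1)
  · rw [map_smul, smul_comm]
    congr 1
    rw [← Module.End.mul_apply]
    cases i using Fin.lastCases with
    | last =>
      rw [cherednik_last_mul_raising q ht, LinearMap.smul_apply, Module.End.mul_apply, h.2,
        map_smul, smul_smul, eigenvalue_rotate_last]
    | cast i =>
      rw [cherednik_castSucc_mul_raising q ht, Module.End.mul_apply, h.2, map_smul,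
        eigenvalue_rotate_castSucc]

/-- `Y_i` and `Y_{i+1}` preserve the span of `E` and `T_i E`. Requiring `Y_i` to have eigenvalue
`e_{i+1}` on `T_i E + c E` gives `(t - 1) e_i + c e_i = c e_{i+1}`, that is `c (r - 1) = t - 1` with
`r = e_{i+1} / e_i`. The factor `t⁻¹` normalises the leading coefficient. -/
theorem IsTriangularEigen.swap {q : kˣ} {t : k} (ht : t ≠ 0) (hg : Generic (q : k) t) {i : Fin m}
    {η : Fin (m + 1) → ℕ} (hη : η i.castSucc < η i.succ) {E : RatFun k (m + 1)}
    (h : IsTriangularEigen q t η E) :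
    IsTriangularEigen q t (fun j => η (simpleSwap i j))
      (t⁻¹ • (demazureLustig t i E + ((t - 1) / (eigenRatio (q : k) t i η - 1)) • E)) := by
  set r := eigenRatio (q : k) t i η with hr
  have hr1 : r - 1 ≠ 0 := sub_ne_zero.2 (eigenRatio_ne_one hg hη)
  set c := (t - 1) / (r - 1) with hc
  have hcr : c * (r - 1) = t - 1 := div_mul_cancel₀ _ hr1
  have hes := eigenvalue_succ (q := (q : k)) ht hη
  rw [← hr] at hes
  refine ⟨?_, fun j => ?_⟩
  · have hE : E ∈ lowerSpan k (fun j => η (simpleSwap i j)) := by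
      rw [← sub_add_cancel E (mono k η)]
      exact add_mem (lowerSpan_le_swap hη h.1) (mono_mem_lowerSpan (refLT_swap hη))
    have h1 : demazureLustig t i (E - mono k η) ∈ lowerSpan k (fun j => η (simpleSwap i j)) :=
      map_mem_of_lowerSpan _ (fun ν hν => span_between_le hν hη (demazureLustig_mono_mem t i ν)) h.1
    have h2 : demazureLustig t i (mono k η) - t • mono k (fun j => η (simpleSwap i j)) ∈
        lowerSpan k (fun j => η (simpleSwap i j)) := by
      refine Submodule.span_mono ?_ (demazureLustig_mono_sub_mem t hη)
      rintro _ ⟨μ, ⟨hμ, hne⟩, rfl⟩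
      exact ⟨μ, ⟨(RefLE.refl η).between hη hμ, hne⟩, rfl⟩
    have h3 : t⁻¹ • (demazureLustig t i E + c • E) - mono k (fun j => η (simpleSwap i j)) =
        t⁻¹ • (demazureLustig t i (E - mono k η) + (demazureLustig t i (mono k η) -
          t • mono k (fun j => η (simpleSwap i j))) + c • E) := by
      have h4 : t⁻¹ • t • mono k (fun j => η (simpleSwap i j)) =
          mono k (fun j => η (simpleSwap i j)) := by
        rw [smul_smul, inv_mul_cancel₀ ht, one_smul]
      rw [map_sub, sub_add_sub_cancel, sub_add_eq_add_sub, smul_sub, h4]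
    rw [h3]
    exact Submodule.smul_mem _ _ (add_mem (add_mem h1 h2) (Submodule.smul_mem _ _ hE))
  · rw [eigenvalue_swap _ _ hη, map_smul, smul_comm, map_add, map_smul, h.2, smul_comm]
    congr 1
    by_cases hj : j ∈ others i
    · have hj' := mem_others.1 hj
      rw [simpleSwap_of_ne hj'.1 hj'.2, ← Module.End.mul_apply,
        ← demazureLustig_mul_cherednik q ht j i hj'.1 hj'.2, Module.End.mul_apply, h.2, map_smul,
        ← smul_add]
    · rw [mem_others] at hj
      by_cases hj' : j = i.castSucc
      · subst hj'
        rw [simpleSwap_castSucc, ← Module.End.mul_apply,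
          cherednik_castSucc_mul_demazureLustig q ht, LinearMap.add_apply, LinearMap.smul_apply,
          Module.End.mul_apply, h.2, h.2, map_smul, hes, ← hcr]
        module
      · have hj'' : j = i.succ := by tauto
        subst hj''
        have hY : cherednik q t i.succ * demazureLustig t i =
            demazureLustig t i * cherednik q t i.castSucc - (t - 1) • cherednik q t i.castSucc := by
          rw [demazureLustig_mul_cherednik_castSucc q ht, add_sub_cancel_left]
        rw [simpleSwap_succ, ← Module.End.mul_apply, hY, LinearMap.sub_apply, LinearMap.smul_apply,
          Module.End.mul_apply, h.2, map_smul, hes, ← hcr]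
        module

/-- Induction on the modulus and, for a fixed modulus, along `RefLT`: a positive last entry makes
`η` a rotation of a composition of smaller modulus, otherwise an exchange leads to a lower
composition. -/
theorem exists_isTriangularEigen {q : kˣ} {t : k} (ht : t ≠ 0) (hg : Generic (q : k) t)
    (η : Fin (m + 1) → ℕ) : ∃ E, IsTriangularEigen q t η E := by
  induction hM : ∑ i, η i using Nat.strong_induction_on generalizing η with
  | _ M ihM =>
  revert hM
  refine refLT_induction (P := fun η => ∑ i, η i = M → ∃ E, IsTriangularEigen q t η E)
    (fun η ih hM => ?_) η
  by_cases h0 : η = 0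
  · exact ⟨1, h0 ▸ isTriangularEigen_zero q ht⟩
  by_cases hl : η (Fin.last m) = 0
  -- A nonzero composition ending in `0` has a positive entry directly followed by `0`.
  · obtain ⟨i, hi1, hi2⟩ : ∃ i : Fin m, η i.succ = 0 ∧ 0 < η i.castSucc := by
      by_contra! hc
      refine h0 (funext fun j => ?_)
      induction j using Fin.reverseInduction with
      | last => exact hl
      | cast j ih => exact Nat.le_zero.1 (hc j ih)
    set ν : Fin (m + 1) → ℕ := fun j => η (simpleSwap i j) with hν
    have hlt : ν i.castSucc < ν i.succ := by
      simp only [hν, simpleSwap_castSucc, simpleSwap_succ]; omega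
    have hη : η = fun j => ν (simpleSwap i j) := by
      ext j; simp only [hν, simpleSwap_simpleSwap]
    have hR := refLT_swap hlt
    rw [← hη] at hR
    obtain ⟨E, hE⟩ := ih ν hR (hR.1.1.trans hM)
    rw [hη]
    exact ⟨_, hE.swap ht hg hlt⟩
  · set ν : Fin (m + 1) → ℕ := Fin.cons (α := fun _ => ℕ) (η (Fin.last m) - 1)
      (fun j : Fin m => η j.castSucc) with hν
    have hη : η = rotate ν := by
      ext j
      cases j using Fin.lastCases with
      | last => rw [rotate_last, hν, Fin.cons_zero]; omega
      | cast j => rw [rotate_castSucc, hν, Fin.cons_succ]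
    have hs : ∑ i, ν i + 1 = M := by rw [← hM, hη, sum_rotate]
    obtain ⟨E, hE⟩ := ihM _ (by omega) ν rfl
    rw [hη]
    exact ⟨_, hE.raising ht⟩

/-- The expansion of the eigenvectors in monomials is unitriangular, so it is inverted by induction
along the order. -/
theorem mono_mem_span_eigen {q : kˣ} {t : k} (ht : t ≠ 0) (hg : Generic (q : k) t)
    (η : Fin (m + 1) → ℕ) :
    mono k η ∈ Submodule.span k {E | ∃ μ, RefLE μ η ∧ IsTriangularEigen q t μ E} := by
  refine refLT_induction (P := fun η => mono k η ∈
    Submodule.span k {E | ∃ μ, RefLE μ η ∧ IsTriangularEigen q t μ E}) (fun η ih => ?_) η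
  obtain ⟨E, hE⟩ := exists_isTriangularEigen ht hg η
  have h1 : lowerSpan k η ≤ Submodule.span k {E | ∃ μ, RefLE μ η ∧ IsTriangularEigen q t μ E} := by
    refine Submodule.span_le.2 ?_
    rintro _ ⟨ν, hν, rfl⟩
    refine Submodule.span_mono ?_ (ih ν hν)
    rintro E ⟨μ, hμ, hE⟩
    exact ⟨μ, hμ.trans hν.1, hE⟩
  rw [← sub_sub_cancel E (mono k η)]
  exact sub_mem (Submodule.subset_span ⟨η, RefLE.refl η, hE⟩) (h1 hE.1)

/-- The difference of two solutions is a combination of `x^ν` with `ν ≺ η`, hence of eigenvectors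
with index `μ` at or below some such `ν`. The index `η` does not occur by asymmetry of `≺`, and the
other joint eigenvalues differ from that of `η`. -/
theorem IsNonsymmetric.unique {q : kˣ} {t : k} (ht : t ≠ 0) (hg : Generic (q : k) t)
    {η : Fin (m + 1) → ℕ} {E E' : RatFun k (m + 1)} (h : IsNonsymmetric q t η E)
    (h' : IsNonsymmetric q t η E') : E = E' := by
  rw [← sub_eq_zero]
  refine eq_zero_of_mem_span_eigen (k := k) (Y := cherednik q t)
    (χ := eigenvalue (q : k) t η) (S := {F | ∃ μ, μ ≠ η ∧ IsTriangularEigen q t μ F})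
    (fun i => by rw [map_sub, h.2, h'.2, smul_sub]) ?_ ?_
  · rintro F ⟨μ, hμ, hF⟩
    exact ⟨_, hF.2, (eigenvalue_injective q.ne_zero ht hg).ne hμ⟩
  · rw [← sub_sub_sub_cancel_right E E' (mono k η)]
    have hle : Submodule.span k {f | ∃ ν : Fin (m + 1) → ℕ, Prec ν η ∧ f = mono k ν} ≤
        Submodule.span k {F | ∃ μ, μ ≠ η ∧ IsTriangularEigen q t μ F} := by
      refine Submodule.span_le.2 ?_
      rintro _ ⟨ν, hν, rfl⟩
      refine Submodule.span_mono ?_ (mono_mem_span_eigen ht hg ν)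
      rintro F ⟨μ, hμ, hF⟩
      refine ⟨μ, ?_, hF⟩
      rintro rfl
      by_cases he : μ = ν
      · subst he; exact hν.asymm hν
      · exact hν.asymm (RefLT.prec ⟨hμ, he⟩)
    exact hle (sub_mem h.1 h'.1)

end Nonsymmetric

/-! ### Admissible parameters -/

section Admissible

variable {K : Type*} [Field K] [CharZero K]

/-- A polynomial without zeros in the open unit square does not vanish at admissible parameters. -/
theorem Admissible.aeval_ne_zero {q t : K} (h : Admissible q t) (P : MvPolynomial (Fin 2) ℚ)
    (hP : ∀ a b : ℝ, 0 < a → a < 1 → 0 < b → b < 1 → MvPolynomial.aeval ![a, b] P ≠ 0) :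
    MvPolynomial.aeval ![q, t] P ≠ 0 := by
  rcases h with h | ⟨φ, a, b, ha, ha', hb, hb', rfl, rfl⟩
  · intro h0
    have : P = 0 := h (h0.trans (map_zero _).symm)
    -- Any point of the open square shows that `P` is not the zero polynomial.
    refine hP (1 / 2) (1 / 2) (by norm_num) (by norm_num) (by norm_num) (by norm_num) ?_
    rw [this, map_zero]
  · have h1 : MvPolynomial.aeval ![φ a, φ b] P =
        φ.toRatAlgHom (MvPolynomial.aeval ![a, b] P) := by
      rw [← AlgHom.comp_apply, MvPolynomial.comp_aeval]
      congr 2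
      ext i
      fin_cases i <;> rfl
    rw [h1]
    exact (map_ne_zero_iff _ φ.injective).2 (hP a b ha ha' hb hb')

theorem Admissible.generic {q t : K} (h : Admissible q t) : Generic q t := by
  intro a b hab
  by_contra hc
  refine h.aeval_ne_zero (MvPolynomial.X 0 ^ a * MvPolynomial.X 1 ^ b - 1) ?_ ?_
  · intro x y hx hx' hy hy'
    simp only [map_sub, map_mul, map_pow, MvPolynomial.aeval_X, map_one, Matrix.cons_val_zero,
      Matrix.cons_val_one]
    have h1 := pow_le_one₀ hx.le hx'.le (n := a)
    have h2 := pow_le_one₀ hy.le hy'.le (n := b)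
    have h3 := pow_pos hx a
    have h4 := pow_pos hy b
    rcases Nat.eq_zero_or_pos a with ha | ha
    · have : b ≠ 0 := fun hb => hc ⟨ha, hb⟩
      have := pow_lt_one₀ hy.le hy' this
      nlinarith
    · have := pow_lt_one₀ hx.le hx' ha.ne'
      nlinarith
  · simp [hab]

/-- The half `x = y - d` of the tangent inequality, divided by `a ^ x`. The slope used there is the
forward difference `a ^ (y + 1) - a ^ y`. -/
theorem pow_mul_sub_lt {a : ℝ} (ha : 0 < a) (ha' : a < 1) (d : ℕ) :
    0 ≤ 1 - a ^ d - d * (1 - a) * a ^ d ∧ (d ≠ 0 → 0 < 1 - a ^ d - d * (1 - a) * a ^ d) := by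
  induction d with
  | zero => simp
  | succ d ih =>
    have hp := pow_pos ha d
    have h1 : 0 < (d + 1) * (1 - a) * a ^ d * (1 - a) := by
      have : 0 < 1 - a := by linarith
      positivity
    have : 0 < 1 - a ^ (d + 1) - ((d + 1 : ℕ) : ℝ) * (1 - a) * a ^ (d + 1) := by
      push_cast
      rw [pow_succ]
      nlinarith [ih.1]
    exact ⟨this.le, fun _ => this⟩

/-- The discrete tangent inequality for `x ↦ a ^ x`. -/
theorem tangent_le {a : ℝ} (ha : 0 < a) (ha' : a < 1) (x y : ℕ) :
    a ^ y - ((x : ℝ) - y) * (1 - a) * a ^ y ≤ a ^ x ∧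
      (x < y → a ^ y - ((x : ℝ) - y) * (1 - a) * a ^ y < a ^ x) := by
  rcases le_or_gt y x with h | h
  · refine ⟨?_, fun h' => absurd h' h.not_gt⟩
    obtain ⟨d, rfl⟩ := Nat.exists_eq_add_of_le h
    have h1 := one_add_mul_le_pow (a := a - 1) (by linarith) d
    rw [add_sub_cancel] at h1
    have h2 := pow_pos ha y
    rw [pow_add]
    push_cast
    nlinarith
  · obtain ⟨d, rfl⟩ := Nat.exists_eq_add_of_lt h
    have h1 := (pow_mul_sub_lt ha ha' (d + 1)).2 (by omega)
    have h2 := pow_pos ha x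
    have : a ^ (x + d + 1) - ((x : ℝ) - (x + d + 1 : ℕ)) * (1 - a) * a ^ (x + d + 1) < a ^ x := by
      rw [add_assoc, pow_add]
      push_cast at h1 ⊢
      nlinarith
    exact ⟨this.le, fun _ => this⟩

theorem sum_filter_le_succ {m : ℕ} (f : Fin (m + 1) → ℝ) (p : Fin m) :
    ∑ i ∈ Finset.univ.filter (fun i => i ≤ p.succ), f i =
      ∑ i ∈ Finset.univ.filter (fun i => i ≤ p.castSucc), f i + f p.succ := by
  have : Finset.univ.filter (fun i => i ≤ p.succ) =
      insert p.succ (Finset.univ.filter fun i => i ≤ p.castSucc) := by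
    ext i
    simp only [Finset.mem_filter, Finset.mem_univ, true_and, Finset.mem_insert, Fin.le_def,
      Fin.ext_iff, Fin.val_succ, Fin.val_castSucc]
    omega
  rw [this, Finset.sum_insert (by simp), add_comm]

/-- Abel summation, carried out as an induction on `p`. -/
theorem sum_mul_le_of_partialSums {m : ℕ} {d w : Fin (m + 1) → ℝ} (hw : Monotone w)
    (hd : ∀ p : Fin (m + 1), 0 ≤ ∑ i ∈ Finset.univ.filter (fun i => i ≤ p), d i)
    (p : Fin (m + 1)) : ∑ i ∈ Finset.univ.filter (fun i => i ≤ p), d i * w i ≤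
      w p * ∑ i ∈ Finset.univ.filter (fun i => i ≤ p), d i := by
  induction p using Fin.induction with
  | zero => simp [Finset.filter_eq', mul_comm]
  | succ p ih =>
    rw [sum_filter_le_succ, sum_filter_le_succ]
    have h1 := hw (Fin.castSucc_lt_succ (i := p)).le
    have h2 := hd p.castSucc
    nlinarith

/-- By the tangent inequality the right side is at least the left side minus `(1 - a) ∑ d_i w_i`.
The weights `w_i` increase, and the `d_i` have nonnegative partial sums and total zero, so `∑ d_i
w_i ≤ 0`. Strictness comes from an index with `κ_i < μ_i`. -/
theorem sum_pow_lt_of_domLT {m : ℕ} {κ μ : Fin (m + 1) → ℕ} (hμ : Antitone μ) (h : DomLT μ κ)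
    {a b : ℝ} (ha : 0 < a) (ha' : a < 1) (hb : 0 < b) (hb' : b < 1) :
    ∑ i : Fin (m + 1), a ^ μ i * b ^ (m - (i : ℕ)) <
      ∑ i : Fin (m + 1), a ^ κ i * b ^ (m - (i : ℕ)) := by
  set d : Fin (m + 1) → ℝ := fun i => (κ i : ℝ) - μ i with hd
  set w : Fin (m + 1) → ℝ := fun i => a ^ μ i * b ^ (m - (i : ℕ)) with hw
  have hwm : Monotone w := fun i j hij => by
    have h1 := pow_le_pow_of_le_one ha.le ha'.le (hμ hij)
    have h2 := pow_le_pow_of_le_one hb.le hb'.le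
      (show m - (j : ℕ) ≤ m - (i : ℕ) from Nat.sub_le_sub_left hij m)
    exact mul_le_mul h1 h2 (pow_pos hb _).le (pow_pos ha _).le
  have hdp (p : Fin (m + 1)) : 0 ≤ ∑ i ∈ Finset.univ.filter (fun i => i ≤ p), d i := by
    rw [hd, Finset.sum_sub_distrib, sub_nonneg]
    exact_mod_cast h.2.1 p
  have hlast : Finset.univ.filter (fun i => i ≤ Fin.last m) = Finset.univ := by
    ext i; simp [Fin.le_last]
  have hsum0 : ∑ i, d i = 0 := by
    rw [hd, Finset.sum_sub_distrib, sub_eq_zero]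
    exact_mod_cast h.1.symm
  have h1 := sum_mul_le_of_partialSums hwm hdp (Fin.last m)
  rw [hlast, hsum0, mul_zero] at h1
  obtain ⟨i, hi⟩ : ∃ i, κ i < μ i := by
    by_contra! hc
    refine h.2.2 (funext fun i => ?_)
    exact (Finset.sum_eq_sum_iff_of_le fun i _ => hc i).1 h.1 i (Finset.mem_univ i)
  have h2 : ∑ i, (w i - (1 - a) * (d i * w i)) < ∑ i : Fin (m + 1), a ^ κ i * b ^ (m - (i : ℕ)) := by
    refine Finset.sum_lt_sum (fun j _ => ?_) ⟨i, Finset.mem_univ i, ?_⟩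
    · have := (tangent_le ha ha' (κ j) (μ j)).1
      have hbp := pow_pos hb (m - (j : ℕ))
      simp only [hd, hw]
      nlinarith
    · have := (tangent_le ha ha' (κ i) (μ i)).2 hi
      have hbp := pow_pos hb (m - (i : ℕ))
      simp only [hd, hw]
      nlinarith
  rw [Finset.sum_sub_distrib, ← Finset.mul_sum] at h2
  nlinarith

theorem legColength_of_injective {n : ℕ} {η : Fin n → ℕ} (h : Function.Injective η) (i : Fin n) :
    legColength η i = (Finset.univ.filter fun l => η i < η l).card := by
  rw [← card_above]
  congr 1
  ext l
  simp only [mem_above, Finset.mem_filter, Finset.mem_univ, true_and]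
  rcases lt_trichotomy l i with hl | rfl | hl
  · have := h.ne hl.ne
    constructor
    · rintro (⟨-, h1⟩ | ⟨-, h1⟩) <;> omega
    · exact fun h1 => Or.inl ⟨hl, h1.le⟩
  · simp
  · exact ⟨by rintro (⟨h1, -⟩ | ⟨-, h1⟩) <;> [exact absurd h1 hl.not_gt; exact h1],
      fun h1 => Or.inr ⟨hl, h1⟩⟩

theorem legColength_comp {n : ℕ} {η : Fin n → ℕ} (h : Function.Injective η) (σ : Perm (Fin n))
    (i : Fin n) : legColength (fun j => η (σ j)) i = legColength η (σ i) := by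
  rw [legColength_of_injective (η := fun j => η (σ j)) (h.comp σ.injective), legColength_of_injective h,
    Finset.card_filter, Finset.card_filter,
    ← Equiv.sum_comp σ fun l => if η (σ i) < η l then 1 else 0]

theorem legColength_of_strictAnti {n : ℕ} {η : Fin n → ℕ} (h : StrictAnti η) (i : Fin n) :
    legColength η i = i := by
  rw [legColength_of_injective h.injective]
  simp only [h.lt_iff_gt]
  rw [show Finset.univ.filter (fun j => j < i) = Finset.Iio i by ext; simp, Fin.card_Iio]

theorem sum_eigenvalue_comp {k : Type*} [Field k] (q t : k) {n : ℕ} {η : Fin n → ℕ}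
    (h : Function.Injective η) (σ : Perm (Fin n)) :
    ∑ i, eigenvalue q t (fun j => η (σ j)) i = ∑ i, eigenvalue q t η i := by
  rw [← Equiv.sum_comp σ (eigenvalue q t η)]
  simp only [eigenvalue, legColength_comp h]

/-- Multiplication by `t ^ m` makes both sums polynomials in `q` and `t`; their difference has no
zero in the open unit square. -/
theorem Admissible.sum_eigenvalue_ne {q t : K} (hqt : Admissible q t) (ht : t ≠ 0) {m : ℕ}
    {κ μ : Fin (m + 1) → ℕ} (hκ : StrictAnti κ) (hμ : StrictAnti μ) (h : DomLT μ κ) :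
    ∑ i, eigenvalue q t μ i ≠ ∑ i, eigenvalue q t κ i := by
  intro he
  have hs {ν : Fin (m + 1) → ℕ} (hν : StrictAnti ν) : t ^ m * ∑ i, eigenvalue q t ν i =
      ∑ i : Fin (m + 1), q ^ ν i * t ^ (m - (i : ℕ)) := by
    rw [Finset.mul_sum]
    refine Finset.sum_congr rfl fun i _ => ?_
    rw [eigenvalue, legColength_of_strictAnti hν]
    have : t ^ m = t ^ (m - (i : ℕ)) * t ^ (i : ℕ) := by
      rw [← pow_add, Nat.sub_add_cancel (Nat.lt_succ_iff.1 i.2)]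
    rw [this, inv_pow]
    field_simp
  refine hqt.aeval_ne_zero (∑ i : Fin (m + 1), MvPolynomial.X 0 ^ κ i *
    MvPolynomial.X 1 ^ (m - (i : ℕ)) - ∑ i : Fin (m + 1), MvPolynomial.X 0 ^ μ i *
    MvPolynomial.X 1 ^ (m - (i : ℕ))) ?_ ?_
  · intro a b ha ha' hb hb'
    simp only [map_sub, map_sum, map_mul, map_pow, MvPolynomial.aeval_X, Matrix.cons_val_zero,
      Matrix.cons_val_one]
    exact (sub_pos.2 (sum_pow_lt_of_domLT hμ.antitone h ha ha' hb hb')).ne'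
  · simp only [map_sub, map_sum, map_mul, map_pow, MvPolynomial.aeval_X, Matrix.cons_val_zero,
      Matrix.cons_val_one]
    rw [← hs hκ, ← hs hμ, he, sub_self]

end Admissible

/-! ### The antisymmetric Macdonald polynomials -/

section Antisymmetric

variable {k : Type*} [Field k] {m n : ℕ}

theorem DomLE.trans {ν η ξ : Fin n → ℕ} (h : DomLE ν η) (h' : DomLE η ξ) : DomLE ν ξ :=
  fun p => (h p).trans (h' p)

theorem DomLT.trans {ν η ξ : Fin n → ℕ} (h : DomLT ν η) (h' : DomLT η ξ) : DomLT ν ξ :=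
  ⟨h.1.trans h'.1, h.2.1.trans h'.2.1, by
    rintro rfl
    exact h.asymm h'⟩

theorem domLT_induction {P : (Fin n → ℕ) → Prop} (h : ∀ η, (∀ ν, DomLT ν η → P ν) → P η)
    (η : Fin n → ℕ) : P η := by
  have := finite_sum_eq n (∑ i, η i)
  let r : {ν : Fin n → ℕ // ∑ i, ν i = ∑ i, η i} → {ν : Fin n → ℕ // ∑ i, ν i = ∑ i, η i} → Prop :=
    fun a b => DomLT a.1 b.1
  have : IsTrans _ r := ⟨fun _ _ _ => DomLT.trans⟩
  have : Std.Irrefl r := ⟨fun _ h => h.2.2 rfl⟩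
  have wf : WellFounded r := Finite.wellFounded_of_trans_of_irrefl r
  exact wf.induction (C := fun a => P a.1) ⟨η, rfl⟩ fun a ih =>
    h a.1 fun ν hν => ih ⟨ν, hν.1.trans a.2⟩ hν

theorem toPartition_eq_of_antitone {κ ν : Fin n → ℕ} (hκ : Antitone κ)
    (h : ∀ c, excess ν 0 c = excess κ 0 c) : toPartition ν = κ := by
  refine DomLE.antisymm (domLE_of_antitone hκ fun c => ?_)
    (domLE_of_antitone (antitone_toPartition ν) fun c => ?_)
  · rw [excess_toPartition, h]
  · rw [excess_toPartition, h]

theorem toPartition_comp {κ : Fin n → ℕ} (hκ : Antitone κ) (σ : Perm (Fin n)) :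
    toPartition (fun i => κ (σ i)) = κ :=
  toPartition_eq_of_antitone hκ fun c => excess_zero_comp κ σ c

/-- The argument of `domLE_of_antitone`, applied to the sums over the tail. -/
theorem domLE_of_monotone {ν η : Fin n → ℕ} (hη : Monotone η) (hs : ∑ i, ν i = ∑ i, η i)
    (h : ∀ c, excess ν 0 c ≤ excess η 0 c) : DomLE η ν := by
  intro p
  have h0 := h (η p)
  simp only [excess, not_lt_zero, if_false, add_zero] at h0
  have h1 : ∑ i ∈ Finset.univ.filter (fun i => ¬i ≤ p), ν i ≤
      ∑ i ∈ Finset.univ.filter (fun i => ¬i ≤ p), η p + ∑ i, (ν i - η p) := by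
    calc _ ≤ ∑ i ∈ Finset.univ.filter (fun i => ¬i ≤ p), (η p + (ν i - η p)) :=
          Finset.sum_le_sum fun i _ => by omega
      _ ≤ _ := by
          rw [Finset.sum_add_distrib]
          exact Nat.add_le_add_left (Finset.sum_le_sum_of_subset (Finset.subset_univ _)) _
  have h2 : ∑ i ∈ Finset.univ.filter (fun i => ¬i ≤ p), η i =
      ∑ i ∈ Finset.univ.filter (fun i => ¬i ≤ p), η p + ∑ i, (η i - η p) := by
    rw [← Finset.sum_filter_add_sum_filter_not Finset.univ (fun i => i ≤ p) fun i => η i - η p,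
      Finset.sum_eq_zero (s := Finset.univ.filter fun i => i ≤ p), zero_add,
      ← Finset.sum_add_distrib]
    · refine Finset.sum_congr rfl fun i hi => ?_
      have := hη (not_le.1 (Finset.mem_filter.1 hi).2).le
      omega
    · intro i hi
      have := hη (Finset.mem_filter.1 hi).2
      omega
  have h3 := Finset.sum_filter_add_sum_filter_not Finset.univ (fun i => i ≤ p) ν
  have h4 := Finset.sum_filter_add_sum_filter_not Finset.univ (fun i => i ≤ p) η
  omega

theorem antisymmetrizer_mono_comp [CharZero k] {t : k} (ht : t ≠ 0) (η : Fin (m + 1) → ℕ)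
    (σ : Perm (Fin (m + 1))) :
    antisymmetrizer m t (mono k fun i => η (σ i)) =
      (Perm.sign σ : ℤ) • antisymmetrizer m t (mono k η) := by
  have := antisymmetrizer_permAut ht σ⁻¹ (mono k η)
  rwa [permAut_mono, inv_inv, Perm.sign_inv] at this

/-- Transposing two equal exponents fixes the monomial but changes the sign of its image under `U⁻`.
-/
theorem antisymmetrizer_mono_of_not_injective [CharZero k] {t : k} (ht : t ≠ 0)
    {η : Fin (m + 1) → ℕ} (h : ¬Function.Injective η) :
    antisymmetrizer m t (mono k η) = 0 := by
  have : CharZero (RatFun k (m + 1)) := charZero_of_injective_algebraMap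
    (FaithfulSMul.algebraMap_injective k (RatFun k (m + 1)))
  simp only [Function.Injective, not_forall] at h
  obtain ⟨i, j, he, hne⟩ := h
  have h1 := antisymmetrizer_mono_comp ht η (swap i j)
  have h2 : (fun l => η (swap i j l)) = η := by
    ext l
    rw [swap_apply_def]
    split_ifs with h h'
    · rw [h, he]
    · rw [h', he]
    · rfl
  rw [h2, Perm.sign_swap hne] at h1
  simp only [Units.val_neg, Units.val_one, neg_smul, one_smul] at h1
  exact self_eq_neg.1 h1

/-- The span of the antisymmetric monomials strictly below `κ`. -/
noncomputable def antisymSpan (t : k) (κ : Fin (m + 1) → ℕ) : Submodule k (RatFun k (m + 1)) :=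
  Submodule.span k {f | ∃ μ : Fin (m + 1) → ℕ, StrictAnti μ ∧ DomLT μ κ ∧ f = antisymMono t μ}

theorem zsmul_sign_mem {S : Submodule k (RatFun k n)} (z : ℤ) {f : RatFun k n} (hf : f ∈ S) :
    z • f ∈ S := by
  rw [zsmul_eq_mul, show (z : RatFun k n) * f = (z : k) • f by
    rw [const_smul, const, map_intCast]]
  exact S.smul_mem _ hf

theorem antisymmetrizer_mono_mem [CharZero k] {t : k} (ht : t ≠ 0) {ν κ : Fin (m + 1) → ℕ}
    (h : DomLT (toPartition ν) κ) : antisymmetrizer m t (mono k ν) ∈ antisymSpan t κ := by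
  by_cases hi : Function.Injective ν
  · have h1 := antisymmetrizer_mono_comp (k := k) ht (toPartition ν)
      (Fin.revPerm.trans (Tuple.sort ν))⁻¹
    have h2 : (fun i => toPartition ν ((Fin.revPerm.trans (Tuple.sort ν))⁻¹ i)) = ν := by
      ext i
      rw [toPartition_eq_comp]
      exact congrArg ν (Equiv.apply_symm_apply _ i)
    rw [h2] at h1
    rw [h1]
    refine zsmul_sign_mem _ (Submodule.subset_span ⟨_, ?_, h, rfl⟩)
    refine (antitone_toPartition ν).strictAnti_of_injective ?_
    rw [toPartition_eq_comp]
    exact hi.comp (Equiv.injective _)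
  · rw [antisymmetrizer_mono_of_not_injective ht hi]
    exact zero_mem _

theorem antisymmetrizer_comm_sum_cherednik (q : kˣ) {t : k} (ht : t ≠ 0) :
    antisymmetrizer m t * ∑ j, cherednik q t j = (∑ j, cherednik q t j) * antisymmetrizer m t := by
  have h (w : List (Fin m)) : (w.map (demazureLustig t)).prod * ∑ j, cherednik q t j =
      (∑ j, cherednik q t j) * (w.map (demazureLustig t)).prod := by
    induction w with
    | nil => simp
    | cons i w ih =>
      rw [List.map_cons, List.prod_cons, mul_assoc, ih, ← mul_assoc,
        demazureLustig_mul_sum_cherednik q ht, mul_assoc]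
  rw [antisymmetrizer, Finset.sum_mul, Finset.mul_sum]
  refine Finset.sum_congr rfl fun σ _ => ?_
  rw [smul_mul_assoc, heckeOp, h, mul_smul_comm]

theorem sum_cherednik_antisymmetrizer {q : kˣ} {t : k} (ht : t ≠ 0) {η : Fin (m + 1) → ℕ}
    {E : RatFun k (m + 1)} (h : ∀ i, cherednik q t i E = eigenvalue (q : k) t η i • E) :
    (∑ i, cherednik q t i) (antisymmetrizer m t E) =
      (∑ i, eigenvalue (q : k) t η i) • antisymmetrizer m t E := by
  rw [← Module.End.mul_apply, ← antisymmetrizer_comm_sum_cherednik q ht, Module.End.mul_apply,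
    LinearMap.sum_apply, Finset.sum_congr rfl fun i _ => h i, ← Finset.sum_smul, map_smul]

/-- The antisymmetrisation of `E_η` for increasing `η` is an antisymmetric Macdonald
polynomial. -/
theorem IsTriangularEigen.isAntisymmetric [CharZero k] {q : kˣ} {t : k} (ht : t ≠ 0)
    {κ : Fin (m + 1) → ℕ} (hκ : StrictAnti κ) {E : RatFun k (m + 1)}
    (hE : IsTriangularEigen q t (fun i => κ (Fin.revPerm i)) E) :
    IsAntisymmetric q t κ ((Perm.sign (Fin.revPerm : Perm (Fin (m + 1))) : ℤ) •
      antisymmetrizer m t E) := by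
  refine ⟨?_, ?_⟩
  · have h1 : antisymmetrizer m t (E - mono k fun i => κ (Fin.revPerm i)) ∈ antisymSpan t κ := by
      refine map_mem_of_lowerSpan _ (fun ν hν => antisymmetrizer_mono_mem ht ?_) hE.1
      rcases hν.prec with h | ⟨h, h'⟩
      · rwa [toPartition_comp hκ.antitone] at h
      -- No other rearrangement of `κ` occurs below the increasing one, which is the smallest in
      -- dominance order.
      · have h2 : DomLE (fun i => κ (Fin.revPerm i)) ν := by
          refine domLE_of_monotone (fun i j hij => hκ.antitone (Fin.rev_le_rev.2 hij)) hν.1.1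
            fun c => hν.1.2 0 c
        exact absurd (h'.2.1.antisymm h2) h'.2.2
    rw [map_sub, antisymmetrizer_mono_comp ht] at h1
    have h3 := zsmul_sign_mem (Perm.sign (Fin.revPerm : Perm (Fin (m + 1))) : ℤ) h1
    have h4 : ((Perm.sign (Fin.revPerm : Perm (Fin (m + 1))) : ℤ)) *
        (Perm.sign (Fin.revPerm : Perm (Fin (m + 1))) : ℤ) = 1 := by
      rcases Int.units_eq_one_or (Perm.sign (Fin.revPerm : Perm (Fin (m + 1)))) with h | h <;>
        simp [h]
    rw [zsmul_eq_mul, mul_sub, zsmul_eq_mul, ← mul_assoc, ← Int.cast_mul, h4, Int.cast_one, one_mul,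
      ← zsmul_eq_mul] at h3
    exact h3
  · rw [map_zsmul, sum_cherednik_antisymmetrizer ht hE.2,
      sum_eigenvalue_comp _ _ hκ.injective Fin.revPerm, smul_comm]

theorem exists_isAntisymmetric [CharZero k] {q : kˣ} {t : k} (ht : t ≠ 0)
    (hg : Generic (q : k) t) {κ : Fin (m + 1) → ℕ} (hκ : StrictAnti κ) :
    ∃ S, IsAntisymmetric q t κ S := by
  obtain ⟨E, hE⟩ := exists_isTriangularEigen ht hg fun i => κ (Fin.revPerm i)
  exact ⟨_, hE.isAntisymmetric ht hκ⟩

theorem antisymMono_mem_span [CharZero k] {q : kˣ} {t : k} (ht : t ≠ 0) (hg : Generic (q : k) t)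
    {κ : Fin (m + 1) → ℕ} (hκ : StrictAnti κ) :
    antisymMono t κ ∈ Submodule.span k {S | ∃ μ : Fin (m + 1) → ℕ,
      StrictAnti μ ∧ (μ = κ ∨ DomLT μ κ) ∧ IsAntisymmetric q t μ S} := by
  revert hκ
  refine domLT_induction (P := fun κ => StrictAnti κ → antisymMono t κ ∈
    Submodule.span k {S | ∃ μ : Fin (m + 1) → ℕ,
      StrictAnti μ ∧ (μ = κ ∨ DomLT μ κ) ∧ IsAntisymmetric q t μ S}) (fun κ ih hκ => ?_) κ
  obtain ⟨S, hS⟩ := exists_isAntisymmetric ht hg hκ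
  rw [← sub_sub_cancel S (antisymMono t κ)]
  refine sub_mem (Submodule.subset_span ⟨κ, hκ, Or.inl rfl, hS⟩) ?_
  have hle : antisymSpan t κ ≤ Submodule.span k {S | ∃ μ : Fin (m + 1) → ℕ,
      StrictAnti μ ∧ (μ = κ ∨ DomLT μ κ) ∧ IsAntisymmetric q t μ S} := by
    refine Submodule.span_le.2 ?_
    rintro _ ⟨ν, hν, hlt, rfl⟩
    refine Submodule.span_mono ?_ (ih ν hlt hν)
    rintro S ⟨μ, hμ, hle, hS⟩
    refine ⟨μ, hμ, Or.inr ?_, hS⟩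
    rcases hle with rfl | h
    · exact hlt
    · exact h.trans hlt
  exact hle hS.1

/-- Only the single operator `∑ Y_i` is available, so the sums of eigenvalues of the partitions
below `κ` must differ from that of `κ`; here admissibility is used beyond genericity. -/
theorem IsAntisymmetric.unique [CharZero k] {q : kˣ} {t : k} (ht : t ≠ 0)
    (hqt : Admissible (q : k) t) {κ : Fin (m + 1) → ℕ} (hκ : StrictAnti κ)
    {S S' : RatFun k (m + 1)} (h : IsAntisymmetric q t κ S) (h' : IsAntisymmetric q t κ S') :
    S = S' := by
  rw [← sub_eq_zero]
  refine eq_zero_of_mem_span_eigen (k := k) (Y := fun _ : Unit => ∑ i, cherednik q t i)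
    (χ := fun _ => ∑ i, eigenvalue (q : k) t κ i)
    (S := {S | ∃ μ : Fin (m + 1) → ℕ, StrictAnti μ ∧ DomLT μ κ ∧ IsAntisymmetric q t μ S})
    (fun _ => by rw [map_sub, h.2, h'.2, smul_sub]) ?_ ?_
  · rintro F ⟨μ, hμ, hlt, hF⟩
    exact ⟨fun _ => ∑ i, eigenvalue (q : k) t μ i, fun _ => hF.2, fun he =>
      hqt.sum_eigenvalue_ne ht hκ hμ hlt (congr_fun he ())⟩
  · rw [← sub_sub_sub_cancel_right S S' (antisymMono t κ)]
    have hle : antisymSpan t κ ≤ Submodule.span k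
        {S | ∃ μ : Fin (m + 1) → ℕ, StrictAnti μ ∧ DomLT μ κ ∧ IsAntisymmetric q t μ S} := by
      refine Submodule.span_le.2 ?_
      rintro _ ⟨ν, hν, hlt, rfl⟩
      refine Submodule.span_mono ?_ (antisymMono_mem_span ht hqt.generic hν)
      rintro F ⟨μ, hμ, hle, hF⟩
      refine ⟨μ, hμ, ?_, hF⟩
      rcases hle with rfl | h
      · exact hlt
      · exact h.trans hlt
    exact hle (sub_mem h.1 h'.1)

/-! #### Nonvanishing -/

/-- The polynomials without the monomial `x^κ`. -/
noncomputable def coeffKer (k : Type*) [Field k] {n : ℕ} (κ : Fin n → ℕ) :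
    Submodule k (RatFun k n) :=
  (LinearMap.ker (MvPolynomial.lcoeff k (Finsupp.equivFunOnFinite.symm κ))).map
    (Algebra.linearMap (MvPolynomial (Fin n) k) (RatFun k n) |>.restrictScalars k)

theorem mono_eq_algebraMap (η : Fin n → ℕ) : mono k η = algebraMap (MvPolynomial (Fin n) k)
    (RatFun k n) (MvPolynomial.monomial (Finsupp.equivFunOnFinite.symm η) 1) := by
  rw [MvPolynomial.monomial_eq, map_mul, map_one, map_one, one_mul, Finsupp.prod_fintype, map_prod]
  · simp [mono, var]
  · simp

theorem mono_mem_coeffKer {κ η : Fin n → ℕ} (h : η ≠ κ) : mono k η ∈ coeffKer k κ := by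
  refine ⟨MvPolynomial.monomial (Finsupp.equivFunOnFinite.symm η) 1, ?_, (mono_eq_algebraMap η).symm⟩
  simp [MvPolynomial.coeff_monomial, h]

theorem mono_notMem_coeffKer (κ : Fin n → ℕ) : mono k κ ∉ coeffKer k κ := by
  rintro ⟨p, hp, he⟩
  have : p = MvPolynomial.monomial (Finsupp.equivFunOnFinite.symm κ) 1 :=
    IsFractionRing.injective (MvPolynomial (Fin n) k) (RatFun k n)
      (he.trans (mono_eq_algebraMap κ))
  rw [this] at hp
  simp at hp

theorem altOp_mono (η : Fin n → ℕ) : altOp k n (mono k η) =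
    ∑ σ : Perm (Fin n), (Perm.sign σ : ℤ) • mono k fun i => η (σ⁻¹ i) := by
  simp only [altOp_apply, permAut_mono, zsmul_eq_mul]

theorem altOp_mono_mem_coeffKer {κ μ : Fin n → ℕ} (hκ : StrictAnti κ) (hμ : StrictAnti μ)
    (h : μ ≠ κ) : altOp k n (mono k μ) ∈ coeffKer k κ := by
  rw [altOp_mono]
  refine sum_mem fun σ _ => zsmul_sign_mem _ (mono_mem_coeffKer fun he => h ?_)
  rw [← toPartition_comp hμ.antitone σ⁻¹, he]
  exact toPartition_comp hκ.antitone 1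

theorem altOp_mono_notMem_coeffKer {κ : Fin n → ℕ} (hκ : StrictAnti κ) :
    altOp k n (mono k κ) ∉ coeffKer k κ := by
  intro h
  refine mono_notMem_coeffKer (k := k) κ ?_
  rw [altOp_mono, ← Finset.add_sum_erase _ _ (Finset.mem_univ 1), Perm.sign_one, inv_one] at h
  have h2 := (Submodule.add_mem_iff_left _ (sum_mem fun σ hσ => ?_)).1 h
  · simpa using h2
  · refine zsmul_sign_mem _ (mono_mem_coeffKer fun he => (Finset.mem_erase.1 hσ).1 ?_)
    ext i
    have := hκ.injective (congr_fun he (σ i))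
    exact congrArg Fin.val (this.symm.trans (Equiv.symm_apply_apply _ i))

theorem antisymmetrizer_factor_ne_zero {t : k} (ht : t ≠ 0) :
    (const (t⁻¹ ^ (pairs (m + 1)).card) : RatFun k (m + 1)) *
      (∏ p ∈ pairs (m + 1), dlCoeff t p.1 p.2) ≠ 0 := by
  refine mul_ne_zero ?_ (Finset.prod_ne_zero_iff.2 fun p hp => ?_)
  · exact (map_ne_zero_iff _ (FaithfulSMul.algebraMap_injective k (RatFun k (m + 1)))).2
      (pow_ne_zero _ (inv_ne_zero ht))
  · simp only [pairs, Finset.mem_filter, Finset.mem_univ, true_and] at hp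
    exact div_ne_zero (const_mul_var_sub_ne_zero hp.ne t) (var_sub_var_ne_zero hp.ne)

/-- Divided by the prefactor `g` of `U⁻`, the leading term becomes the alternating sum of `x^κ`,
which contains `x^κ` with coefficient one; the alternating sums for other strict partitions do not
contain `x^κ`. -/
theorem IsAntisymmetric.ne_zero [CharZero k] {q : kˣ} {t : k} (ht : t ≠ 0)
    {κ : Fin (m + 1) → ℕ} (hκ : StrictAnti κ) {S : RatFun k (m + 1)}
    (h : IsAntisymmetric q t κ S) : S ≠ 0 := by
  rintro rfl
  have h1 := h.1
  rw [zero_sub, neg_mem_iff] at h1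
  set g := (const (t⁻¹ ^ (pairs (m + 1)).card) : RatFun k (m + 1)) *
      (∏ p ∈ pairs (m + 1), dlCoeff t p.1 p.2) with hg
  have hg0 : g ≠ 0 := antisymmetrizer_factor_ne_zero ht
  have h2 : antisymSpan t κ ≤ (coeffKer k κ).comap (LinearMap.mulLeft k g⁻¹) := by
    refine Submodule.span_le.2 ?_
    rintro _ ⟨μ, hμ, hlt, rfl⟩
    simp only [Submodule.comap_coe, Set.mem_preimage, LinearMap.mulLeft_apply, SetLike.mem_coe,
      antisymMono]
    rw [antisymmetrizer_eq ht, ← hg, inv_mul_cancel_left₀ hg0]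
    exact altOp_mono_mem_coeffKer hκ hμ hlt.2.2
  have h3 := h2 h1
  simp only [Submodule.mem_comap, LinearMap.mulLeft_apply, antisymMono] at h3
  rw [antisymmetrizer_eq ht, ← hg, inv_mul_cancel_left₀ hg0] at h3
  exact altOp_mono_notMem_coeffKer hκ h3

end Antisymmetric

/-! ### The constants `d_η`, `d'_η` and `h_η` -/

section Constants

variable {k : Type*} [Field k] {m n : ℕ}

theorem Generic.one_sub_ne_zero {q t : k} (hg : Generic q t) {a b : ℕ} (h : a ≠ 0 ∨ b ≠ 0) :
    1 - q ^ a * t ^ b ≠ 0 := fun he => by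
  have := hg a b (sub_eq_zero.1 he).symm
  tauto

theorem dConst_ne_zero {q t : k} (hg : Generic q t) (η : Fin n → ℕ) : dConst η q t ≠ 0 :=
  Finset.prod_ne_zero_iff.2 fun _ _ => Finset.prod_ne_zero_iff.2 fun _ _ =>
    hg.one_sub_ne_zero (Or.inl (Nat.succ_ne_zero _))

theorem dConst'_ne_zero {q t : k} (hg : Generic q t) (η : Fin n → ℕ) : dConst' η q t ≠ 0 :=
  Finset.prod_ne_zero_iff.2 fun _ _ => Finset.prod_ne_zero_iff.2 fun _ _ =>
    hg.one_sub_ne_zero (Or.inl (Nat.succ_ne_zero _))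

theorem dConst'_mul_ne_zero {q t : k} (hg : Generic q t) (η : Fin n → ℕ) :
    dConst' η q (q * t) ≠ 0 :=
  Finset.prod_ne_zero_iff.2 fun _ _ => Finset.prod_ne_zero_iff.2 fun _ _ => by
    rw [mul_pow, ← mul_assoc, ← pow_add]
    exact hg.one_sub_ne_zero (Or.inl (by omega))

theorem hConst_mul_ne_zero {q t : k} (hg : Generic q t) (η : Fin n → ℕ) :
    hConst η q (q * t) ≠ 0 :=
  Finset.prod_ne_zero_iff.2 fun _ _ => Finset.prod_ne_zero_iff.2 fun _ _ => by
    rw [mul_pow, ← mul_assoc, ← pow_add]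
    exact hg.one_sub_ne_zero (Or.inr (by omega))

/-! #### Exchanging two adjacent parts -/

theorem legLength_eq_sum (η : Fin n → ℕ) (i : Fin n) (j : ℕ) : legLength η i j =
    ∑ l, ((if i < l ∧ j ≤ η l ∧ η l ≤ η i then 1 else 0) +
      if l < i ∧ j ≤ η l + 1 ∧ η l + 1 ≤ η i then 1 else 0) := by
  rw [legLength, Finset.card_filter, Finset.card_filter, Finset.sum_add_distrib]

theorem legColength_eq_sum (η : Fin n → ℕ) (i : Fin n) : legColength η i =
    ∑ l, ((if l < i ∧ η i ≤ η l then 1 else 0) + if i < l ∧ η i < η l then 1 else 0) := by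
  rw [legColength, Finset.card_filter, Finset.card_filter, Finset.sum_add_distrib]

theorem legLength_comp_eq_sum (η : Fin n → ℕ) (σ : Perm (Fin n)) (i : Fin n) (j : ℕ) :
    legLength (fun l => η (σ l)) (σ⁻¹ i) j =
    ∑ l, ((if σ⁻¹ i < σ⁻¹ l ∧ j ≤ η l ∧ η l ≤ η i then 1 else 0) +
      if σ⁻¹ l < σ⁻¹ i ∧ j ≤ η l + 1 ∧ η l + 1 ≤ η i then 1 else 0) := by
  rw [legLength_eq_sum, ← Equiv.sum_comp σ⁻¹]
  simp only [← Perm.mul_apply, mul_inv_cancel, Perm.one_apply]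

variable {i : Fin m} {η : Fin (m + 1) → ℕ}

theorem mem_others_iff_val {l : Fin (m + 1)} : l ∈ others i ↔ (l : ℕ) ≠ i ∧ (l : ℕ) ≠ i + 1 := by
  rw [mem_others, Ne, Ne, Fin.ext_iff, Fin.ext_iff, Fin.val_castSucc, Fin.val_succ]

theorem simpleSwap_inv (i : Fin m) : (simpleSwap i)⁻¹ = simpleSwap i := swap_inv _ _

theorem simpleSwap_apply_of_mem {l : Fin (m + 1)} (h : l ∈ others i) : simpleSwap i l = l :=
  swap_apply_of_ne_of_ne (mem_others.1 h).1 (mem_others.1 h).2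

theorem legLength_comp_simpleSwap (i : Fin m) (η : Fin (m + 1) → ℕ) (l : Fin (m + 1)) (j : ℕ) :
    legLength (fun l => η (simpleSwap i l)) (simpleSwap i l) j =
    ∑ r, ((if simpleSwap i l < simpleSwap i r ∧ j ≤ η r ∧ η r ≤ η l then 1 else 0) +
      if simpleSwap i r < simpleSwap i l ∧ j ≤ η r + 1 ∧ η r + 1 ≤ η l then 1 else 0) := by
  have := legLength_comp_eq_sum η (simpleSwap i) l j
  rwa [simpleSwap_inv] at this

theorem legLength_swap_of_mem {l : Fin (m + 1)} (hl : l ∈ others i) (j : ℕ) :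
    legLength (fun l => η (simpleSwap i l)) (simpleSwap i l) j = legLength η l j := by
  rw [legLength_comp_simpleSwap, legLength_eq_sum]
  refine Finset.sum_congr rfl fun r _ => ?_
  have h1 : simpleSwap i l < simpleSwap i r ↔ l < r := by
    rw [simpleSwap_apply_of_mem hl]
    rw [mem_others_iff_val] at hl
    by_cases hr : r ∈ others i
    · rw [simpleSwap_apply_of_mem hr]
    · rw [mem_others] at hr
      by_cases h : r = i.castSucc
      · subst h
        rw [simpleSwap_castSucc, Fin.lt_def, Fin.lt_def, Fin.val_castSucc, Fin.val_succ]; omega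
      · obtain rfl : r = i.succ := by tauto
        rw [simpleSwap_succ, Fin.lt_def, Fin.lt_def, Fin.val_castSucc, Fin.val_succ]; omega
  have h2 : simpleSwap i r < simpleSwap i l ↔ r < l := by
    rw [simpleSwap_apply_of_mem hl]
    rw [mem_others_iff_val] at hl
    by_cases hr : r ∈ others i
    · rw [simpleSwap_apply_of_mem hr]
    · rw [mem_others] at hr
      by_cases h : r = i.castSucc
      · subst h
        rw [simpleSwap_castSucc, Fin.lt_def, Fin.lt_def, Fin.val_castSucc, Fin.val_succ]; omega
      · obtain rfl : r = i.succ := by tauto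
        rw [simpleSwap_succ, Fin.lt_def, Fin.lt_def, Fin.val_castSucc, Fin.val_succ]; omega
  simp only [h1, h2]

theorem castSucc_lt_iff_of_mem {l : Fin (m + 1)} (hl : l ∈ others i) :
    i.castSucc < l ↔ i.succ < l := by
  rw [mem_others_iff_val] at hl
  rw [Fin.lt_def, Fin.lt_def, Fin.val_castSucc, Fin.val_succ]
  omega

theorem lt_castSucc_iff_lt_succ_of_mem {l : Fin (m + 1)} (hl : l ∈ others i) :
    l < i.castSucc ↔ l < i.succ := by
  rw [mem_others_iff_val] at hl
  rw [Fin.lt_def, Fin.lt_def, Fin.val_castSucc, Fin.val_succ]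
  omega

theorem legLength_swap_castSucc (h : η i.castSucc < η i.succ) (j : ℕ) :
    legLength (fun l => η (simpleSwap i l)) (simpleSwap i i.castSucc) j =
      legLength η i.castSucc j := by
  have hlt := i.castSucc_lt_succ
  rw [legLength_comp_simpleSwap, legLength_eq_sum, sum_eq_add_sum_others i,
    sum_eq_add_sum_others i, simpleSwap_castSucc, simpleSwap_succ]
  refine congrArg₂ _ ?_ (Finset.sum_congr rfl fun r hr => ?_)
  · simp [hlt, hlt.not_gt, h.not_ge, (Nat.lt_succ_of_lt h).not_ge]
  · simp only [simpleSwap_apply_of_mem hr, castSucc_lt_iff_of_mem hr,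
      lt_castSucc_iff_lt_succ_of_mem hr]

/-- A row of length `η_i` above the longer row counts in the columns `j ≤ η_i + 1`, below it only
for `j ≤ η_i`. The leg changes in the one column `η_i + 1`. -/
theorem legLength_swap_succ (h : η i.castSucc < η i.succ) (j : ℕ) :
    legLength (fun l => η (simpleSwap i l)) (simpleSwap i i.succ) j +
      (if j = η i.castSucc + 1 then 1 else 0) = legLength η i.succ j := by
  have hlt := i.castSucc_lt_succ
  rw [legLength_comp_simpleSwap, legLength_eq_sum, sum_eq_add_sum_others i,
    sum_eq_add_sum_others i, simpleSwap_castSucc, simpleSwap_succ, add_right_comm]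
  refine congrArg₂ _ ?_ (Finset.sum_congr rfl fun r hr => ?_)
  · simp only [hlt, hlt.not_gt, lt_irrefl, false_and, true_and, if_false]
    split_ifs <;> omega
  · simp only [simpleSwap_apply_of_mem hr, castSucc_lt_iff_of_mem hr,
      lt_castSucc_iff_lt_succ_of_mem hr]

/-- The leg of this node counts the entries ranked after `η_{i+1}` up to and including `η_i`. -/
theorem legLength_succ_add (h : η i.castSucc < η i.succ) :
    legLength η i.succ (η i.castSucc + 1) + legColength η i.succ = legColength η i.castSucc := by
  have hlt := i.castSucc_lt_succ
  rw [legLength_eq_sum, legColength_eq_sum, legColength_eq_sum, ← Finset.sum_add_distrib,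
    sum_eq_add_sum_others i, sum_eq_add_sum_others i]
  refine congrArg₂ _ ?_ (Finset.sum_congr rfl fun r hr => ?_)
  · simp only [hlt, hlt.not_gt, lt_irrefl, false_and, true_and, if_false]
    split_ifs <;> omega
  · simp only [castSucc_lt_iff_of_mem hr, lt_castSucc_iff_lt_succ_of_mem hr]
    by_cases h1 : i.succ < r
    · simp only [h1, h1.not_gt, false_and, true_and, if_false]
      split_ifs <;> omega
    · by_cases h2 : r < i.succ
      · simp only [h1, h2, false_and, true_and, if_false]
        split_ifs <;> omega
      · simp [h1, h2]

/-- All factors agree except that of the node in row `i + 1` and column `η_i + 1`, whose leg drops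
by one under the exchange; its exponents are those of `e_{i+1} / e_i`. -/
theorem dConst'_swap (q t : k) (h : η i.castSucc < η i.succ) :
    dConst' (fun l => η (simpleSwap i l)) q t *
        (1 - q ^ (η i.succ - η i.castSucc) * t ^ (legColength η i.castSucc - legColength η i.succ)) =
      dConst' η q t * (1 - q ^ (η i.succ - η i.castSucc) *
        t ^ (legColength η i.castSucc - legColength η i.succ - 1)) := by
  have hleg := legLength_succ_add h
  rw [dConst', ← Equiv.prod_comp (simpleSwap i), dConst', prod_eq_mul_prod_others i,
    prod_eq_mul_prod_others i (fun l => ∏ j ∈ Finset.Icc 1 (η l), _)]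
  have h1 (l : Fin (m + 1)) : η (simpleSwap i (simpleSwap i l)) = η l := by
    rw [simpleSwap_simpleSwap]
  simp only [h1, legLength_swap_castSucc h]
  rw [Finset.prod_congr rfl fun l hl => Finset.prod_congr rfl fun j _ => by
    rw [legLength_swap_of_mem hl]]
  have hmem : η i.castSucc + 1 ∈ Finset.Icc 1 (η i.succ) := Finset.mem_Icc.2 ⟨by omega, by omega⟩
  rw [← Finset.mul_prod_erase _ _ hmem, ← Finset.mul_prod_erase (Finset.Icc 1 (η i.succ)) _ hmem]
  have h2 := legLength_swap_succ h (η i.castSucc + 1)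
  rw [if_pos rfl] at h2
  rw [show η i.succ - (η i.castSucc + 1) + 1 = η i.succ - η i.castSucc by omega,
    show legColength η i.castSucc - legColength η i.succ = legLength η i.succ (η i.castSucc + 1) by
      omega, show legLength η i.succ (η i.castSucc + 1) - 1 =
      legLength (fun l => η (simpleSwap i l)) (simpleSwap i i.succ) (η i.castSucc + 1) by omega]
  have h3 : ∀ j ∈ (Finset.Icc 1 (η i.succ)).erase (η i.castSucc + 1),
      legLength (fun l => η (simpleSwap i l)) (simpleSwap i i.succ) j = legLength η i.succ j := by
    intro j hj
    have := legLength_swap_succ h j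
    rwa [if_neg (Finset.mem_erase.1 hj).1, add_zero] at this
  rw [Finset.prod_congr rfl fun j hj => congrArg
    (fun e => 1 - q ^ (η i.succ - j + 1) * t ^ e) (h3 j hj)]
  ring

/-! #### Increasing compositions with distinct parts -/

section Columns

variable (B : Finset ℕ)

theorem card_filter_lt_add_card_filter_le (j : ℕ) :
    (B.filter (· < j)).card + (B.filter (j ≤ ·)).card = B.card := by
  rw [← Finset.card_filter_add_card_filter_not (s := B) (· < j)]
  simp only [not_lt]

theorem card_filter_lt_le (j : ℕ) : (B.filter (· < j)).card ≤ j := by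
  refine (Finset.card_le_card (t := Finset.range j) fun b hb => ?_).trans_eq (Finset.card_range j)
  exact Finset.mem_range.2 (Finset.mem_filter.1 hb).2

/-- `j - #{b ∈ B | b < j}` counts the non-elements of `B` below `j`, hence is nondecreasing. -/
theorem card_filter_lt_add_le {i j : ℕ} (h : i ≤ j) :
    (B.filter (· < j)).card + i ≤ (B.filter (· < i)).card + j := by
  have h1 : (B.filter (· < j)).card ≤ (B.filter (· < i)).card + (Finset.Ico i j).card := by
    refine (Finset.card_le_card fun b hb => ?_).trans (Finset.card_union_le _ _)
    rw [Finset.mem_filter] at hb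
    rw [Finset.mem_union, Finset.mem_filter, Finset.mem_Ico]
    by_cases hbi : b < i
    · exact Or.inl ⟨hb.1, hbi⟩
    · exact Or.inr ⟨not_lt.1 hbi, hb.2⟩
  rw [Nat.card_Ico] at h1
  omega

theorem card_filter_lt_succ_of_notMem {j : ℕ} (h : j ∉ B) :
    B.filter (· < j + 1) = B.filter (· < j) := by
  refine Finset.filter_congr fun b hb => ?_
  have : b ≠ j := fun he => h (he ▸ hb)
  omega

theorem card_filter_succ_le_of_notMem {j : ℕ} (h : j ∉ B) :
    B.filter (j + 1 ≤ ·) = B.filter (j ≤ ·) := by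
  refine Finset.filter_congr fun b hb => ?_
  have : b ≠ j := fun he => h (he ▸ hb)
  omega

theorem card_filter_succ_le_of_mem {j : ℕ} (h : j ∈ B) :
    (B.filter (j + 1 ≤ ·)).card + 1 = (B.filter (j ≤ ·)).card := by
  rw [← Finset.card_insert_of_notMem (a := j) (by simp)]
  congr 1
  ext b
  simp only [Finset.mem_insert, Finset.mem_filter]
  constructor
  · rintro (rfl | h')
    · exact ⟨h, le_rfl⟩
    · exact ⟨h'.1, by omega⟩
  · rintro ⟨h1, h2⟩
    rcases h2.eq_or_lt with rfl | h2
    · exact Or.inl rfl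
    · exact Or.inr ⟨h1, h2⟩

/-- The leg length in the column `s` of the diagram obtained by removing the columns in `B`. -/
def reducedLeg (s : ℕ) : ℕ := (B.filter fun b => s + (B.filter (· < b)).card ≤ b).card

variable {B}

/-- Deleting the columns in `B` sends the column `j` (counted from zero) to `j + 1 - #{b < j}` and a
part `b` to `b - #{b' < b}`. The comparison of the two amounts to `j ≤ b` because `j ∉ B`. -/
theorem reducedLeg_eq {j : ℕ} (h : j ∉ B) :
    reducedLeg B (j + 1 - (B.filter (· < j)).card) = (B.filter (j ≤ ·)).card := by
  rw [reducedLeg]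
  congr 1
  refine Finset.filter_congr fun b hb => ?_
  have hne : b ≠ j := fun he => h (he ▸ hb)
  have h1 := card_filter_lt_le B j
  rcases lt_or_ge b j with hbj | hbj
  · have h2 := card_filter_lt_add_le B (Nat.succ_le_of_lt hbj)
    have h3 : (B.filter (· < b + 1)).card = (B.filter (· < b)).card + 1 := by
      have e1 := card_filter_succ_le_of_mem B hb
      have e2 := card_filter_lt_add_card_filter_le B b
      have e3 := card_filter_lt_add_card_filter_le B (b + 1)
      omega
    simp only [Nat.succ_eq_add_one] at h2
    omega
  · have h2 := card_filter_lt_add_le B (i := j + 1) (j := b) (by omega)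
    rw [card_filter_lt_succ_of_notMem B h] at h2
    omega

/-- The columns outside `B` correspond bijectively to the columns `s` of the reduced row. Arm plus
one plus leg at `s` equals `a - j`, which is why the reduced diagram is taken with `t` replaced by
`q t`. -/
theorem prod_columns {a : ℕ} (hB : B ⊆ Finset.range a) (F : ℕ → ℕ → k) :
    ∏ s ∈ Finset.Icc 1 (a - B.card), F (a - B.card - s + 1 + reducedLeg B s) (reducedLeg B s) =
      ∏ j ∈ Finset.range a \ B, F (a - j) (B.filter (j ≤ ·)).card := by
  have hBa : B.filter (· < a) = B :=
    Finset.filter_true_of_mem fun b hb => Finset.mem_range.1 (hB hb)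
  have hinj : Set.InjOn (fun j => j + 1 - (B.filter (· < j)).card)
      (Finset.range a \ B : Finset ℕ) := by
    have hmono {i j : ℕ} (hi : i ∉ B) (hij : i < j) :
        i + 1 - (B.filter (· < i)).card < j + 1 - (B.filter (· < j)).card := by
      have h1 := card_filter_lt_add_le B (Nat.succ_le_of_lt hij)
      rw [Nat.succ_eq_add_one, card_filter_lt_succ_of_notMem B hi] at h1
      have h2 := card_filter_lt_le B i
      have h3 := card_filter_lt_le B j
      omega
    intro i hi j hj he
    have hi := (Finset.mem_sdiff.1 (Finset.mem_coe.1 hi)).2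
    have hj := (Finset.mem_sdiff.1 (Finset.mem_coe.1 hj)).2
    rcases lt_trichotomy i j with h | h | h
    · exact absurd he (hmono hi h).ne
    · exact h
    · exact absurd he (hmono hj h).ne'
  have himage : (Finset.range a \ B).image (fun j => j + 1 - (B.filter (· < j)).card) =
      Finset.Icc 1 (a - B.card) := by
    refine Finset.eq_of_subset_of_card_le (fun s hs => ?_) ?_
    · obtain ⟨j, hj, rfl⟩ := Finset.mem_image.1 hs
      obtain ⟨hja, hj⟩ := Finset.mem_sdiff.1 hj
      rw [Finset.mem_range] at hja
      have h1 := card_filter_lt_le B j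
      have h2 := card_filter_lt_add_le B (Nat.succ_le_of_lt hja)
      rw [Nat.succ_eq_add_one, card_filter_lt_succ_of_notMem B hj, hBa] at h2
      rw [Finset.mem_Icc]
      omega
    · rw [Finset.card_image_of_injOn hinj, Finset.card_sdiff_of_subset hB, Finset.card_range,
        Nat.card_Icc]
      omega
  rw [← himage, Finset.prod_image hinj]
  refine Finset.prod_congr rfl fun j hj => ?_
  obtain ⟨hja, hj⟩ := Finset.mem_sdiff.1 hj
  rw [Finset.mem_range] at hja
  rw [reducedLeg_eq hj]
  have h1 := card_filter_lt_le B j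
  have h2 := card_filter_lt_add_le B (Nat.succ_le_of_lt hja)
  rw [Nat.succ_eq_add_one, card_filter_lt_succ_of_notMem B hj, hBa] at h2
  have h3 := card_filter_lt_add_card_filter_le B j
  congr 1
  omega

/-- For `j ∈ B` the factors of the two full rows coincide, since passing from `j` to `j + 1` loses
exactly the part `j`. The columns outside `B` are handled by `prod_columns`. -/
theorem prod_columns_identity {a : ℕ} (hB : B ⊆ Finset.range a) (F : ℕ → ℕ → k) :
    (∏ j ∈ Finset.range a, F (a - j) (B.filter (j ≤ ·)).card) *
        ∏ s ∈ Finset.Icc 1 (a - B.card),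
          F (a - B.card - s + 1 + reducedLeg B s) (reducedLeg B s + 1) =
      (∏ j ∈ Finset.range a, F (a - j) ((B.filter (j + 1 ≤ ·)).card + 1)) *
        ∏ s ∈ Finset.Icc 1 (a - B.card),
          F (a - B.card - s + 1 + reducedLeg B s) (reducedLeg B s) := by
  rw [prod_columns hB, prod_columns hB fun x y => F x (y + 1), ← Finset.prod_sdiff hB,
    ← Finset.prod_sdiff (f := fun j => F (a - j) ((B.filter (j + 1 ≤ ·)).card + 1)) hB,
    Finset.prod_congr (s₁ := B) rfl fun j hj =>
      congrArg (F (a - j)) (card_filter_succ_le_of_mem B hj),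
    Finset.prod_congr (s₁ := Finset.range a \ B) rfl fun j hj =>
      congrArg (fun b : Finset ℕ => F (a - j) (b.card + 1))
        (card_filter_succ_le_of_notMem B (Finset.mem_sdiff.1 hj).2)]
  ring

end Columns

/-! ### Legs of `κ`, of its reversal and of `κ - δ` in terms of the parts below a row -/

theorem card_image_filter {κ : Fin n → ℕ} (hκ : StrictAnti κ) (i : Fin n) (p : ℕ → Prop)
    [DecidablePred p] : (((Finset.Ioi i).image κ).filter p).card =
      (Finset.univ.filter fun l => i < l ∧ p (κ l)).card := by
  rw [Finset.filter_image, Finset.card_image_of_injective _ hκ.injective]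
  congr 1
  ext l
  simp

theorem legLength_of_strictAnti {κ : Fin n → ℕ} (hκ : StrictAnti κ) (i : Fin n) (j : ℕ) :
    legLength κ i j = (((Finset.Ioi i).image κ).filter (j ≤ ·)).card := by
  rw [card_image_filter hκ, legLength]
  refine Eq.trans (congrArg₂ (· + ·) ?_ (Finset.card_eq_zero.2
    (Finset.filter_eq_empty_iff.2 ?_))) (add_zero _)
  · congr 1
    ext l
    simp only [Finset.mem_filter, Finset.mem_univ, true_and]
    exact ⟨fun h => ⟨h.1, h.2.1⟩, fun h => ⟨h.1, h.2, (hκ h.1).le⟩⟩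
  · rintro l - ⟨h1, -, h2⟩
    have := hκ h1
    omega

/-- After reversal the shorter rows lie above, where a row `k` counts with `η_k + 1`; hence the
shift of the column by one. -/
theorem legLength_comp_rev {κ : Fin n → ℕ} (hκ : StrictAnti κ) (i : Fin n) (j : ℕ) :
    legLength (fun l => κ (Fin.revPerm l)) (Fin.revPerm i) (j + 1) =
      (((Finset.Ioi i).image κ).filter (j ≤ ·)).card := by
  have h := legLength_comp_eq_sum κ Fin.revPerm i (j + 1)
  rw [card_image_filter hκ, Finset.card_filter]
  refine h.trans (Finset.sum_congr rfl fun l _ => ?_)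
  have h1 (r : Fin n) : (Fin.revPerm⁻¹ : Perm (Fin n)) r = Fin.rev r := rfl
  simp only [h1, Fin.rev_lt_rev]
  rcases lt_trichotomy i l with h | rfl | h
  · have := hκ h
    simp only [h, h.not_gt, true_and, false_and, if_false]
    split_ifs <;> omega
  · simp
  · have := hκ h
    simp only [h, h.not_gt, true_and, false_and, if_false]
    split_ifs <;> omega

/-- `m - l` is the number of parts below row `l`, so `κ - δ` is the reduction of `κ`. It is weakly
decreasing, and rows above never contribute to its legs. -/
theorem legLength_sub {κ : Fin (m + 1) → ℕ} (hκ : StrictAnti κ) (i : Fin (m + 1)) {s : ℕ}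
    (hs : 1 ≤ s) : legLength (fun l => κ l - (m - (l : ℕ))) i s =
      reducedLeg ((Finset.Ioi i).image κ) s := by
  have hcard {l : Fin (m + 1)} (hl : i < l) :
      (((Finset.Ioi i).image κ).filter (· < κ l)).card = m - (l : ℕ) := by
    rw [card_image_filter hκ, show Finset.univ.filter (fun r => i < r ∧ κ r < κ l) = Finset.Ioi l by
      ext r
      simp only [Finset.mem_filter, Finset.mem_univ, true_and, Finset.mem_Ioi, hκ.lt_iff_gt]
      exact ⟨fun h => h.2, fun h => ⟨hl.trans h, h⟩⟩, Fin.card_Ioi]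
    omega
  have hanti {l r : Fin (m + 1)} (h : l < r) :
      κ r - (m - (r : ℕ)) ≤ κ l - (m - (l : ℕ)) := by
    have h1 := card_filter_lt_add_le ((Finset.Ioi l).image κ) (hκ h).le
    have h2 : (((Finset.Ioi l).image κ).filter (· < κ r)).card = m - (r : ℕ) := by
      rw [card_image_filter hκ,
        show Finset.univ.filter (fun x => l < x ∧ κ x < κ r) = Finset.Ioi r by
          ext x
          simp only [Finset.mem_filter, Finset.mem_univ, true_and, Finset.mem_Ioi, hκ.lt_iff_gt]
          exact ⟨fun h' => h'.2, fun h' => ⟨h.trans h', h'⟩⟩, Fin.card_Ioi]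
      omega
    have h3 : (((Finset.Ioi l).image κ).filter (· < κ l)).card = m - (l : ℕ) := by
      rw [card_image_filter hκ,
        show Finset.univ.filter (fun x => l < x ∧ κ x < κ l) = Finset.Ioi l by
          ext x
          simp [hκ.lt_iff_gt], Fin.card_Ioi]
      omega
    omega
  rw [reducedLeg, card_image_filter hκ, legLength]
  refine Eq.trans (congrArg₂ (· + ·) ?_ (Finset.card_eq_zero.2
    (Finset.filter_eq_empty_iff.2 ?_))) (add_zero _)
  · congr 1
    ext l
    simp only [Finset.mem_filter, Finset.mem_univ, true_and]
    constructor
    · rintro ⟨h1, h2, -⟩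
      rw [hcard h1]
      exact ⟨h1, by omega⟩
    · rintro ⟨h1, h2⟩
      rw [hcard h1] at h2
      exact ⟨h1, by omega, hanti h1⟩
  · rintro l - ⟨h1, -, h2⟩
    have := hanti h1
    omega

/-- Row by row, this is `prod_columns_identity` with `B` the set of parts below the row and columns
counted from zero; `(q t) ^ l = q ^ l t ^ l` moves the leg into the exponent of `q`. -/
theorem dConst'_rev_mul_hConst (q t : k) {κ : Fin (m + 1) → ℕ} (hκ : StrictAnti κ) :
    dConst' (fun i => κ (Fin.revPerm i)) q t *
        hConst (fun i => κ i - (m - (i : ℕ))) q (q * t) =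
      dConst κ q t * dConst' (fun i => κ i - (m - (i : ℕ))) q (q * t) := by
  rw [dConst', ← Equiv.prod_comp Fin.revPerm, hConst, dConst, dConst', ← Finset.prod_mul_distrib,
    ← Finset.prod_mul_distrib]
  refine Finset.prod_congr rfl fun i _ => ?_
  have h0 : κ (Fin.revPerm (Fin.revPerm i)) = κ i := by simp
  have hB : (Finset.Ioi i).image κ ⊆ Finset.range (κ i) := fun b hb => by
    obtain ⟨l, hl, rfl⟩ := Finset.mem_image.1 hb
    exact Finset.mem_range.2 (hκ (Finset.mem_Ioi.1 hl))
  have hcard : ((Finset.Ioi i).image κ).card = m - (i : ℕ) := by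
    rw [Finset.card_image_of_injective _ hκ.injective, Fin.card_Ioi]
    omega
  have hshift (F : ℕ → k) (a : ℕ) :
      ∏ j ∈ Finset.Icc 1 a, F j = ∏ j ∈ Finset.range a, F (j + 1) := by
    rw [Finset.range_eq_Ico, Finset.prod_Ico_add' F 0 a 1, zero_add]
    rfl
  have key := prod_columns_identity hB fun x y => 1 - q ^ x * t ^ y
  rw [hcard] at key
  rw [h0, hshift, hshift (fun j => 1 - q ^ (κ i - j + 1) * t ^ (legLength κ i j + 1))]
  refine Eq.trans (congrArg₂ _ ?_ ?_) (key.trans (congrArg₂ _ ?_ ?_))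
  · refine Finset.prod_congr rfl fun j hj => ?_
    rw [Finset.mem_range] at hj
    rw [legLength_comp_rev hκ, show κ i - (j + 1) + 1 = κ i - j by omega]
  · refine Finset.prod_congr rfl fun s hs => ?_
    rw [Finset.mem_Icc] at hs
    rw [legLength_sub hκ i hs.1, mul_pow, ← mul_assoc, ← pow_add, add_right_comm _ 1, add_assoc]
  · refine Finset.prod_congr rfl fun j hj => ?_
    rw [Finset.mem_range] at hj
    rw [legLength_of_strictAnti hκ, show κ i - (j + 1) + 1 = κ i - j by omega]
  · refine Finset.prod_congr rfl fun s hs => ?_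
    rw [Finset.mem_Icc] at hs
    rw [legLength_sub hκ i hs.1, mul_pow, ← mul_assoc, ← pow_add]

end Constants

/-! ### The normalisation of the antisymmetrised nonsymmetric polynomials -/

section Normalisation

variable {k : Type*} [Field k] {m : ℕ}

theorem antisymmetrizer_demazureLustig [CharZero k] {t : k} (ht : t ≠ 0) (i : Fin m)
    (E : RatFun k (m + 1)) :
    antisymmetrizer m t (demazureLustig t i E) = -antisymmetrizer m t E := by
  rw [← Module.End.mul_apply, antisymmetrizer_mul_demazureLustig ht, LinearMap.neg_apply]

theorem simpleSwap_ne (i : Fin m) : i.castSucc ≠ i.succ := i.castSucc_lt_succ.ne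

/-- With `r = e_{i+1} / e_i` the scalar is `-(1 - r / t) / (1 - r)`, the negative of the quotient in
`dConst'_swap`. -/
theorem mul_dConst'_swap {q t : k} (ht : t ≠ 0) (hg : Generic q t) {i : Fin m}
    {η : Fin (m + 1) → ℕ} (h : η i.castSucc < η i.succ) :
    t⁻¹ * ((t - 1) / (eigenRatio q t i η - 1) - 1) * dConst' η q t =
      -dConst' (fun j => η (simpleSwap i j)) q t := by
  have h1 := dConst'_swap q t h
  have hr := eigenRatio_ne_one hg h
  have hr1 : eigenRatio q t i η - 1 ≠ 0 := sub_ne_zero.2 hr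
  have h2 : eigenRatio q t i η = q ^ (η i.succ - η i.castSucc) *
      t ^ (legColength η i.castSucc - legColength η i.succ - 1) * t := by
    have := legColength_lt h
    rw [eigenRatio, mul_assoc, ← pow_succ, Nat.sub_add_cancel (by omega)]
  rw [← eigenRatio] at h1
  rw [div_sub_one hr1, ← mul_div_assoc, div_mul_eq_mul_div, div_eq_iff hr1, neg_mul, mul_assoc,
    inv_mul_eq_iff_eq_mul₀ ht]
  linear_combination -t * h1 - dConst' η q t * h2

theorem eq_comp_rev_of_monotone {κ : Fin (m + 1) → ℕ} (hκ : StrictAnti κ)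
    {σ : Perm (Fin (m + 1))} (h : Monotone fun i => κ (σ i)) : σ = Fin.revPerm := by
  have hrev : Monotone fun i : Fin (m + 1) => κ (Fin.revPerm i) := fun i j hij =>
    hκ.antitone (Fin.rev_le_rev.2 hij)
  have hs : ∑ i, κ (Fin.revPerm i) = ∑ i, κ (σ i) := by
    rw [Equiv.sum_comp σ κ, Equiv.sum_comp Fin.revPerm κ]
  have he (c : ℕ) : excess (fun i => κ (Fin.revPerm i)) 0 c = excess (fun i => κ (σ i)) 0 c := by
    rw [excess_zero_comp, excess_zero_comp]
  have := DomLE.antisymm (domLE_of_monotone h hs fun c => (he c).le)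
    (domLE_of_monotone hrev hs.symm fun c => (he c).ge)
  ext i
  rw [hκ.injective (congr_fun this i)]

/-- Induction along `RefLT` from the increasing arrangement. Each exchange changes the sign of `σ`
and multiplies `U⁻ E` by the negative quotient of the constants `d'`. -/
theorem antisymmetrizer_isTriangularEigen [CharZero k] {q : kˣ} {t : k} (ht : t ≠ 0)
    (hqt : Admissible (q : k) t) {κ : Fin (m + 1) → ℕ} (hκ : StrictAnti κ)
    {S : RatFun k (m + 1)} (hS : IsAntisymmetric q t κ S) (σ : Perm (Fin (m + 1)))
    {E : RatFun k (m + 1)} (hE : IsTriangularEigen q t (fun i => κ (σ i)) E) :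
    antisymmetrizer m t E = (((Perm.sign σ : ℤ) : k) *
      (dConst' (fun i => κ (σ i)) (q : k) t *
        hConst (fun i => κ i - (m - (i : ℕ))) (q : k) (q * t)) /
      (dConst κ (q : k) t * dConst' (fun i => κ i - (m - (i : ℕ))) (q : k) (q * t))) • S := by
  have hg := hqt.generic
  suffices H : ∀ η : Fin (m + 1) → ℕ, ∀ σ : Perm (Fin (m + 1)), η = (fun i => κ (σ i)) →
      ∀ E, IsTriangularEigen q t η E → antisymmetrizer m t E = (((Perm.sign σ : ℤ) : k) *
        (dConst' η (q : k) t * hConst (fun i => κ i - (m - (i : ℕ))) (q : k) (q * t)) /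
        (dConst κ (q : k) t * dConst' (fun i => κ i - (m - (i : ℕ))) (q : k) (q * t))) • S from
    H _ σ rfl E hE
  clear hE E σ
  intro η
  induction η using refLT_induction with
  | h η ih =>
  intro σ hη E hE
  by_cases hmono : Monotone η
  · subst hη
    obtain rfl := eq_comp_rev_of_monotone hκ hmono
    rw [dConst'_rev_mul_hConst _ _ hκ, mul_div_cancel_right₀ _
      (mul_ne_zero (dConst_ne_zero hg _) (dConst'_mul_ne_zero hg _)),
      hS.unique ht hqt hκ (hE.isAntisymmetric ht hκ)]
    rcases Int.units_eq_one_or (Perm.sign (Fin.revPerm : Perm (Fin (m + 1)))) with h | h <;>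
      simp [h]
  · rw [Fin.monotone_iff_le_succ] at hmono
    push Not at hmono
    obtain ⟨i, hi⟩ := hmono
    set ν : Fin (m + 1) → ℕ := fun j => η (simpleSwap i j) with hν
    have hνη : (fun j => ν (simpleSwap i j)) = η := by
      ext j; rw [hν]; simp only [simpleSwap_simpleSwap]
    have hlt : ν i.castSucc < ν i.succ := by
      simp only [hν, simpleSwap_castSucc, simpleSwap_succ]; exact hi
    obtain ⟨F, hF⟩ := exists_isTriangularEigen ht hg ν
    have hFE := hF.swap ht hg hlt
    have href := refLT_swap hlt
    have hd := mul_dConst'_swap ht hg hlt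
    rw [hνη] at hFE href hd
    have ihF := ih ν href (σ * simpleSwap i) (by rw [hν, hη]; rfl) F hF
    -- Because `U⁻ T_i = -U⁻`, the operator `T_i + c` acts under `U⁻` as the scalar `c - 1`.
    have hsub (c : k) (f : RatFun k (m + 1)) : -f + c • f = (c - 1) • f := by
      rw [sub_smul, one_smul, neg_add_eq_sub]
    rw [IsNonsymmetric.unique ht hg hE.isNonsymmetric hFE.isNonsymmetric, map_smul, map_add,
      antisymmetrizer_demazureLustig ht, map_smul, hsub, smul_smul, ihF,
      smul_smul, Perm.sign_mul, simpleSwap, Perm.sign_swap (simpleSwap_ne i)]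
    congr 1
    simp only [Units.val_neg, mul_neg, mul_one, Int.cast_neg]
    rw [← mul_div_assoc]
    congr 1
    linear_combination -(((Perm.sign σ : ℤ) : k) *
      hConst (fun i => κ i - (m - (i : ℕ))) (q : k) (q * t)) * hd

end Normalisation

end Macdonald

/-! ### The theorem -/

theorem lemma2 {K : Type*} [Field K] [CharZero K] (m : ℕ) (q t : Kˣ)
    (hqt : Macdonald.Admissible (q : K) (t : K)) :
    -- a) the identity in `K(y)(x)`; here `L = K(y)`, `s = t ∈ L` and `y i = y_i ∈ L`
    (let L := Macdonald.RatFun K (m + 1)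
     let s : L := Macdonald.const (t : K)
     let y : Fin (m + 1) → L := fun i => Macdonald.var K i
     let x : Fin (m + 1) → Macdonald.RatFun L (m + 1) := fun i => Macdonald.var L i
     let c : L → Macdonald.RatFun L (m + 1) := Macdonald.const
     Macdonald.antisymmetrizer m s
        ((∏ i, 1 / (1 - c s * x i * c (y i))) *
          ∏ i, ∏ j ∈ Finset.univ.filter (fun j => j < i),
            (1 - x i * c (y j)) / (1 - c s * x i * c (y j))) =
      c (Macdonald.delta s⁻¹ y) * Macdonald.delta (c s) x /
        ∏ i, ∏ j, (1 - c s * x i * c (y j))) ∧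
    -- b) `κ = η⁺` is a partition with distinct parts and `η = σ(κ)`
    (∀ (κ : Fin (m + 1) → ℕ), StrictAnti κ → ∀ σ : Equiv.Perm (Fin (m + 1)),
      (∃! E, Macdonald.IsNonsymmetric q (t : K) (fun i => κ (σ⁻¹ i)) E) ∧
      (∃! S, Macdonald.IsAntisymmetric q (t : K) κ S) ∧
      ∀ E S : Macdonald.RatFun K (m + 1),
        Macdonald.IsNonsymmetric q (t : K) (fun i => κ (σ⁻¹ i)) E →
        Macdonald.IsAntisymmetric q (t : K) κ S →
        ∀ β : K,
          S = β⁻¹ • Macdonald.antisymmetrizer m (t : K) E ↔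
          β = (-1) ^ Macdonald.permLength σ *
            (Macdonald.dConst' (fun i => κ (σ⁻¹ i)) (q : K) (t : K) *
              Macdonald.hConst (fun i => κ i - (m - (i : ℕ))) (q : K) ((q : K) * (t : K))) /
            (Macdonald.dConst κ (q : K) (t : K) *
              Macdonald.dConst' (fun i => κ i - (m - (i : ℕ))) (q : K) ((q : K) * (t : K)))) := by
  refine ⟨Macdonald.antisymmetrizer_cauchyKernel m t, fun κ hκ σ => ?_⟩
  have ht : (t : K) ≠ 0 := t.ne_zero
  have hg := hqt.generic
  obtain ⟨E, hE⟩ := Macdonald.exists_isTriangularEigen (q := q) ht hg fun i => κ (σ⁻¹ i)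
  obtain ⟨S, hS⟩ := Macdonald.exists_isAntisymmetric (q := q) ht hg hκ
  refine ⟨⟨E, hE.isNonsymmetric, fun E' hE' => hE'.unique ht hg hE.isNonsymmetric⟩,
    ⟨S, hS, fun S' hS' => hS'.unique ht hqt hκ hS⟩, fun E' S' hE' hS' β => ?_⟩
  -- The composition `σ(κ)` is `κ ∘ σ⁻¹`, and `σ⁻¹` has the sign of `σ`.
  have hsign : (((Equiv.Perm.sign σ⁻¹ : ℤˣ) : ℤ) : K) = (-1) ^ Macdonald.permLength σ := by
    rw [Equiv.Perm.sign_inv, Macdonald.sign_eq_neg_one_pow_permLength]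
    simp
  have hS0 := hS'.ne_zero ht hκ
  rw [hE'.unique ht hg hE.isNonsymmetric,
    Macdonald.antisymmetrizer_isTriangularEigen ht hqt hκ hS' σ⁻¹ hE, hsign, smul_smul]
  generalize hb : (-1 : K) ^ Macdonald.permLength σ * (_ * _) / (_ * _) = b
  have hb0 : b ≠ 0 := by
    rw [← hb]
    exact div_ne_zero (mul_ne_zero (pow_ne_zero _ (neg_ne_zero.2 one_ne_zero))
      (mul_ne_zero (Macdonald.dConst'_ne_zero hg _) (Macdonald.hConst_mul_ne_zero hg _)))
      (mul_ne_zero (Macdonald.dConst_ne_zero hg _) (Macdonald.dConst'_mul_ne_zero hg _))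
  constructor
  · intro h
    have h1 : (1 - β⁻¹ * b) • S' = 0 := by rw [sub_smul, one_smul, ← h, sub_self]
    have h2 := sub_eq_zero.1 ((smul_eq_zero.1 h1).resolve_right hS0)
    -- With the convention `0⁻¹ = 0` the value `β = 0` would give `S = 0`, contrary to `hS0`.
    have hβ : β ≠ 0 := by
      rintro rfl
      simp at h2
    rw [eq_comm, inv_mul_eq_iff_eq_mul₀ hβ, mul_one] at h2
    exact h2.symm
  · rintro rfl
    rw [inv_mul_cancel₀ hb0, one_smul]
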